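/- Let $\alpha,\beta>0$ and $w(x,\alpha,\beta)=x^{\alpha}(1-x)^{\beta}$ for $x\in[0,1]$. For $0\le t\le 1$ and $n\ge 1$ let $$\mathbb P(t,\alpha,\beta,n)=\frac{\frac1{n!}\int_{(t,1)^n}\prod_{1\le i<j\le n}(x_j-x_i)^2\prod_{k=1}^n w(x_k,\alpha,\beta)\,dx_k}{\frac1{n!}\int_{(0,1)^n}\prod_{1\le i<j\le n}(x_j-x_i)^2\prod_{k=1}^n w(x_k,\alpha,\beta)\,dx_k}$$ be the probability that all $n$ eigenvalues of the Jacobi unitary ensemble with weight $w$ lie between $t$ and $1$. Then for every $s\ge 0$ the limit $$\mathbb P(s,\alpha,\beta):=\lim_{n\to\infty}\mathbb P\!\left(\frac{s}{4n^2},\alpha,\beta,n\right)$$ exists and is positive. The function $s\mapsto\log\mathbb P(s,\alpha,\beta)$ is differentiable on $(0,\infty)$, and $$\sigma(s):=s\,\frac{d}{ds}\log\mathbb P(s,\alpha,\beta)\quad(s>0),\qquad \sigma(0):=0,$$ is twice differentiable on $(0,\infty)$ and satisfies there the Jimbo–Miwa–Okamoto $\sigma$-form of Painlevé III $$(s\sigma'')^2+\sigma'(4\sigma'+1)(s\sigma'-\sigma)-\alpha^2(\sigma')^2=0,$$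 an equation in which the parameter $\beta$ does not appear. Moreover the initial conditions $\sigma(0)=\sigma'(0)=0$ hold, in the sense that $\sigma(s)\to 0$ and $\sigma'(s)\to 0$ as $s\to 0^+$, and the right derivative of $\sigma$ at $0$ exists and equals $0$. -/

import Mathlib

open Filter Topology

noncomputable section

/-- The (shifted) Jacobi weight `x ^ α * (1 - x) ^ β`; it is only used for `x` in `[0, 1]`. -/
def jacobiWeight (α β x : ℝ) : ℝ := x ^ α * (1 - x) ^ β

/-- The integral
`(1 / n!) ∫_{(t,1)^n} ∏_{i<j} (x_j - x_i)^2 ∏_k w(x_k, α, β) dx_1 ⋯ dx_n`. -/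
def jacobiPartition (t α β : ℝ) (n : ℕ) : ℝ :=
  1 / (n.factorial : ℝ) *
    ∫ x in Set.univ.pi (fun _ : Fin n => Set.Ioo t 1),
      (∏ i : Fin n, ∏ j ∈ Finset.Ioi i, (x j - x i) ^ 2) *
        ∏ k : Fin n, jacobiWeight α β (x k)

/-- The probability that all `n` eigenvalues of the Jacobi unitary ensemble with weight
`x ^ α * (1 - x) ^ β` on `[0, 1]` lie between `t` and `1` (meaningful for `0 ≤ t ≤ 1`). -/
def jacobiProb (t α β : ℝ) (n : ℕ) : ℝ :=
  jacobiPartition t α β n / jacobiPartition 0 α β n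

/-- The double-scaled probability: the limit as `n → ∞` of the probability at
`t = s / (4 n ^ 2)`, for fixed `s`. -/
def scaledProb (s α β : ℝ) : ℝ :=
  limUnder atTop (fun n : ℕ => jacobiProb (s / (4 * (n : ℝ) ^ 2)) α β n)

/-- The function `σ(s) = s * d/ds log P(s, α, β)`. -/
def sigmaFn (α β s : ℝ) : ℝ :=
  s * deriv (fun u : ℝ => Real.log (scaledProb u α β)) s

end

open Polynomial

/-! ### The weight and its moment functional -/

/-! The argument has an algebraic half, an exact differential equation for every finite `n`, and an
analytic half, a limit strong enough to carry that equation over.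

Algebra. By Heine–Andréief the integral over `(t, 1)^n` is a Hankel determinant, hence a product of
norms `h_k(t)` of the monic orthogonal polynomials `P_k` on `(t, 1)`. Integration by parts shows
that `t (1 - t) d/dt log det` is affine in `c(t)`, the subleading coefficient of `P_n`
(`hasDerivAt_log_det_jacobiHankel`). The operator `x (1 - x) ∂_x + t (1 - t) ∂_t` acts on the pair
`(P_{k+1}, P_k)` by a 2×2 matrix polynomial in `x` (`jopEuler_succ`, `jopEuler_eq`). At `x = 0` and
`x = 1` the `∂_x` term disappears, and after the `∂_t` term is rewritten by Christoffel–Darboux a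
matrix is left that kills the nonzero vector `(P_{k+1}(x), P_k(x))`. The two vanishing determinants
eliminate all unknowns except `c`, `c'`, `c''`, giving an equation of Painlevé VI type
(`jopSub_painleve`). In the variable `s = 4 n² t` its coefficients are polynomial in `ν = 1 / n`;
the parameter `β` always carries a factor `ν`, and at `ν = 0` the equation is Painlevé III
(`sigmaDefect_zero`).

Analysis. The probability is `det(1 - C M)`, where `C` is the inverse Hankel matrix on `(0, 1)`,
explicit through Jacobi polynomials, and `M` holds the moments over `(0, t)`. After scaling and a
diagonal conjugation the entries extend to holomorphic functions of `s` in a half disc of radius `2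
n²`, converge, and obey a separable summable bound, so the determinants converge locally uniformly
in the right half plane (`exists_tendsto_edgeDet`). All derivatives then converge, and so does the
equation, provided that the limit does not vanish; this comes from a lower bound independent of `n`,
due to extremality of monic orthogonal polynomials (`exp_le_jacobiProb`). The initial conditions
follow from `|F(z) - 1| ≤ C |z|^(α+1)` and Cauchy estimates. -/

lemma continuous_jacobiWeight {α β : ℝ} (hα : 0 < α) (hβ : 0 < β) :
    Continuous (jacobiWeight α β) := by
  unfold jacobiWeight
  exact (continuous_id.rpow_const fun _ => Or.inr hα.le).mul
    ((continuous_const.sub continuous_id).rpow_const fun _ => Or.inr hβ.le)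

lemma jacobiWeight_pos {α β x : ℝ} (h0 : 0 < x) (h1 : x < 1) : 0 < jacobiWeight α β x :=
  mul_pos (Real.rpow_pos_of_pos h0 _) (Real.rpow_pos_of_pos (sub_pos.2 h1) _)

lemma jacobiWeight_nonneg {α β x : ℝ} (h0 : 0 ≤ x) (h1 : x ≤ 1) : 0 ≤ jacobiWeight α β x :=
  mul_nonneg (Real.rpow_nonneg h0 _) (Real.rpow_nonneg (sub_nonneg.2 h1) _)

/-- The derivative of `x (1 - x) w(x)`. -/
lemma hasDerivAt_mul_jacobiWeight {α β x : ℝ} (h0 : 0 < x) (h1 : x < 1) :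
    HasDerivAt (fun y => y * (1 - y) * jacobiWeight α β y)
      ((α + 1 - (α + β + 2) * x) * jacobiWeight α β x) x := by
  unfold jacobiWeight
  have h1' : (0 : ℝ) < 1 - x := sub_pos.2 h1
  have hd := (((hasDerivAt_id x).mul ((hasDerivAt_id x).const_sub 1)).mul
    (((hasDerivAt_id x).rpow_const (p := α) (Or.inl h0.ne')).mul
      (((hasDerivAt_id x).const_sub 1).rpow_const (p := β) (Or.inl h1'.ne'))))
  refine HasDerivAt.congr_deriv hd ?_
  simp only [id, Pi.mul_apply]
  rw [Real.rpow_sub_one h0.ne', Real.rpow_sub_one h1'.ne']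
  field_simp
  ring

/-- Integration over `(t, 1)` against the Jacobi weight, as a functional on polynomials. -/
noncomputable def jacobiL (α β t : ℝ) (f : ℝ[X]) : ℝ :=
  ∫ x in t..1, f.eval x * jacobiWeight α β x

section functional

variable {α β t : ℝ}

lemma continuous_eval_mul_jacobiWeight (hα : 0 < α) (hβ : 0 < β) (f : ℝ[X]) :
    Continuous fun x => f.eval x * jacobiWeight α β x :=
  f.continuous.mul (continuous_jacobiWeight hα hβ)

lemma jacobiL_add (hα : 0 < α) (hβ : 0 < β) (f g : ℝ[X]) :
    jacobiL α β t (f + g) = jacobiL α β t f + jacobiL α β t g := by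
  unfold jacobiL
  rw [← intervalIntegral.integral_add
    ((continuous_eval_mul_jacobiWeight hα hβ f).intervalIntegrable _ _)
    ((continuous_eval_mul_jacobiWeight hα hβ g).intervalIntegrable _ _)]
  simp [add_mul]

lemma jacobiL_smul (c : ℝ) (f : ℝ[X]) : jacobiL α β t (C c * f) = c * jacobiL α β t f := by
  unfold jacobiL
  rw [← intervalIntegral.integral_const_mul]
  simp [mul_assoc]

lemma jacobiL_zero : jacobiL α β t 0 = 0 := by simp [jacobiL]

lemma jacobiL_neg (f : ℝ[X]) : jacobiL α β t (-f) = -jacobiL α β t f := by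
  simpa using jacobiL_smul (α := α) (β := β) (t := t) (-1) f

lemma jacobiL_sub (hα : 0 < α) (hβ : 0 < β) (f g : ℝ[X]) :
    jacobiL α β t (f - g) = jacobiL α β t f - jacobiL α β t g := by
  rw [sub_eq_add_neg, jacobiL_add hα hβ, jacobiL_neg, sub_eq_add_neg]

lemma jacobiL_sum (hα : 0 < α) (hβ : 0 < β) {ι : Type*} (s : Finset ι) (f : ι → ℝ[X]) :
    jacobiL α β t (∑ i ∈ s, f i) = ∑ i ∈ s, jacobiL α β t (f i) := by
  classical
  induction s using Finset.induction_on with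
  | empty => simp [jacobiL_zero]
  | insert a s ha ih => rw [Finset.sum_insert ha, Finset.sum_insert ha, jacobiL_add hα hβ, ih]

lemma jacobiL_mul_self_pos (hα : 0 < α) (hβ : 0 < β) (h0 : 0 ≤ t) (h1 : t < 1) {f : ℝ[X]}
    (hf : f ≠ 0) : 0 < jacobiL α β t (f * f) := by
  unfold jacobiL
  have hinf : (Set.Ioo t 1).Infinite := Set.Ioo_infinite h1
  obtain ⟨c, hc, hcf⟩ : ∃ c ∈ Set.Ioo t 1, f.eval c ≠ 0 := by
    by_contra! h
    exact hinf ((f.rootSet_finite ℝ).subset fun x hx => by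
      rw [Polynomial.mem_rootSet]; exact ⟨hf, by simpa using h x hx⟩)
  refine intervalIntegral.integral_pos h1
    (continuous_eval_mul_jacobiWeight hα hβ _).continuousOn (fun x hx => ?_) ⟨c, ⟨hc.1.le, hc.2.le⟩, ?_⟩
  · rw [eval_mul]
    exact mul_nonneg (mul_self_nonneg _) (jacobiWeight_nonneg (h0.trans hx.1.le) hx.2)
  · rw [eval_mul]
    exact mul_pos (mul_self_pos.2 hcf) (jacobiWeight_pos (h0.trans_lt hc.1) hc.2)

/-- The first-order operator `f ↦ x (1 - x) f' + (α + 1 - (α + β + 2) x) f`, whose product with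
the weight is the derivative of `x (1 - x) w f`. -/
noncomputable def pearson (α β : ℝ) (f : ℝ[X]) : ℝ[X] :=
  X * (1 - X) * derivative f + (C (α + 1) - C (α + β + 2) * X) * f

/-- The integrand is the derivative of `x (1 - x) w f`. The factor `1 - x` kills the end at `1`, so
the only boundary contribution is at the moving endpoint `t`. -/
lemma jacobiL_pearson (hα : 0 < α) (hβ : 0 < β) (h0 : 0 ≤ t) (h1 : t ≤ 1) (f : ℝ[X]) :
    jacobiL α β t (pearson α β f) = -(t * (1 - t) * jacobiWeight α β t) * f.eval t := by
  have hc := continuous_jacobiWeight hα hβ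
  have := intervalIntegral.integral_eq_sub_of_hasDerivAt_of_le (a := t) (b := 1)
    (f := fun y => y * (1 - y) * jacobiWeight α β y * f.eval y)
    (f' := fun x => (pearson α β f).eval x * jacobiWeight α β x) h1
    (((continuous_id.mul (continuous_const.sub continuous_id)).mul hc).mul f.continuous).continuousOn
    (fun x hx => by
      refine ((hasDerivAt_mul_jacobiWeight (h0.trans_lt hx.1) hx.2).mul
        (f.hasDerivAt x)).congr_deriv ?_
      simp [pearson]; ring)
    ((continuous_eval_mul_jacobiWeight hα hβ _).intervalIntegrable _ _)
  unfold jacobiL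
  rw [this]; simp

lemma hasDerivAt_jacobiL (hα : 0 < α) (hβ : 0 < β) (f : ℝ[X]) :
    HasDerivAt (fun u => jacobiL α β u f) (-(jacobiWeight α β t * f.eval t)) t := by
  have hc := continuous_eval_mul_jacobiWeight hα hβ f
  have := intervalIntegral.integral_hasDerivAt_left (hc.intervalIntegrable t 1)
    (hc.stronglyMeasurableAtFilter _ _) hc.continuousAt
  simpa [jacobiL, mul_comm] using this

end functional

/-! ### Polynomials depending differentiably on a parameter -/

/-- Coefficientwise differentiability of a family of polynomials of bounded degree. -/
structure PolyHasDerivAt (p : ℝ → ℝ[X]) (p' : ℝ[X]) (t : ℝ) : Prop where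
  bdd : ∃ N, ∀ u, (p u).natDegree ≤ N
  coeff : ∀ i, HasDerivAt (fun u => (p u).coeff i) (p'.coeff i) t

namespace PolyHasDerivAt

variable {p q : ℝ → ℝ[X]} {p' q' : ℝ[X]} {t : ℝ}

lemma const (f : ℝ[X]) : PolyHasDerivAt (fun _ => f) 0 t :=
  ⟨⟨f.natDegree, fun _ => le_rfl⟩, fun i => by simpa using hasDerivAt_const t (f.coeff i)⟩

lemma add (hp : PolyHasDerivAt p p' t) (hq : PolyHasDerivAt q q' t) :
    PolyHasDerivAt (fun u => p u + q u) (p' + q') t := by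
  obtain ⟨N, hN⟩ := hp.bdd
  obtain ⟨M, hM⟩ := hq.bdd
  exact ⟨⟨max N M, fun u => (natDegree_add_le _ _).trans (max_le_max (hN u) (hM u))⟩,
    fun i => by simpa using (hp.coeff i).fun_add (hq.coeff i)⟩

lemma mul (hp : PolyHasDerivAt p p' t) (hq : PolyHasDerivAt q q' t) :
    PolyHasDerivAt (fun u => p u * q u) (p' * q t + p t * q') t := by
  obtain ⟨N, hN⟩ := hp.bdd
  obtain ⟨M, hM⟩ := hq.bdd
  refine ⟨⟨N + M, fun u => natDegree_mul_le.trans (add_le_add (hN u) (hM u))⟩, fun i => ?_⟩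
  simp only [coeff_add, coeff_mul, ← Finset.sum_add_distrib]
  exact HasDerivAt.fun_sum fun x _ => (hp.coeff x.1).mul (hq.coeff x.2)

lemma C {a : ℝ → ℝ} {a' : ℝ} (ha : HasDerivAt a a' t) :
    PolyHasDerivAt (fun u => Polynomial.C (a u)) (Polynomial.C a') t := by
  refine ⟨⟨0, fun u => by simp⟩, fun i => ?_⟩
  simp only [coeff_C]
  split_ifs
  · exact ha
  · exact hasDerivAt_const t 0

lemma neg (hp : PolyHasDerivAt p p' t) : PolyHasDerivAt (fun u => -p u) (-p') t := by
  obtain ⟨N, hN⟩ := hp.bdd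
  exact ⟨⟨N, fun u => by simpa using hN u⟩, fun i => by simpa using (hp.coeff i).fun_neg⟩

lemma sub (hp : PolyHasDerivAt p p' t) (hq : PolyHasDerivAt q q' t) :
    PolyHasDerivAt (fun u => p u - q u) (p' - q') t := by
  simpa [sub_eq_add_neg] using hp.add hq.neg

/-- Coefficients beyond the uniform degree bound vanish identically, hence so do their derivatives.
Evaluation and integration thus become sums over an index range that does not depend on the
parameter. -/
lemma exists_bound (hp : PolyHasDerivAt p p' t) :
    ∃ N, (∀ u, (p u).natDegree < N) ∧ p'.natDegree < N := by
  obtain ⟨N, hN⟩ := hp.bdd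
  refine ⟨N + 1, fun u => Nat.lt_succ_of_le (hN u), Nat.lt_succ_of_le ?_⟩
  refine natDegree_le_iff_coeff_eq_zero.2 fun i hi => ?_
  have h := hp.coeff i
  have h0 : (fun u => (p u).coeff i) = fun _ => 0 :=
    funext fun u => coeff_eq_zero_of_natDegree_lt ((hN u).trans_lt hi)
  rw [h0] at h
  exact h.unique (hasDerivAt_const t 0)

/-- Locally constant top coefficients have derivative zero; for a monic family the derivative
therefore drops in degree. -/
lemma degree_lt (hp : PolyHasDerivAt p p' t) {k : ℕ}
    (h : ∀ i, k ≤ i → ∀ᶠ u in 𝓝 t, (p u).coeff i = (p t).coeff i) : p'.degree < k := by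
  refine (degree_lt_iff_coeff_zero _ _).2 fun i hi => ?_
  refine (hp.coeff i).unique ?_
  exact (hasDerivAt_const t ((p t).coeff i)).congr_of_eventuallyEq (h i hi)

lemma eval_diag (hp : PolyHasDerivAt p p' t) :
    HasDerivAt (fun u => (p u).eval u) (p'.eval t + (derivative (p t)).eval t) t := by
  obtain ⟨N, hN, hN'⟩ := hp.exists_bound
  have h1 : (fun u => (p u).eval u) = fun u => ∑ i ∈ Finset.range N, (p u).coeff i * u ^ i :=
    funext fun u => eval_eq_sum_range' (hN u) u
  have hd : (derivative (p t)).eval t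
      = ∑ i ∈ Finset.range N, (p t).coeff i * (i * t ^ (i - 1)) := by
    conv_lhs => rw [(p t).as_sum_range' N (hN t)]
    simp [eval_finsetSum, derivative_monomial, mul_assoc]
  rw [h1, hd, eval_eq_sum_range' hN' t, ← Finset.sum_add_distrib]
  exact HasDerivAt.fun_sum fun i _ => (hp.coeff i).mul (hasDerivAt_pow i t)

lemma jacobiL {α β : ℝ} (hα : 0 < α) (hβ : 0 < β) (hp : PolyHasDerivAt p p' t) :
    HasDerivAt (fun u => jacobiL α β u (p u))
      (_root_.jacobiL α β t p' - jacobiWeight α β t * (p t).eval t) t := by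
  obtain ⟨N, hN, hN'⟩ := hp.exists_bound
  have key : ∀ u (f : ℝ[X]), f.natDegree < N →
      _root_.jacobiL α β u f = ∑ i ∈ Finset.range N, f.coeff i * _root_.jacobiL α β u (X ^ i) := by
    intro u f hf
    conv_lhs => rw [f.as_sum_range_C_mul_X_pow' hf, jacobiL_sum hα hβ]
    simp [jacobiL_smul]
  have h1 : (fun u => _root_.jacobiL α β u (p u)) = fun u =>
      ∑ i ∈ Finset.range N, (p u).coeff i * _root_.jacobiL α β u (X ^ i) :=
    funext fun u => key u _ (hN u)
  rw [h1, key t p' hN', eval_eq_sum_range' (hN t) t, Finset.mul_sum, ← Finset.sum_sub_distrib]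
  refine HasDerivAt.fun_sum fun i _ => ?_
  refine ((hp.coeff i).mul (hasDerivAt_jacobiL hα hβ (X ^ i))).congr_deriv ?_
  simp; ring

end PolyHasDerivAt

/-! ### Orthogonal polynomials on `(t, 1)` -/

/-- The monic orthogonal polynomials for the Jacobi weight on `(t, 1)`, by their three-term
recurrence. -/
noncomputable def jop (α β t : ℝ) : ℕ → ℝ[X]
  | 0 => 1
  | 1 => X - C (jacobiL α β t X / jacobiL α β t 1)
  | k + 2 =>
      (X - C (jacobiL α β t (X * (jop α β t (k + 1) * jop α β t (k + 1))) /
        jacobiL α β t (jop α β t (k + 1) * jop α β t (k + 1)))) * jop α β t (k + 1) -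
      C (jacobiL α β t (jop α β t (k + 1) * jop α β t (k + 1)) /
        jacobiL α β t (jop α β t k * jop α β t k)) * jop α β t k

/-- The squared norm of the `k`-th monic orthogonal polynomial. -/
noncomputable def jopNorm (α β t : ℝ) (k : ℕ) : ℝ :=
  jacobiL α β t (jop α β t k * jop α β t k)

/-- The diagonal recurrence coefficient. -/
noncomputable def jopDiag (α β t : ℝ) (k : ℕ) : ℝ :=
  jacobiL α β t (X * (jop α β t k * jop α β t k)) / jopNorm α β t k

/-- The coefficient of degree `k - 1` of the `k`-th monic orthogonal polynomial. -/
noncomputable def jopSub (α β t : ℝ) : ℕ → ℝ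
  | 0 => 0
  | k + 1 => (jop α β t (k + 1)).coeff k

section

variable {α β t : ℝ}

lemma jop_zero : jop α β t 0 = 1 := by rw [jop]

lemma jop_one : jop α β t 1 = (X - C (jopDiag α β t 0)) * jop α β t 0 := by
  simp [jop, jopDiag, jopNorm]

lemma jop_add_two (k : ℕ) : jop α β t (k + 2) =
    (X - C (jopDiag α β t (k + 1))) * jop α β t (k + 1) -
      C (jopNorm α β t (k + 1) / jopNorm α β t k) * jop α β t k := by
  rw [jop]; rfl

lemma jop_coeff (k : ℕ) :
    (jop α β t k).coeff k = 1 ∧ ∀ i, k < i → (jop α β t k).coeff i = 0 := by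
  induction k using Nat.twoStepInduction with
  | zero => exact ⟨by simp [jop_zero], fun i hi => by simp [jop_zero, coeff_one, hi.ne']⟩
  | one =>
    refine ⟨by simp [jop_one, jop_zero], fun i hi => ?_⟩
    rw [jop_one, jop_zero, mul_one, coeff_sub, coeff_X_of_ne_one hi.ne', coeff_C,
      if_neg (by omega), sub_zero]
  | more k h0 h1 =>
    have key : ∀ i, (jop α β t (k + 2)).coeff (i + 1) = (jop α β t (k + 1)).coeff i -
        jopDiag α β t (k + 1) * (jop α β t (k + 1)).coeff (i + 1) -
        jopNorm α β t (k + 1) / jopNorm α β t k * (jop α β t k).coeff (i + 1) := fun i => by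
      rw [jop_add_two, sub_mul]; simp
    refine ⟨?_, fun i hi => ?_⟩
    · rw [key, h1.1, h1.2 _ (by omega), h0.2 _ (by omega)]; simp
    · obtain ⟨i, rfl⟩ : ∃ j, i = j + 1 := ⟨i - 1, by omega⟩
      rw [key, h1.2 _ (by omega), h1.2 _ (by omega), h0.2 _ (by omega)]; simp

lemma jop_coeff_self (k : ℕ) : (jop α β t k).coeff k = 1 := (jop_coeff k).1

lemma jop_coeff_of_lt {k i : ℕ} (h : k < i) : (jop α β t k).coeff i = 0 := (jop_coeff k).2 i h

lemma jop_ne_zero (k : ℕ) : jop α β t k ≠ 0 := fun h => by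
  simpa [h] using jop_coeff_self (α := α) (β := β) (t := t) k

lemma jop_natDegree_le (k : ℕ) : (jop α β t k).natDegree ≤ k :=
  natDegree_le_iff_coeff_eq_zero.2 fun _ h => jop_coeff_of_lt h

lemma jop_degree_lt {k n : ℕ} (h : k < n) : (jop α β t k).degree < n :=
  (degree_lt_iff_coeff_zero _ _).2 fun _ hi => jop_coeff_of_lt (h.trans_le hi)

lemma jopSub_zero : jopSub α β t 0 = 0 := rfl

lemma jopDiag_eq (k : ℕ) : jopDiag α β t k = jopSub α β t k - jopSub α β t (k + 1) := by
  rcases k with _ | k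
  · simp [jopSub, jop_one, jop_zero]
  · simp only [jopSub]
    rcases k with _ | k
    · rw [jop_add_two, sub_mul]
      simp [jop_coeff_self, jop_zero]
    · have : (jop α β t (k + 1 + 2)).coeff (k + 1 + 1) = (jop α β t (k + 1 + 1)).coeff (k + 1) -
        jopDiag α β t (k + 1 + 1) := by
        rw [jop_add_two, sub_mul]
        simp [jop_coeff_self, jop_coeff_of_lt]
      rw [this]; ring

lemma jopNorm_pos (hα : 0 < α) (hβ : 0 < β) (h0 : 0 ≤ t) (h1 : t < 1) (k : ℕ) :
    0 < jopNorm α β t k :=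
  jacobiL_mul_self_pos hα hβ h0 h1 (jop_ne_zero k)

lemma X_mul_jop_zero : X * jop α β t 0 = jop α β t 1 + C (jopDiag α β t 0) * jop α β t 0 := by
  rw [jop_one]; ring

lemma X_mul_jop_succ (k : ℕ) : X * jop α β t (k + 1) = jop α β t (k + 2) +
    C (jopDiag α β t (k + 1)) * jop α β t (k + 1) +
      C (jopNorm α β t (k + 1) / jopNorm α β t k) * jop α β t k := by
  rw [jop_add_two]; ring

/-- In the recurrence for the new polynomial, `X` is moved to the other factor and expanded there by
the same recurrence. The two recurrence coefficients are exactly those that cancel the pairings with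
the two preceding polynomials; all lower pairings vanish by induction. -/
lemma jacobiL_jop_mul_jop (hα : 0 < α) (hβ : 0 < β) (h0 : 0 ≤ t) (h1 : t < 1) (n : ℕ) :
    ∀ k ≤ n, ∀ j < k, jacobiL α β t (jop α β t k * jop α β t j) = 0 := by
  have hpos := jopNorm_pos hα hβ h0 h1
  induction n with
  | zero => intro k hk j hj; omega
  | succ n ih =>
    intro k hk j hj
    rcases hk.lt_or_eq with hk | rfl
    · exact ih k (by omega) j hj
    rcases n with _ | n
    · obtain rfl : j = 0 := by omega
      rw [jop_one, show (X - C (jopDiag α β t 0)) * jop α β t 0 * jop α β t 0 =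
        X * (jop α β t 0 * jop α β t 0) - C (jopDiag α β t 0) * (jop α β t 0 * jop α β t 0) by ring,
        jacobiL_sub hα hβ, jacobiL_smul, jopDiag, ← jopNorm, div_mul_cancel₀ _ (hpos 0).ne', sub_self]
    · have hsplit : ∀ j, jacobiL α β t (jop α β t (n + 1 + 1) * jop α β t j) =
          jacobiL α β t (jop α β t (n + 1) * (X * jop α β t j)) -
          jopDiag α β t (n + 1) * jacobiL α β t (jop α β t (n + 1) * jop α β t j) -
          jopNorm α β t (n + 1) / jopNorm α β t n *
            jacobiL α β t (jop α β t n * jop α β t j) := fun j => by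
        rw [← jacobiL_smul, ← jacobiL_smul, ← jacobiL_sub hα hβ, ← jacobiL_sub hα hβ, jop_add_two]
        congr 1; ring
      rw [hsplit]
      rcases (Nat.lt_succ_iff.1 hj).lt_or_eq with hj | rfl
      · have hX : jacobiL α β t (jop α β t (n + 1) * (X * jop α β t j)) =
            jacobiL α β t (jop α β t (n + 1) * jop α β t (j + 1)) := by
          rcases j with _ | j
          · rw [X_mul_jop_zero, mul_add, jacobiL_add hα hβ, mul_left_comm, jacobiL_smul,
              ih _ le_rfl 0 (by omega)]; simp
          · rw [X_mul_jop_succ, mul_add, mul_add, jacobiL_add hα hβ, jacobiL_add hα hβ,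
              mul_left_comm, jacobiL_smul, mul_left_comm _ (C _), jacobiL_smul,
              ih _ le_rfl (j + 1) (by omega), ih _ le_rfl j (by omega)]; simp
        rw [hX, ih _ le_rfl j (by omega)]
        rcases (Nat.lt_succ_iff.1 hj).lt_or_eq with hj | rfl
        · rw [ih _ le_rfl (j + 1) (by omega), ih n (by omega) j (by omega)]; simp
        -- Here `j = n`: moving `X` produces the norm `h_{n+1}`, cancelled by the off-diagonal
        -- coefficient `h_{n+1} / h_n` times `h_n`.
        · rw [← jopNorm, ← jopNorm, div_mul_cancel₀ _ (hpos _).ne']; simp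
      · have h3 : jacobiL α β t (jop α β t n * jop α β t (n + 1)) = 0 := by
          rw [mul_comm]; exact ih _ le_rfl _ (by omega)
        rw [h3, mul_left_comm, jopDiag, ← jopNorm, div_mul_cancel₀ _ (hpos _).ne']; simp

/-- Removing the top coefficient with a monic polynomial lowers the degree; this is the step in
every induction on degree below. -/
lemma degree_sub_jop_lt {f : ℝ[X]} {d : ℕ} (hf : f.degree < (d + 1 : ℕ)) :
    (f - C (f.coeff d) * jop α β t d).degree < d := by
  rw [degree_lt_iff_coeff_zero] at hf ⊢
  intro i hi
  rcases hi.lt_or_eq with hi | rfl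
  · simp [hf i hi, jop_coeff_of_lt hi]
  · simp [jop_coeff_self]

lemma jacobiL_jop_mul_eq_zero (hα : 0 < α) (hβ : 0 < β) (h0 : 0 ≤ t) (h1 : t < 1) {k : ℕ}
    {f : ℝ[X]} (hf : f.degree < k) : jacobiL α β t (jop α β t k * f) = 0 := by
  have : ∀ d ≤ k, ∀ f : ℝ[X], f.degree < d → jacobiL α β t (jop α β t k * f) = 0 := by
    intro d
    induction d with
    | zero =>
      intro _ f hf
      have : f = 0 := by
        ext i; exact (degree_lt_iff_coeff_zero _ _).1 hf i (Nat.zero_le i)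
      simp [this, jacobiL_zero]
    | succ d ih =>
      intro hd f hf
      have h := ih (by omega) _ (degree_sub_jop_lt (α := α) (β := β) (t := t) hf)
      rw [mul_sub, jacobiL_sub hα hβ, mul_left_comm, jacobiL_smul,
        jacobiL_jop_mul_jop hα hβ h0 h1 k k le_rfl d (by omega)] at h
      simpa using h
  exact this k le_rfl f hf

lemma jacobiL_jop_mul (hα : 0 < α) (hβ : 0 < β) (h0 : 0 ≤ t) (h1 : t < 1) {k : ℕ}
    {f : ℝ[X]} (hf : f.degree < (k + 1 : ℕ)) :
    jacobiL α β t (jop α β t k * f) = f.coeff k * jopNorm α β t k := by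
  have h := jacobiL_jop_mul_eq_zero hα hβ h0 h1 (degree_sub_jop_lt (α := α) (β := β) (t := t) hf)
  rw [mul_sub, jacobiL_sub hα hβ, mul_left_comm, jacobiL_smul, ← jopNorm] at h
  linarith

/-- Subtract from `f` its top coefficient times `P_{k+1}`. This is orthogonal to `P_k` and changes
the coefficient of degree `k` by the subleading coefficient of `P_{k+1}`. -/
lemma jacobiL_jop_mul_succ (hα : 0 < α) (hβ : 0 < β) (h0 : 0 ≤ t) (h1 : t < 1) {k : ℕ}
    {f : ℝ[X]} (hf : f.degree < (k + 2 : ℕ)) :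
    jacobiL α β t (jop α β t k * f) =
      (f.coeff k - f.coeff (k + 1) * jopSub α β t (k + 1)) * jopNorm α β t k := by
  have h := jacobiL_jop_mul hα hβ h0 h1
    (degree_sub_jop_lt (α := α) (β := β) (t := t) (d := k + 1) hf)
  rw [mul_sub, jacobiL_sub hα hβ, mul_left_comm, jacobiL_smul, mul_comm (jop α β t k) (jop _ _ _ _),
    jacobiL_jop_mul_jop hα hβ h0 h1 (k + 1) _ le_rfl k (by omega)] at h
  simpa [jopSub] using h

/-- Test `f` against itself. Polynomial identities below are proved by bounding the degree of a
difference and computing its pairings. -/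
lemma eq_zero_of_jacobiL_eq_zero (hα : 0 < α) (hβ : 0 < β) (h0 : 0 ≤ t) (h1 : t < 1) {k : ℕ}
    {f : ℝ[X]} (hf : f.degree < k) (h : ∀ g : ℝ[X], g.degree < k → jacobiL α β t (f * g) = 0) :
    f = 0 := by
  by_contra hne
  exact (jacobiL_mul_self_pos hα hβ h0 h1 hne).ne' (h f hf)

/-- The reproducing kernel of the polynomials of degree less than `n`, with one argument at the
endpoint `t`. -/
noncomputable def jopKer (α β t : ℝ) (n : ℕ) : ℝ[X] :=
  ∑ j ∈ Finset.range n, C ((jop α β t j).eval t / jopNorm α β t j) * jop α β t j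

lemma jopKer_succ (n : ℕ) : jopKer α β t (n + 1) =
    jopKer α β t n + C ((jop α β t n).eval t / jopNorm α β t n) * jop α β t n :=
  Finset.sum_range_succ _ _

lemma jopKer_degree_lt (n : ℕ) : (jopKer α β t n).degree < n := by
  rw [degree_lt_iff_coeff_zero]
  intro i hi
  rw [jopKer, finsetSum_coeff]
  refine Finset.sum_eq_zero fun j hj => ?_
  rw [coeff_C_mul, jop_coeff_of_lt ((Finset.mem_range.1 hj).trans_le hi), mul_zero]

lemma jacobiL_jopKer_mul (hα : 0 < α) (hβ : 0 < β) (h0 : 0 ≤ t) (h1 : t < 1) {n : ℕ} :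
    ∀ {g : ℝ[X]}, g.degree < n → jacobiL α β t (jopKer α β t n * g) = g.eval t := by
  induction n with
  | zero =>
    intro g hg
    have : g = 0 := by
      ext i; exact (degree_lt_iff_coeff_zero _ _).1 hg i (Nat.zero_le i)
    simp [this, jacobiL_zero]
  | succ n ih =>
    intro g hg
    have hd := degree_sub_jop_lt (α := α) (β := β) (t := t) hg
    have hK : jacobiL α β t (jopKer α β t n * g) =
        (g - C (g.coeff n) * jop α β t n).eval t := by
      rw [← ih hd, mul_sub, jacobiL_sub hα hβ, mul_left_comm, jacobiL_smul, mul_comm (jopKer _ _ _ _)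
        (jop _ _ _ _), jacobiL_jop_mul_eq_zero hα hβ h0 h1 (jopKer_degree_lt n)]
      simp
    rw [jopKer_succ, add_mul, jacobiL_add hα hβ, hK, mul_assoc, jacobiL_smul,
      jacobiL_jop_mul hα hβ h0 h1 hg]
    have := (jopNorm_pos hα hβ h0 h1 n).ne'
    simp
    field_simp
    ring

/-- The Christoffel–Darboux formula. -/
lemma X_sub_mul_jopKer (hα : 0 < α) (hβ : 0 < β) (h0 : 0 ≤ t) (h1 : t < 1) (n : ℕ) :
    C (jopNorm α β t n) * ((X - C t) * jopKer α β t (n + 1)) =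
      C ((jop α β t n).eval t) * jop α β t (n + 1) -
        C ((jop α β t (n + 1)).eval t) * jop α β t n := by
  induction n with
  | zero =>
    have := (jopNorm_pos hα hβ h0 h1 0).ne'
    simp [jopKer, jop_one, jop_zero]
    rw [mul_left_comm, ← C_mul, mul_inv_cancel₀ this]
    simp
  | succ n ih =>
    have hn := (jopNorm_pos hα hβ h0 h1 n).ne'
    have hn1 := (jopNorm_pos hα hβ h0 h1 (n + 1)).ne'
    set b := jopNorm α β t (n + 1) / jopNorm α β t n with hb
    have hb' : jopNorm α β t (n + 1) = b * jopNorm α β t n := by rw [hb]; field_simp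
    have e2 : (jop α β t (n + 2)).eval t = (t - jopDiag α β t (n + 1)) *
      (jop α β t (n + 1)).eval t - b * (jop α β t n).eval t := by
      rw [jop_add_two]; simp [hb]
    have hcancel : C (jopNorm α β t (n + 1)) *
        C ((jop α β t (n + 1)).eval t / jopNorm α β t (n + 1)) = C ((jop α β t (n + 1)).eval t) := by
      rw [← C_mul, mul_div_cancel₀ _ hn1]
    rw [jopKer_succ, mul_add, mul_add, e2, jop_add_two n, ← hb]
    -- Since `h_{n+1} = b h_n`, the induction hypothesis times `b` accounts for the part of the sum
    -- up to `n`; the recurrence then absorbs the new summand.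
    have : C (jopNorm α β t (n + 1)) * ((X - C t) * jopKer α β t (n + 1)) = C b *
      (C ((jop α β t n).eval t) * jop α β t (n + 1) -
        C ((jop α β t (n + 1)).eval t) * jop α β t n) := by
      rw [← ih, hb', C_mul]; ring
    rw [this]
    have h2 : C (jopNorm α β t (n + 1)) * ((X - C t) *
        (C ((jop α β t (n + 1)).eval t / jopNorm α β t (n + 1)) * jop α β t (n + 1))) =
        (X - C t) * (C ((jop α β t (n + 1)).eval t) * jop α β t (n + 1)) := by
      rw [← hcancel]; ring
    rw [h2]
    simp only [C_sub, C_mul]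
    ring

end

/-! ### Dependence of the orthogonal polynomials on the endpoint -/

section

variable {α β t : ℝ}

/-- Differentiability only: the recurrence coefficients are quotients of differentiable integrals by
nonzero norms. The value of the derivative is found afterwards from orthogonality. -/
lemma exists_polyHasDerivAt_jop (hα : 0 < α) (hβ : 0 < β) (h0 : 0 ≤ t) (h1 : t < 1) (k : ℕ) :
    ∃ p', PolyHasDerivAt (fun u => jop α β u k) p' t := by
  have hdiv : ∀ {f g : ℝ → ℝ} {f' g' : ℝ}, HasDerivAt f f' t → HasDerivAt g g' t → g t ≠ 0 →
      ∃ r, PolyHasDerivAt (fun u => C (f u / g u)) r t := fun hf hg hne =>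
    ⟨_, PolyHasDerivAt.C (hf.fun_div hg hne)⟩
  induction k using Nat.twoStepInduction with
  | zero => exact ⟨0, by simpa only [jop_zero] using PolyHasDerivAt.const 1⟩
  | one =>
    obtain ⟨r, hr⟩ := hdiv ((PolyHasDerivAt.const (t := t) X).jacobiL hα hβ)
      ((PolyHasDerivAt.const (t := t) 1).jacobiL hα hβ)
      (by simpa using (jacobiL_mul_self_pos hα hβ h0 h1 (one_ne_zero (α := ℝ[X]))).ne')
    exact ⟨_, by simpa only [jop] using (PolyHasDerivAt.const X).sub hr⟩
  | more k ih0 ih1 =>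
    obtain ⟨p0, hp0⟩ := ih0
    obtain ⟨p1, hp1⟩ := ih1
    obtain ⟨r, hr⟩ := hdiv (((PolyHasDerivAt.const X).mul (hp1.mul hp1)).jacobiL hα hβ)
      ((hp1.mul hp1).jacobiL hα hβ) (jopNorm_pos hα hβ h0 h1 (k + 1)).ne'
    obtain ⟨r', hr'⟩ := hdiv ((hp1.mul hp1).jacobiL hα hβ) ((hp0.mul hp0).jacobiL hα hβ)
      (jopNorm_pos hα hβ h0 h1 k).ne'
    exact ⟨_, by
      simpa only [jop] using (((PolyHasDerivAt.const X).sub hr).mul hp1).sub (hr'.mul hp0)⟩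

/-- Because `P_k` stays monic, its derivative has degree less than `k`. Differentiating `∫_t^1 P_k g
w = 0` for such `g` gives pairing `w(t) P_k(t) g(t)` for the derivative, and the reproducing kernel
is what represents evaluation at `t`. -/
lemma polyHasDerivAt_jop (hα : 0 < α) (hβ : 0 < β) (h0 : 0 < t) (h1 : t < 1) (k : ℕ) :
    PolyHasDerivAt (fun u => jop α β u k)
      (C (jacobiWeight α β t * (jop α β t k).eval t) * jopKer α β t k) t := by
  obtain ⟨p', hp⟩ := exists_polyHasDerivAt_jop hα hβ h0.le h1 k
  have hdeg : p'.degree < k := hp.degree_lt fun i hi => Eventually.of_forall fun u => by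
    rcases hi.lt_or_eq with hi | rfl
    · simp only [jop_coeff_of_lt hi]
    · simp only [jop_coeff_self]
  have hdegK : (C (jacobiWeight α β t * (jop α β t k).eval t) * jopKer α β t k).degree < k := by
    rw [degree_lt_iff_coeff_zero]
    intro i hi
    rw [coeff_C_mul, (degree_lt_iff_coeff_zero _ _).1 (jopKer_degree_lt k) i hi, mul_zero]
  have : p' - C (jacobiWeight α β t * (jop α β t k).eval t) * jopKer α β t k = 0 := by
    refine eq_zero_of_jacobiL_eq_zero hα hβ h0.le h1
      ((degree_sub_le _ _).trans_lt (max_lt hdeg hdegK)) fun g hg => ?_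
    have hd := (hp.mul (PolyHasDerivAt.const g)).jacobiL hα hβ
    have hz : (fun u => jacobiL α β u (jop α β u k * g)) =ᶠ[𝓝 t] fun _ => 0 := by
      filter_upwards [Ioo_mem_nhds h0 h1] with u hu
      exact jacobiL_jop_mul_eq_zero hα hβ hu.1.le hu.2 hg
    have h := hd.unique ((hasDerivAt_const t (0 : ℝ)).congr_of_eventuallyEq hz)
    rw [sub_mul, jacobiL_sub hα hβ, mul_assoc, jacobiL_smul, jacobiL_jopKer_mul hα hβ h0.le h1 hg]
    simp only [mul_zero, add_zero, eval_mul] at h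
    linarith
  rwa [← sub_eq_zero.1 this]

/-- The derivative of `P_k` has lower degree and is orthogonal to `P_k`, so only the boundary term
of the integral survives. -/
lemma hasDerivAt_jopNorm (hα : 0 < α) (hβ : 0 < β) (h0 : 0 < t) (h1 : t < 1) (k : ℕ) :
    HasDerivAt (fun u => jopNorm α β u k)
      (-(jacobiWeight α β t * (jop α β t k).eval t ^ 2)) t := by
  have hp := polyHasDerivAt_jop hα hβ h0 h1 k
  have hL : jacobiL α β t
      (C (jacobiWeight α β t * (jop α β t k).eval t) * jopKer α β t k * jop α β t k) = 0 := by
    rw [mul_assoc, jacobiL_smul, mul_comm (jopKer _ _ _ _),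
      jacobiL_jop_mul_eq_zero hα hβ h0.le h1 (jopKer_degree_lt k), mul_zero]
  refine ((hp.mul hp).jacobiL hα hβ).congr_deriv ?_
  rw [jacobiL_add hα hβ, mul_comm (jop α β t k) (_ * _), hL, eval_mul]
  ring

/-- The derivative of the norms, evaluated by partial integration. -/
lemma endpoint_weight_mul_sq (hα : 0 < α) (hβ : 0 < β) (h0 : 0 ≤ t) (h1 : t < 1) (k : ℕ) :
    -(t * (1 - t) * jacobiWeight α β t) * (jop α β t k).eval t ^ 2 =
      jopNorm α β t k * (2 * k + α + 1 - (2 * k + α + β) * jopSub α β t k +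
        (2 * k + α + β + 2) * jopSub α β t (k + 1)) := by
  have h := jacobiL_pearson hα hβ h0 h1.le (jop α β t k * jop α β t k)
  -- With this `f` the operator `pearson` sends `P_k²` to `P_k f`, and `f` has degree at most `k +
  -- 1`; the pairing thus needs only its two top coefficients.
  set f := C 2 * (X * (1 - X) * derivative (jop α β t k)) +
    (C (α + 1) - C (α + β + 2) * X) * jop α β t k with hf
  have e : pearson α β (jop α β t k * jop α β t k) = jop α β t k * f := by
    rw [pearson, hf, derivative_mul]; simp only [map_ofNat]; ring
  have hc : ∀ i, f.coeff (i + 1) = 2 * (jop α β t k).coeff (i + 1) * (i + 1)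
      - 2 * ((jop α β t k).coeff i * i) +
      (α + 1) * (jop α β t k).coeff (i + 1) - (α + β + 2) * (jop α β t k).coeff i := by
    intro i
    have : f = X * (C 2 * derivative (jop α β t k)) - X * (X * (C 2 * derivative (jop α β t k))) +
        C (α + 1) * jop α β t k - X * (C (α + β + 2) * jop α β t k) := by rw [hf]; ring
    rw [this]
    rcases i with _ | i
    · simp only [coeff_add, coeff_sub, coeff_C_mul, coeff_X_mul, mul_coeff_zero,
      coeff_X_zero, coeff_C_zero, coeff_derivative]
      push_cast; ring
    · simp only [coeff_add, coeff_sub, coeff_C_mul, coeff_X_mul, coeff_derivative]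
      push_cast; ring
  have hdeg : f.degree < (k + 2 : ℕ) := by
    rw [degree_lt_iff_coeff_zero]
    intro i hi
    obtain ⟨i, rfl⟩ : ∃ j, i = j + 1 := ⟨i - 1, by omega⟩
    rw [hc, jop_coeff_of_lt (show k < i by omega), jop_coeff_of_lt (show k < i + 1 by omega)]
    ring
  rw [e, jacobiL_jop_mul_succ hα hβ h0 h1 hdeg, hc, jop_coeff_self,
    jop_coeff_of_lt (Nat.lt_succ_self k), eval_mul] at h
  have hfk : f.coeff k = 2 * k + α + 1 - (2 * k + α + β) * jopSub α β t k := by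
    rcases k with _ | k
    · simp [hf, jop_zero, jopSub]
    · rw [hc, jop_coeff_self]; simp only [jopSub]; push_cast; ring
  rw [hfk] at h
  linear_combination -h

lemma jopSub_succ (k : ℕ) : jopSub α β t (k + 1) = (jop α β t (k + 1)).coeff k := rfl

/-- Read off degree `k` in the derivative of `P_{k+1}`: only the last summand of the kernel reaches
that degree, contributing `P_k(t) / h_k`. -/
lemma hasDerivAt_jopSub (hα : 0 < α) (hβ : 0 < β) (h0 : 0 < t) (h1 : t < 1) (k : ℕ) :
    HasDerivAt (fun u => jopSub α β u (k + 1))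
      (jacobiWeight α β t * (jop α β t (k + 1)).eval t * (jop α β t k).eval t /
        jopNorm α β t k) t := by
  refine ((polyHasDerivAt_jop hα hβ h0 h1 (k + 1)).coeff k).congr_deriv ?_
  rw [jopKer_succ, coeff_C_mul, coeff_add, coeff_C_mul, jop_coeff_self,
    (degree_lt_iff_coeff_zero _ _).1 (jopKer_degree_lt k) k le_rfl]
  ring

/-! ### The linear differential system -/

/-- The sum of `x (1 - x) ∂/∂x` and `t (1 - t) ∂/∂t` applied to the orthogonal polynomial. -/
noncomputable def jopEuler (α β t : ℝ) (k : ℕ) : ℝ[X] :=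
  X * (1 - X) * derivative (jop α β t k) +
    C (t * (1 - t) * (jacobiWeight α β t * (jop α β t k).eval t)) * jopKer α β t k

lemma coeff_pearson (g : ℝ[X]) (i : ℕ) : (pearson α β g).coeff (i + 1) =
    g.coeff (i + 1) * (i + 1) - g.coeff i * i + (α + 1) * g.coeff (i + 1) -
      (α + β + 2) * g.coeff i := by
  have : pearson α β g = X * derivative g - X * (X * derivative g) +
      C (α + 1) * g - X * (C (α + β + 2) * g) := by rw [pearson]; ring
  rw [this]
  rcases i with _ | i
  · simp only [coeff_add, coeff_sub, coeff_C_mul, coeff_X_mul, mul_coeff_zero,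
      coeff_X_zero, coeff_C_zero, coeff_derivative]
    push_cast; ring
  · simp only [coeff_add, coeff_sub, coeff_C_mul, coeff_X_mul, coeff_derivative]
    push_cast; ring

lemma coeff_jopEuler {k i : ℕ} (h : k ≤ i + 1) : (jopEuler α β t k).coeff (i + 1) =
    (jop α β t k).coeff (i + 1) * (i + 1) - (jop α β t k).coeff i * i := by
  have : jopEuler α β t k = X * derivative (jop α β t k) - X * (X * derivative (jop α β t k)) +
    C (t * (1 - t) * (jacobiWeight α β t * (jop α β t k).eval t)) * jopKer α β t k := by
    rw [jopEuler]; ring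
  rw [this]
  have hK := (degree_lt_iff_coeff_zero _ _).1 (jopKer_degree_lt (α := α) (β := β) (t := t) k) (i + 1) h
  rcases i with _ | i
  · simp only [coeff_add, coeff_sub, coeff_C_mul, coeff_X_mul, mul_coeff_zero,
      coeff_X_zero, coeff_derivative,
      hK]
    push_cast; ring
  · simp only [coeff_add, coeff_sub, coeff_C_mul, coeff_X_mul, coeff_derivative,
      hK]
    push_cast; ring

/-- Integration by parts moves the `x`-derivative onto `g`, and the boundary term `-t (1 - t) w(t)
P(t) g(t)` cancels against the kernel term that comes from `t (1 - t) ∂_t`. This cancellation is why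
the two derivatives are combined. What remains involves only the top coefficient of `pearson α β g`.
-/
lemma jacobiL_jopEuler_mul (hα : 0 < α) (hβ : 0 < β) (h0 : 0 ≤ t) (h1 : t < 1) {k : ℕ} {g : ℝ[X]}
    (hg : g.degree < (k + 1 : ℕ)) :
    jacobiL α β t (jopEuler α β t (k + 1) * g) =
      (k + α + β + 2) * g.coeff k * jopNorm α β t (k + 1) := by
  have hdeg : (pearson α β g).degree < (k + 1 + 1 : ℕ) := by
    rw [degree_lt_iff_coeff_zero] at hg ⊢
    intro i hi
    obtain ⟨i, rfl⟩ : ∃ j, i = j + 1 := ⟨i - 1, by omega⟩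
    rw [coeff_pearson, hg i (by omega), hg (i + 1) (by omega)]; ring
  have e : jopEuler α β t (k + 1) * g = pearson α β (jop α β t (k + 1) * g) -
      jop α β t (k + 1) * pearson α β g +
      C (t * (1 - t) * (jacobiWeight α β t * (jop α β t (k + 1)).eval t)) *
        (jopKer α β t (k + 1) * g) := by
    simp only [jopEuler, pearson, derivative_mul]; ring
  rw [e, jacobiL_add hα hβ, jacobiL_sub hα hβ, jacobiL_smul, jacobiL_jopKer_mul hα hβ h0 h1 hg,
    jacobiL_pearson hα hβ h0 h1.le, jacobiL_jop_mul hα hβ h0 h1 hdeg, coeff_pearson,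
    (degree_lt_iff_coeff_zero _ _).1 hg (k + 1) le_rfl, eval_mul]
  ring

lemma coeff_C_sub_C_mul_X_mul (a b : ℝ) (f : ℝ[X]) (i : ℕ) :
    ((C a - C b * X) * f).coeff (i + 1) = a * f.coeff (i + 1) - b * f.coeff i := by
  rw [sub_mul, mul_assoc, coeff_sub, coeff_C_mul, coeff_C_mul, coeff_X_mul]

/-- The right side matches the left in degrees above `k`, and both pair equally with all polynomials
of degree at most `k`. With `jopEuler_eq` this is a closed linear system for `(P_{k+1}, P_k)`. -/
lemma jopEuler_succ (hα : 0 < α) (hβ : 0 < β) (h0 : 0 ≤ t) (h1 : t < 1) (k : ℕ) :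
    jopEuler α β t (k + 1) =
      (C (k + 1 + jopSub α β t (k + 1)) - C (k + 1 : ℝ) * X) * jop α β t (k + 1) +
      C ((2 * k + α + β + 3) * (jopNorm α β t (k + 1) / jopNorm α β t k)) * jop α β t k := by
  have hk := (jopNorm_pos hα hβ h0 h1 k).ne'
  rw [← sub_eq_zero]
  refine eq_zero_of_jacobiL_eq_zero hα hβ h0 h1 (k := k + 1) ?_ fun g hg => ?_
  · rw [degree_lt_iff_coeff_zero]
    intro i hi
    obtain ⟨i, rfl⟩ : ∃ j, i = j + 1 := ⟨i - 1, by omega⟩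
    rw [coeff_sub, coeff_add, coeff_C_mul, coeff_C_sub_C_mul_X_mul, coeff_jopEuler hi,
      jop_coeff_of_lt (show k < i + 1 by omega)]
    rcases (show k ≤ i by omega).lt_or_eq with hi | rfl
    · rw [jop_coeff_of_lt (show k + 1 < i + 1 by omega)]
      rcases (show k + 1 ≤ i by omega).lt_or_eq with hi | rfl
      · rw [jop_coeff_of_lt hi]; ring
      · rw [jop_coeff_self]; push_cast; ring
    · rw [jop_coeff_self, jopSub_succ]; ring
  · have e : ((C (k + 1 + jopSub α β t (k + 1)) - C (k + 1 : ℝ) * X) * jop α β t (k + 1) +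
      C ((2 * k + α + β + 3) * (jopNorm α β t (k + 1) / jopNorm α β t k)) * jop α β t k) * g =
      jop α β t (k + 1) * ((C (k + 1 + jopSub α β t (k + 1)) - C (k + 1 : ℝ) * X) * g) +
      C ((2 * k + α + β + 3) * (jopNorm α β t (k + 1) / jopNorm α β t k)) * (jop α β t k * g) := by
      ring
    have hd : ((C (k + 1 + jopSub α β t (k + 1)) - C (k + 1 : ℝ) * X) * g).degree
        < ((k + 1 + 1 : ℕ) : WithBot ℕ) := by
      rw [degree_lt_iff_coeff_zero] at hg ⊢
      intro i hi
      obtain ⟨i, rfl⟩ : ∃ j, i = j + 1 := ⟨i - 1, by omega⟩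
      rw [coeff_C_sub_C_mul_X_mul, hg i (by omega), hg (i + 1) (by omega)]; ring
    rw [sub_mul, jacobiL_sub hα hβ, jacobiL_jopEuler_mul hα hβ h0 h1 hg, e, jacobiL_add hα hβ,
      jacobiL_smul, jacobiL_jop_mul hα hβ h0 h1 hd, jacobiL_jop_mul hα hβ h0 h1 hg,
      coeff_C_sub_C_mul_X_mul, (degree_lt_iff_coeff_zero _ _).1 hg (k + 1) le_rfl]
    field_simp
    ring

lemma jopEuler_eq (hα : 0 < α) (hβ : 0 < β) (h0 : 0 ≤ t) (h1 : t < 1) (k : ℕ) :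
    jopEuler α β t k =
      (C (k - (2 * k + α + β) * jopSub α β t k + (2 * k + α + β + 1) * jopSub α β t (k + 1)) +
        C (k + 1 + α + β) * X) * jop α β t k -
      C (2 * k + α + β + 1) * jop α β t (k + 1) := by
  have hcX : ∀ (a b : ℝ) (f : ℝ[X]) (i : ℕ),
    ((C a + C b * X) * f).coeff (i + 1) = a * f.coeff (i + 1) + b * f.coeff i := fun a b f i => by
      rw [add_mul, mul_assoc, coeff_add, coeff_C_mul, coeff_C_mul, coeff_X_mul]
  rw [← sub_eq_zero]
  -- The pairing formula is available for successor indices only, so `P_0 = 1` is checked by hand.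
  rcases k with _ | k
  · have hj : jop α β t 1 = X + C (jopSub α β t 1) := by
      rw [jop_one, jopDiag_eq, jopSub_zero, jop_zero]; simp
    rw [jopEuler, hj]
    simp [jopKer, jop_zero, jopSub_zero]
    ring
  refine eq_zero_of_jacobiL_eq_zero hα hβ h0 h1 (k := k + 1) ?_ fun g hg => ?_
  · rw [degree_lt_iff_coeff_zero]
    intro i hi
    obtain ⟨i, rfl⟩ : ∃ j, i = j + 1 := ⟨i - 1, by omega⟩
    rw [coeff_sub, coeff_sub, coeff_C_mul, hcX, coeff_jopEuler hi]
    rcases (show k ≤ i by omega).lt_or_eq with hi | rfl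
    · rw [jop_coeff_of_lt (show k + 1 < i + 1 by omega)]
      rcases (show k + 1 ≤ i by omega).lt_or_eq with hi | rfl
      · rw [jop_coeff_of_lt hi, jop_coeff_of_lt (show k + 1 + 1 < i + 1 by omega)]; ring
      · rw [jop_coeff_self, jop_coeff_self]; push_cast; ring
    · rw [jop_coeff_self, jopSub_succ, jopSub_succ]; push_cast; ring
  · have hd : ((C (((k + 1 : ℕ) : ℝ) - (2 * (k + 1 : ℕ) + α + β) * jopSub α β t (k + 1) +
        (2 * (k + 1 : ℕ) + α + β + 1) * jopSub α β t (k + 1 + 1)) +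
        C (((k + 1 : ℕ) : ℝ) + 1 + α + β) * X) * g).degree <
        ((k + 1 + 1 : ℕ) : WithBot ℕ) := by
      rw [degree_lt_iff_coeff_zero] at hg ⊢
      intro i hi
      obtain ⟨i, rfl⟩ : ∃ j, i = j + 1 := ⟨i - 1, by omega⟩
      rw [hcX, hg i (by omega), hg (i + 1) (by omega)]; ring
    rw [sub_mul, jacobiL_sub hα hβ, jacobiL_jopEuler_mul hα hβ h0 h1 hg, sub_mul,
      jacobiL_sub hα hβ, mul_comm _ (jop α β t (k + 1)),
      mul_assoc (jop α β t (k + 1)),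
      jacobiL_jop_mul hα hβ h0 h1 hd,
      mul_assoc (C (2 * ((k + 1 : ℕ) : ℝ) + α + β + 1)), jacobiL_smul,
      jacobiL_jop_mul_eq_zero hα hβ h0 h1 (hg.trans (by exact_mod_cast Nat.lt_succ_self _)), hcX,
      (degree_lt_iff_coeff_zero _ _).1 hg (k + 1) le_rfl]
    push_cast
    ring

end

/-! ### The Painlevé VI equation for the subleading coefficient -/

section

variable {α β t : ℝ}

/-- Along `x = t` the operators `x (1 - x) ∂_x` and `t (1 - t) ∂_t` carry the same factor, so their
sum is `t (1 - t)` times the total derivative. -/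
lemma hasDerivAt_jop_diag (hα : 0 < α) (hβ : 0 < β) (h0 : 0 < t) (h1 : t < 1) (k : ℕ) :
    HasDerivAt (fun u => (jop α β u k).eval u)
      ((jopEuler α β t k).eval t / (t * (1 - t))) t := by
  refine (polyHasDerivAt_jop hα hβ h0 h1 k).eval_diag.congr_deriv ?_
  have : 1 - t ≠ 0 := (sub_pos.2 h1).ne'
  simp [jopEuler]
  field_simp
  ring

/-- A common root descends through the recurrence, whose last coefficient is nonzero, down to `P_0 =
1`. -/
lemma jop_no_common_root (hα : 0 < α) (hβ : 0 < β) (h0 : 0 ≤ t) (h1 : t < 1) (k : ℕ) (x : ℝ) :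
    (jop α β t (k + 1)).eval x ≠ 0 ∨ (jop α β t k).eval x ≠ 0 := by
  induction k with
  | zero => right; simp [jop_zero]
  | succ k ih =>
    by_contra! h
    have hb : jopNorm α β t (k + 1) / jopNorm α β t k ≠ 0 :=
      (div_pos (jopNorm_pos hα hβ h0 h1 _) (jopNorm_pos hα hβ h0 h1 _)).ne'
    have h2 := h.1
    rw [jop_add_two] at h2
    simp only [eval_sub, eval_mul, eval_X, eval_C, h.2, mul_zero, zero_sub, neg_eq_zero] at h2
    rcases ih with ih | ih
    · exact ih h.2
    · exact ih ((mul_eq_zero.1 h2).resolve_left hb)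

lemma det_eq_zero_of_kernel {a b c d A B : ℝ} (h1 : a * A + b * B = 0) (h2 : c * A + d * B = 0)
    (h : A ≠ 0 ∨ B ≠ 0) : a * d - b * c = 0 := by
  rcases h with h | h
  · refine (mul_eq_zero.1 (?_ : (a * d - b * c) * A = 0)).resolve_right h
    linear_combination d * h1 - b * h2
  · refine (mul_eq_zero.1 (?_ : (a * d - b * c) * B = 0)).resolve_right h
    linear_combination a * h2 - c * h1

/-- The residue matrix of the differential system at a singular point `x₀` of `x (1 - x)` is
singular. -/
lemma jop_residue_det (hα : 0 < α) (hβ : 0 < β) (h0 : 0 ≤ t) (h1 : t < 1) (k : ℕ) {x₀ : ℝ}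
    (hx : x₀ * (1 - x₀) = 0) {W q p h b c : ℝ} (hW : W = t * (1 - t) * jacobiWeight α β t)
    (hq : q = (jop α β t (k + 1)).eval t) (hp : p = (jop α β t k).eval t)
    (hh : h = jopNorm α β t k) (hb : b = jopNorm α β t (k + 1) / jopNorm α β t k)
    (hc : c = jopSub α β t (k + 1)) :
    ((x₀ - t) * (k + 1 + c - (k + 1) * x₀) - W * q * p / h) *
      ((x₀ - t) * (-(k + 1) - α - c + (k + 1 + α + β) * x₀) + W * q * p / h) -
    ((x₀ - t) * ((2 * k + α + β + 3) * b) + W * q ^ 2 / h) *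
      (-(x₀ - t) * (2 * k + α + β + 1) - W * p ^ 2 / h) = 0 := by
  have hne : h ≠ 0 := hh ▸ (jopNorm_pos hα hβ h0 h1 k).ne'
  have hcd := congrArg (eval x₀) (X_sub_mul_jopKer hα hβ h0 h1 k)
  have hE1 := congrArg (eval x₀) (jopEuler_succ hα hβ h0 h1 k)
  have hE0 := congrArg (eval x₀) (jopEuler_eq hα hβ h0 h1 k)
  have hvs := endpoint_weight_mul_sq hα hβ h0 h1 k
  rw [← hb] at hE1
  rw [jopEuler] at hE1 hE0
  rw [jopKer_succ] at hcd hE1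
  simp only [eval_add, eval_sub, eval_mul, eval_X, eval_C, eval_one, hx, zero_mul, zero_add,
    ← hq, ← hp, ← hh, ← hc] at hcd hE1 hE0 hvs
  -- The kernel vector is the pair of polynomial values at `x₀`, nonzero since consecutive
  -- polynomials share no root. Its two equations come from the linear system after
  -- Christoffel–Darboux has removed the reproducing kernel.
  refine det_eq_zero_of_kernel (A := (jop α β t (k + 1)).eval x₀) (B := (jop α β t k).eval x₀)
    ?_ ?_ (jop_no_common_root hα hβ h0 h1 k x₀)
  · generalize eval x₀ (jop α β t (k + 1)) = A at *
    generalize eval x₀ (jop α β t k) = B at *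
    generalize eval x₀ (jopKer α β t k) = K at *
    rw [hW]
    field_simp at hcd hE1 ⊢
    linear_combination (-(x₀ - t)) * hE1 + t * (1 - t) * jacobiWeight α β t * q * hcd
  · generalize eval x₀ (jop α β t (k + 1)) = A at *
    generalize eval x₀ (jop α β t k) = B at *
    generalize eval x₀ (jopKer α β t k) = K at *
    rw [← hW] at hvs
    have hE0' : W * p * K = (k - (2 * k + α + β) * jopSub α β t k + (2 * k + α + β + 1) * c +
        (k + 1 + α + β) * x₀) * B - (2 * k + α + β + 1) * A := by
      rw [← hE0, hW]; ring
    -- The endpoint identity trades the subleading coefficient of `P_k` for that of `P_{k+1}`,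
    -- leaving `c` as the only such coefficient.
    have hcs : (2 * k + α + β) * jopSub α β t k = 2 * k + α + 1 + (2 * k + α + β + 2) * c +
        W * p ^ 2 / h := by
      field_simp
      linear_combination hvs
    have hcd' : (x₀ - t) * K = (p * A - q * B) / h - (x₀ - t) * p / h * B := by
      field_simp
      field_simp at hcd
      linear_combination hcd
    have : (x₀ - t) * (W * p * K) = W * p * ((p * A - q * B) / h - (x₀ - t) * p / h * B) := by
      rw [← hcd']; ring
    rw [hE0', hcs] at this
    linear_combination this

lemma hasDerivAt_jacobiWeight (h0 : 0 < t) (h1 : t < 1) : HasDerivAt (jacobiWeight α β)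
    ((α * (1 - t) - β * t) * jacobiWeight α β t / (t * (1 - t))) t := by
  have h1' : (0 : ℝ) < 1 - t := sub_pos.2 h1
  refine (((hasDerivAt_id t).rpow_const (p := α) (Or.inl h0.ne')).mul
      (((hasDerivAt_id t).const_sub 1).rpow_const (p := β) (Or.inl h1'.ne'))).congr_deriv ?_
  simp only [id, jacobiWeight]
  rw [Real.rpow_sub_one h0.ne', Real.rpow_sub_one h1'.ne']
  field_simp
  ring

/-- The derivative of the subleading coefficient `jopSub`. -/
noncomputable def jopSubDeriv (α β t : ℝ) (k : ℕ) : ℝ :=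
  jacobiWeight α β t * (jop α β t (k + 1)).eval t * (jop α β t k).eval t / jopNorm α β t k

/-- The linear system at `x = t` gives the derivatives of `q` and `p`. Their diagonal parts cancel
against the logarithmic derivatives of `w` and `h`, and only the off-diagonal parts, quadratic in
`p` or in `q`, remain. -/
lemma hasDerivAt_jopSubDeriv (hα : 0 < α) (hβ : 0 < β) (h0 : 0 < t) (h1 : t < 1) (k : ℕ)
    {W q p h b : ℝ} (hW : W = t * (1 - t) * jacobiWeight α β t)
    (hq : q = (jop α β t (k + 1)).eval t) (hp : p = (jop α β t k).eval t)
    (hh : h = jopNorm α β t k) (hb : b = jopNorm α β t (k + 1) / jopNorm α β t k) :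
    HasDerivAt (fun u => jopSubDeriv α β u k)
      (((2 * k + α + β + 3) * b * (W * p ^ 2 / h) - (2 * k + α + β + 1) * (W * q ^ 2 / h)) /
        (t * (1 - t)) ^ 2) t := by
  have hne : h ≠ 0 := hh ▸ (jopNorm_pos hα hβ h0.le h1 k).ne'
  have h1' : (1 - t) ≠ 0 := (sub_pos.2 h1).ne'
  have hE1 := congrArg (eval t) (jopEuler_succ hα hβ h0.le h1 k)
  have hE0 := congrArg (eval t) (jopEuler_eq hα hβ h0.le h1 k)
  have hvs := endpoint_weight_mul_sq hα hβ h0.le h1 k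
  rw [← hb] at hE1
  simp only [eval_add, eval_sub, eval_mul, eval_X, eval_C, ← hq, ← hp, ← hh] at hE1 hE0 hvs
  refine ((((hasDerivAt_jacobiWeight (α := α) (β := β) h0 h1).fun_mul
    (hasDerivAt_jop_diag hα hβ h0 h1 (k + 1))).fun_mul (hasDerivAt_jop_diag hα hβ h0 h1 k)).fun_div
    (hasDerivAt_jopNorm hα hβ h0 h1 k) (jopNorm_pos hα hβ h0.le h1 k).ne').congr_deriv ?_
  have hcs : (2 * k + α + β) * jopSub α β t k = 2 * k + α + 1 +
      (2 * k + α + β + 2) * jopSub α β t (k + 1) + W * p ^ 2 / h := by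
    rw [hW]
    field_simp
    linear_combination hvs
  rw [hcs] at hE0
  rw [hE1, hE0, ← hq, ← hp, ← hh, hW]
  field_simp
  ring

/-- The equation of Painlevé VI type satisfied by `c = jopSub` as a function of the endpoint. -/
lemma jopSub_painleve (hα : 0 < α) (hβ : 0 < β) (h0 : 0 < t) (h1 : t < 1) (k : ℕ) :
    ∃ c2, HasDerivAt (fun u => jopSubDeriv α β u k) c2 t ∧ ∀ n m c r : ℝ, n = k + 1 →
      m = 2 * n + α + β → c = jopSub α β t (k + 1) → r = t * (1 - t) * jopSubDeriv α β t k →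
      ((t * (1 - t)) ^ 2 * c2) ^ 2 =
        (t * (1 - t) * (m * c + n * (n + α)) + (2 * c - β + m * (1 - t)) * r) ^ 2 -
        4 * ((n + c) * (n + α + c) * t + c * (c - β) * (1 - t) + m * r) * r ^ 2 := by
  refine ⟨_, hasDerivAt_jopSubDeriv hα hβ h0 h1 k rfl rfl rfl rfl rfl, ?_⟩
  intro n m c r hn hm hc hr
  have d0 := jop_residue_det hα hβ h0.le h1 k (x₀ := 0) (by simp) rfl rfl rfl rfl rfl hc
  have d1 := jop_residue_det hα hβ h0.le h1 k (x₀ := 1) (by simp) rfl rfl rfl rfl rfl hc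
  have h1' : (1 - t) ≠ 0 := (sub_pos.2 h1).ne'
  have hX : (t * (1 - t)) ^ 2 ≠ 0 := by positivity
  rw [mul_div_cancel₀ _ hX]
  have hr' : r = t * (1 - t) * jacobiWeight α β t * (jop α β t (k + 1)).eval t *
      (jop α β t k).eval t / jopNorm α β t k := by rw [hr, jopSubDeriv]; ring
  have hUv : (t * (1 - t) * jacobiWeight α β t * (jop α β t (k + 1)).eval t ^ 2 / jopNorm α β t k) *
      (t * (1 - t) * jacobiWeight α β t * (jop α β t k).eval t ^ 2 / jopNorm α β t k) = r ^ 2 := by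
    rw [hr']; ring
  rw [← hr'] at d0 d1
  generalize t * (1 - t) * jacobiWeight α β t * (jop α β t (k + 1)).eval t ^ 2 / jopNorm α β t k
    = U at *
  generalize t * (1 - t) * jacobiWeight α β t * (jop α β t k).eval t ^ 2 / jopNorm α β t k = v at *
  generalize jopNorm α β t (k + 1) / jopNorm α β t k = b at *
  have hk : (k : ℝ) = n - 1 := by rw [hn]; ring
  rw [hk] at d0 d1 ⊢
  -- The scaled second derivative is `B - G`. The determinants at `0` and `1` determine both `b` and
  -- `B + G` in terms of `c` and `r`, while `U v = r²` gives `B G`. The equation is then `(B - G)² =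
  -- (B + G)² - 4 B G`.
  obtain ⟨G, hG⟩ : ∃ G, G = (m - 1) * U := ⟨_, rfl⟩
  obtain ⟨B, hB⟩ : ∃ B, B = (m + 1) * b * v := ⟨_, rfl⟩
  have e0 : (n + c) * (n + α + c) * t + (2 * n + 2 * c + α) * r =
      (m ^ 2 - 1) * b * t - (B + G) := by
    refine mul_left_cancel₀ h0.ne' ?_
    rw [hB, hG, hm]
    linear_combination -d0 + hUv
  have e1 : c * (c - β) * (1 - t) - (2 * c - β) * r = (m ^ 2 - 1) * b * (1 - t) + (B + G) := by
    refine mul_left_cancel₀ h1' ?_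
    rw [hB, hG, hm]
    linear_combination -d1 + hUv
  have eb : (m ^ 2 - 1) * b = (n + c) * (n + α + c) * t + c * (c - β) * (1 - t) + m * r := by
    rw [hm]; rw [hm] at e0 e1; linear_combination -e0 - e1
  have eS : B + G = -(t * (1 - t) * (m * c + n * (n + α)) + (2 * c - β + m * (1 - t)) * r) := by
    rw [eb] at e1
    rw [hm]; rw [hm] at e1
    linear_combination -e1
  have eBG : B * G = (m ^ 2 - 1) * b * r ^ 2 := by rw [hB, hG, ← hUv]; ring
  rw [← eb]
  have e2 : (2 * (n - 1) + α + β + 3) * b * v - (2 * (n - 1) + α + β + 1) * U = B - G := by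
    rw [hB, hG, hm]; ring
  rw [e2]
  linear_combination (B + G - (t * (1 - t) * (m * c + n * (n + α)) +
    (2 * c - β + m * (1 - t)) * r)) * eS - 4 * eBG

end

/-! ### Hankel determinants -/

section

variable {α β t : ℝ}

/-- The Hankel matrix of moments of the Jacobi weight on `(t, 1)`. -/
noncomputable def jacobiHankel (α β t : ℝ) (n : ℕ) : Matrix (Fin n) (Fin n) ℝ :=
  Matrix.of fun i j => jacobiL α β t (X ^ ((i : ℕ) + j))

lemma jacobiL_mul_eq_sum (hα : 0 < α) (hβ : 0 < β) {n : ℕ} {f g : ℝ[X]}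
    (hf : f.degree < n) (hg : g.degree < n) :
    jacobiL α β t (f * g) =
      ∑ i : Fin n, ∑ j : Fin n, f.coeff i * jacobiHankel α β t n i j * g.coeff j := by
  have key : ∀ f : ℝ[X], f.degree < n → f = ∑ i : Fin n, C (f.coeff i) * X ^ (i : ℕ) := by
    intro f hf
    rw [Fin.sum_univ_eq_sum_range (fun i => C (f.coeff i) * X ^ i) n]
    ext i
    simp only [finsetSum_coeff, coeff_C_mul, coeff_X_pow, mul_ite, mul_one, mul_zero,
      Finset.sum_ite_eq, Finset.mem_range]
    split_ifs with h
    · rfl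
    · exact (degree_lt_iff_coeff_zero _ _).1 hf i (not_lt.1 h)
  conv_lhs => rw [key f hf, key g hg]
  rw [Finset.sum_mul, jacobiL_sum hα hβ]
  refine Finset.sum_congr rfl fun i _ => ?_
  rw [Finset.mul_sum, jacobiL_sum hα hβ]
  refine Finset.sum_congr rfl fun j _ => ?_
  rw [show C (f.coeff i) * X ^ (i : ℕ) * (C (g.coeff j) * X ^ (j : ℕ)) =
    C (f.coeff i * g.coeff j) * X ^ ((i : ℕ) + j) by rw [C_mul, pow_add]; ring, jacobiL_smul]
  simp only [jacobiHankel, Matrix.of_apply]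
  ring

/-- The coefficient matrix of the orthogonal polynomials is unipotent lower triangular and
diagonalises the Hankel form to the norms. -/
lemma det_jacobiHankel (hα : 0 < α) (hβ : 0 < β) (h0 : 0 ≤ t) (h1 : t < 1) (n : ℕ) :
    (jacobiHankel α β t n).det = ∏ k ∈ Finset.range n, jopNorm α β t k := by
  set P : Matrix (Fin n) (Fin n) ℝ := Matrix.of fun i j => (jop α β t i).coeff j with hP
  have hdet : P.det = 1 := by
    rw [Matrix.det_of_isLowerTriangular]
    · simp [hP, jop_coeff_self]
    · intro i j hij
      exact jop_coeff_of_lt (by simpa using hij)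
  have hmul : P * jacobiHankel α β t n * P.transpose =
      Matrix.diagonal fun i : Fin n => jopNorm α β t i := by
    ext i j
    have h := jacobiL_mul_eq_sum (t := t) hα hβ
      (jop_degree_lt (α := α) (β := β) (t := t) i.2) (jop_degree_lt (α := α) (β := β) (t := t) j.2)
    have : (P * jacobiHankel α β t n * P.transpose) i j =
        jacobiL α β t (jop α β t i * jop α β t j) := by
      rw [h, Finset.sum_comm]
      simp [Matrix.mul_apply, hP, Finset.sum_mul]
    rw [this, Matrix.diagonal_apply]
    split_ifs with hij
    · rw [hij, jopNorm]
    · rcases lt_or_gt_of_ne (fun h => hij (Fin.ext h)) with h | h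
      · rw [mul_comm]; exact jacobiL_jop_mul_jop hα hβ h0 h1 j _ le_rfl _ h
      · exact jacobiL_jop_mul_jop hα hβ h0 h1 i _ le_rfl _ h
  have := congrArg Matrix.det hmul
  rw [Matrix.det_mul, Matrix.det_mul, Matrix.det_transpose, hdet, Matrix.det_diagonal,
    Fin.prod_univ_eq_prod_range (fun k => jopNorm α β t k) n] at this
  simpa using this

lemma det_jacobiHankel_pos (hα : 0 < α) (hβ : 0 < β) (h0 : 0 ≤ t) (h1 : t < 1) (n : ℕ) :
    0 < (jacobiHankel α β t n).det := by
  rw [det_jacobiHankel hα hβ h0 h1]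
  exact Finset.prod_pos fun k _ => jopNorm_pos hα hβ h0 h1 k

/-- By `endpoint_weight_mul_sq` the logarithmic derivative of each norm contains the difference of
consecutive terms `(2 k + α + β) jopSub k`, so the sum telescopes. -/
lemma hasDerivAt_log_det_jacobiHankel (hα : 0 < α) (hβ : 0 < β) (h0 : 0 < t) (h1 : t < 1)
    (n : ℕ) : HasDerivAt (fun u => Real.log (jacobiHankel α β u n).det)
      ((n * (n + α) + (2 * n + α + β) * jopSub α β t n) / (t * (1 - t))) t := by
  have heq : (fun u => Real.log (jacobiHankel α β u n).det) =ᶠ[𝓝 t]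
      fun u => ∑ k ∈ Finset.range n, Real.log (jopNorm α β u k) := by
    filter_upwards [Ioo_mem_nhds h0 h1] with u hu
    rw [det_jacobiHankel hα hβ hu.1.le hu.2,
      Real.log_prod fun k _ => (jopNorm_pos hα hβ hu.1.le hu.2 k).ne']
  refine HasDerivAt.congr_of_eventuallyEq ?_ heq
  have hd := HasDerivAt.fun_sum (u := Finset.range n) fun k _ =>
    (hasDerivAt_jopNorm hα hβ h0 h1 k).log (jopNorm_pos hα hβ h0.le h1 k).ne'
  refine hd.congr_deriv ?_
  have hX : t * (1 - t) ≠ 0 := mul_ne_zero h0.ne' (sub_pos.2 h1).ne'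
  rw [eq_div_iff hX, Finset.sum_mul]
  have : ∀ k, -(jacobiWeight α β t * (jop α β t k).eval t ^ 2) / jopNorm α β t k * (t * (1 - t)) =
      2 * k + α + 1 - (2 * k + α + β) * jopSub α β t k +
        (2 * k + α + β + 2) * jopSub α β t (k + 1) := fun k => by
    have h := endpoint_weight_mul_sq hα hβ h0.le h1 k
    have hk := (jopNorm_pos hα hβ h0.le h1 k).ne'
    field_simp
    linear_combination h
  simp only [this]
  clear hd heq this
  induction n with
  | zero => simp [jopSub_zero]
  | succ n ih => rw [Finset.sum_range_succ, ih]; push_cast; ring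

/-- The Heine–Andréief identity. -/
lemma jacobiPartition_eq_det (hα : 0 < α) (hβ : 0 < β) (h1 : t ≤ 1) (n : ℕ) :
    jacobiPartition t α β n = (jacobiHankel α β t n).det := by
  set μ : MeasureTheory.Measure ℝ := MeasureTheory.volume.restrict (Set.Ioo t 1) with hμ
  have hmom : ∀ i, ∫ x, x ^ i * jacobiWeight α β x ∂μ = jacobiL α β t (X ^ i) := fun i => by
    rw [hμ, ← MeasureTheory.integral_Ioc_eq_integral_Ioo, jacobiL,
      intervalIntegral.integral_of_le h1]
    simp
  have hint : ∀ i, MeasureTheory.Integrable (fun x => x ^ i * jacobiWeight α β x) μ := fun i =>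
    (((continuous_pow i).mul (continuous_jacobiWeight hα hβ)).integrableOn_Icc (a := t)
      (b := 1)).mono_set Set.Ioo_subset_Icc_self
  have hvol : (MeasureTheory.volume : MeasureTheory.Measure (Fin n → ℝ)).restrict
      (Set.univ.pi fun _ => Set.Ioo t 1) = MeasureTheory.Measure.pi fun _ => μ := by
    rw [MeasureTheory.volume_pi, MeasureTheory.Measure.restrict_pi_pi]
  have hdet : ∀ M : Matrix (Fin n) (Fin n) ℝ, M.det =
      ∑ σ : Equiv.Perm (Fin n), ((Equiv.Perm.sign σ : ℤ) : ℝ) * ∏ i, M i (σ i) := fun M => by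
    rw [← Matrix.det_transpose, Matrix.det_apply']; simp
  have hpt : ∀ x : Fin n → ℝ, (∏ i : Fin n, ∏ j ∈ Finset.Ioi i, (x j - x i) ^ 2) *
      ∏ k : Fin n, jacobiWeight α β (x k) =
      ∑ σ : Equiv.Perm (Fin n), ∑ τ : Equiv.Perm (Fin n),
        ((Equiv.Perm.sign σ : ℤ) : ℝ) * ((Equiv.Perm.sign τ : ℤ) : ℝ) *
          ∏ i, (x i ^ ((σ i : ℕ) + τ i) * jacobiWeight α β (x i)) := fun x => by
    simp only [Finset.prod_pow]
    rw [← Matrix.det_vandermonde, pow_two, hdet, Finset.sum_mul_sum, Finset.sum_mul]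
    refine Finset.sum_congr rfl fun σ _ => ?_
    rw [Finset.sum_mul]
    refine Finset.sum_congr rfl fun τ _ => ?_
    simp only [Matrix.vandermonde_apply, pow_add, Finset.prod_mul_distrib]
    ring
  unfold jacobiPartition
  simp only [hpt]
  rw [hvol]
  have hI : ∀ σ τ : Equiv.Perm (Fin n), MeasureTheory.Integrable (fun x : Fin n → ℝ =>
      ((Equiv.Perm.sign σ : ℤ) : ℝ) * ((Equiv.Perm.sign τ : ℤ) : ℝ) *
          ∏ i, (x i ^ ((σ i : ℕ) + τ i) * jacobiWeight α β (x i)))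
      (MeasureTheory.Measure.pi fun _ => μ) := fun σ τ =>
    (MeasureTheory.Integrable.fintype_prod (μ := fun _ => μ)
      (f := fun i x => x ^ ((σ i : ℕ) + τ i) * jacobiWeight α β x) fun i => hint _).const_mul _
  rw [MeasureTheory.integral_finsetSum _ fun σ _ =>
    MeasureTheory.integrable_finsetSum _ fun τ _ => hI σ τ]
  -- For fixed `σ` the sum over `τ` is the Hankel determinant with permuted rows, whose sign cancels
  -- the explicit one. All `n!` values of `σ` give the same number, which removes the factor `1 /
  -- n!`.
  have hσ : ∀ σ : Equiv.Perm (Fin n), ∫ x : Fin n → ℝ, ∑ τ : Equiv.Perm (Fin n),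
        ((Equiv.Perm.sign σ : ℤ) : ℝ) * ((Equiv.Perm.sign τ : ℤ) : ℝ) *
          ∏ i, (x i ^ ((σ i : ℕ) + τ i) * jacobiWeight α β (x i))
          ∂(MeasureTheory.Measure.pi fun _ => μ) = (jacobiHankel α β t n).det := fun σ => by
    rw [MeasureTheory.integral_finsetSum _ fun τ _ => hI σ τ]
    have h2 := Matrix.det_permute σ (jacobiHankel α β t n)
    rw [hdet] at h2
    have h3 : ((Equiv.Perm.sign σ : ℤ) : ℝ) * ((Equiv.Perm.sign σ : ℤ) : ℝ) = 1 := by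
      rw [← Int.cast_mul, Int.units_coe_mul_self]; simp
    have h4 := congrArg (fun z => ((Equiv.Perm.sign σ : ℤ) : ℝ) * z) h2
    simp only [← mul_assoc, h3, one_mul, Finset.mul_sum] at h4
    rw [← h4]
    refine Finset.sum_congr rfl fun τ _ => ?_
    rw [MeasureTheory.integral_const_mul,
      MeasureTheory.integral_fintype_prod_eq_prod (μ := fun _ => μ)
        (f := fun i x => x ^ ((σ i : ℕ) + τ i) * jacobiWeight α β x)]
    simp [hmom, jacobiHankel]
  simp only [hσ, Finset.sum_const, Finset.card_univ, Fintype.card_perm, Fintype.card_fin,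
    nsmul_eq_mul]
  rw [← mul_assoc, one_div, inv_mul_cancel₀ (by exact_mod_cast n.factorial_ne_zero), one_mul]

lemma jacobiProb_eq (hα : 0 < α) (hβ : 0 < β) (h1 : t ≤ 1) (n : ℕ) :
    jacobiProb t α β n = (jacobiHankel α β t n).det / (jacobiHankel α β 0 n).det := by
  rw [jacobiProb, jacobiPartition_eq_det hα hβ h1, jacobiPartition_eq_det hα hβ zero_le_one]

end

/-! ### A lower bound for the probability -/

section

variable {α β t : ℝ}

/-- Pythagoras: `f` is its top coefficient times `P_k` plus a polynomial orthogonal to `P_k`. -/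
lemma sq_mul_jopNorm_le (hα : 0 < α) (hβ : 0 < β) (h0 : 0 ≤ t) (h1 : t < 1) {k : ℕ} {f : ℝ[X]}
    (hf : f.degree < (k + 1 : ℕ)) :
    f.coeff k ^ 2 * jopNorm α β t k ≤ jacobiL α β t (f * f) := by
  set g := f - C (f.coeff k) * jop α β t k with hg
  have hd : g.degree < k := degree_sub_jop_lt hf
  have e : f * f = C (f.coeff k ^ 2) * (jop α β t k * jop α β t k) +
      C (2 * f.coeff k) * (jop α β t k * g) + g * g := by
    rw [hg]; simp only [C_mul, C_pow, map_ofNat]; ring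
  have hgg : 0 ≤ jacobiL α β t (g * g) := by
    rcases eq_or_ne g 0 with h | h
    · simp [h, jacobiL_zero]
    · exact (jacobiL_mul_self_pos hα hβ h0 h1 h).le
  rw [e, jacobiL_add hα hβ, jacobiL_add hα hβ, jacobiL_smul, jacobiL_smul,
    jacobiL_jop_mul_eq_zero hα hβ h0 h1 hd, ← jopNorm]
  linarith

/-- Replace `x ^ α` by the smaller `(x - t) ^ α` and map `(0, 1)` affinely onto `(t, 1)`. The
Jacobian gives `1` in the exponent and the weight `α + β`; the pulled-back polynomial has leading
coefficient `(1 - t) ^ k`, which gives `2 k` by extremality on `(0, 1)`. -/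
lemma rpow_mul_jopNorm_zero_le (hα : 0 < α) (hβ : 0 < β) (h0 : 0 ≤ t) (h1 : t < 1) (k : ℕ) :
    (1 - t) ^ (2 * k + α + β + 1) * jopNorm α β 0 k ≤ jopNorm α β t k := by
  have hR : 0 < 1 - t := sub_pos.2 h1
  set P := jop α β t k with hP
  set q : ℝ[X] := C (1 - t) * X + C t with hq
  have hqd : q.natDegree = 1 := natDegree_linear hR.ne'
  have hPd : P.natDegree = k :=
    natDegree_eq_of_le_of_coeff_ne_zero (jop_natDegree_le k) (by simp [hP, jop_coeff_self])
  have hcoeff : (P.comp q).coeff k = (1 - t) ^ k := by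
    have := coeff_comp_degree_mul_degree (p := P) (q := q) (by rw [hqd]; exact one_ne_zero)
    rw [hPd, hqd, mul_one, leadingCoeff, hPd, leadingCoeff, hqd] at this
    rw [this, hP, jop_coeff_self]
    simp [hq]
  have hdeg : (P.comp q).degree < (k + 1 : ℕ) := by
    refine lt_of_le_of_lt degree_le_natDegree ?_
    rw [natDegree_comp, hPd, hqd, mul_one]
    exact_mod_cast Nat.lt_succ_self k
  have hlow := sq_mul_jopNorm_le hα hβ le_rfl zero_lt_one hdeg
  have hcont : Continuous fun x => (P * P).eval x * ((x - t) ^ α * (1 - x) ^ β) :=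
    (P * P).continuous.mul (((continuous_id.sub continuous_const).rpow_const fun _ =>
      Or.inr hα.le).mul ((continuous_const.sub continuous_id).rpow_const fun _ => Or.inr hβ.le))
  have hmono : ∫ x in t..1, (P * P).eval x * ((x - t) ^ α * (1 - x) ^ β) ≤ jopNorm α β t k := by
    refine intervalIntegral.integral_mono_on h1.le (hcont.intervalIntegrable _ _)
      ((continuous_eval_mul_jacobiWeight hα hβ _).intervalIntegrable _ _) fun x hx => ?_
    have hx0 : 0 ≤ x - t := sub_nonneg.2 hx.1
    rw [eval_mul]
    exact mul_le_mul_of_nonneg_left (mul_le_mul_of_nonneg_right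
      (Real.rpow_le_rpow hx0 (by linarith) hα.le)
      (Real.rpow_nonneg (sub_nonneg.2 hx.2) _)) (mul_self_nonneg _)
  have hsub := intervalIntegral.mul_integral_comp_mul_add (a := 0) (b := 1)
    (f := fun x => (P * P).eval x * ((x - t) ^ α * (1 - x) ^ β)) (1 - t) t
  rw [mul_zero, zero_add, mul_one, sub_add_cancel] at hsub
  have hcomp : ∫ y in (0 : ℝ)..1, (P * P).eval ((1 - t) * y + t) *
      (((1 - t) * y + t - t) ^ α * (1 - ((1 - t) * y + t)) ^ β) =
      (1 - t) ^ α * (1 - t) ^ β * jacobiL α β 0 (P.comp q * P.comp q) := by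
    rw [jacobiL, ← intervalIntegral.integral_const_mul]
    refine intervalIntegral.integral_congr fun y hy => ?_
    rw [Set.uIcc_of_le zero_le_one] at hy
    have e1 : (1 - t) * y + t - t = (1 - t) * y := by ring
    have e2 : 1 - ((1 - t) * y + t) = (1 - t) * (1 - y) := by ring
    simp only [e1, e2, Real.mul_rpow hR.le hy.1, Real.mul_rpow hR.le (sub_nonneg.2 hy.2),
      jacobiWeight, eval_mul, eval_comp, hq, eval_add, eval_C, eval_X]
    ring
  rw [hcomp] at hsub
  refine le_trans ?_ (hsub.trans_le hmono)
  rw [hcoeff] at hlow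
  have hpow : (1 - t) ^ (2 * k + α + β + 1) =
      (1 - t) * ((1 - t) ^ α * (1 - t) ^ β) * ((1 - t) ^ k) ^ 2 := by
    rw [show (2 * k + α + β + 1 : ℝ) = ((2 * k + 1 : ℕ) : ℝ) + α + β by push_cast; ring,
      Real.rpow_add hR, Real.rpow_add hR, Real.rpow_natCast]
    ring
  have hle := mul_le_mul_of_nonneg_left hlow
    (by positivity : 0 ≤ (1 - t) * ((1 - t) ^ α * (1 - t) ^ β))
  rw [hpow, mul_assoc]
  exact hle.trans_eq (by ring)

lemma rpow_le_jacobiProb (hα : 0 < α) (hβ : 0 < β) (h0 : 0 ≤ t) (h1 : t < 1) (n : ℕ) :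
    (1 - t) ^ (n * (n + α + β)) ≤ jacobiProb t α β n := by
  have hR : 0 < 1 - t := sub_pos.2 h1
  rw [jacobiProb_eq hα hβ h1.le, det_jacobiHankel hα hβ h0 h1,
    det_jacobiHankel hα hβ le_rfl zero_lt_one, ← Finset.prod_div_distrib]
  have : (1 - t) ^ (n * (n + α + β)) =
      ∏ k ∈ Finset.range n, (1 - t) ^ (2 * k + α + β + 1) := by
    induction n with
    | zero => simp
    | succ n ih =>
      rw [Finset.prod_range_succ, ← ih, ← Real.rpow_add hR]
      congr 1; push_cast; ring
  rw [this]
  refine Finset.prod_le_prod (fun k _ => (Real.rpow_pos_of_pos hR _).le) fun k _ => ?_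
  rw [le_div_iff₀ (jopNorm_pos hα hβ le_rfl zero_lt_one k)]
  exact rpow_mul_jopNorm_zero_le hα hβ h0 h1 k

/-- The bound `(1 - t) ^ (n (n + α + β))` at `t = s / (4 n²)` stays away from `0` uniformly in `n`,
by `log (1 - t) ≥ -2 t` for `t ≤ 1 / 2`. This makes the limit positive. -/
lemma exp_le_jacobiProb (hα : 0 < α) (hβ : 0 < β) {s : ℝ} (hs : 0 ≤ s) {n : ℕ} (hn : 1 ≤ n)
    (hsn : s ≤ 2 * (n : ℝ) ^ 2) :
    Real.exp (-(s / 2 * (1 + α + β))) ≤ jacobiProb (s / (4 * (n : ℝ) ^ 2)) α β n := by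
  have hn' : (1 : ℝ) ≤ n := by exact_mod_cast hn
  set t := s / (4 * (n : ℝ) ^ 2) with ht
  have hst : s = 4 * (n : ℝ) ^ 2 * t := by rw [ht]; field_simp
  have ht0 : 0 ≤ t := by positivity
  have ht1 : t ≤ 1 / 2 := by rw [ht, div_le_iff₀ (by positivity)]; linarith
  refine le_trans ?_ (rpow_le_jacobiProb hα hβ ht0 (by linarith) n)
  have hR : 0 < 1 - t := by linarith
  have hlog : -(2 * t) ≤ Real.log (1 - t) := by
    rw [Real.le_log_iff_exp_le hR, Real.exp_neg]
    have h2 := Real.add_one_le_exp (2 * t)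
    refine (inv_anti₀ (by linarith) h2).trans ?_
    rw [inv_le_iff_one_le_mul₀ (by linarith)]
    nlinarith
  rw [Real.rpow_def_of_pos hR]
  refine Real.exp_le_exp.2 ?_
  have h3 : (n : ℝ) * (n + α + β) ≤ (n : ℝ) ^ 2 * (1 + α + β) := by
    nlinarith [mul_nonneg (sub_nonneg.2 hn') (add_pos hα hβ).le]
  have h4 : 0 ≤ (n : ℝ) * (n + α + β) := by positivity
  calc -(s / 2 * (1 + α + β)) = -(2 * t) * ((n : ℝ) ^ 2 * (1 + α + β)) := by rw [hst]; ring
    _ ≤ -(2 * t) * (n * (n + α + β)) := mul_le_mul_of_nonpos_left h3 (by linarith)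
    _ ≤ _ := mul_le_mul_of_nonneg_right hlog h4

end

/-! ### The Jacobi polynomials on `(0, 1)` -/

section

variable {α β : ℝ}

/-- The coefficients of the hypergeometric polynomial `₂F₁(-m, m + α + β + 1; α + 1; x)`. -/
noncomputable def jacobiCoeff (α β : ℝ) (m : ℕ) : ℕ → ℝ
  | 0 => 1
  | j + 1 => -(((m : ℝ) - j) * (m + α + β + 1 + j)) / ((j + 1) * (α + 1 + j)) * jacobiCoeff α β m j

lemma jacobiCoeff_succ (α β : ℝ) (m j : ℕ) : jacobiCoeff α β m (j + 1) =
    -(((m : ℝ) - j) * (m + α + β + 1 + j)) / ((j + 1) * (α + 1 + j)) * jacobiCoeff α β m j := rfl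

/-- The Jacobi polynomial on `(0, 1)` with value `1` at `0`. -/
noncomputable def jacobiPoly (α β : ℝ) (m : ℕ) : ℝ[X] :=
  ∑ j ∈ Finset.range (m + 1), C (jacobiCoeff α β m j) * X ^ j

lemma jacobiCoeff_eq_zero {m j : ℕ} (h : m < j) : jacobiCoeff α β m j = 0 := by
  induction j with
  | zero => omega
  | succ j ih =>
    rw [jacobiCoeff]
    rcases (Nat.lt_succ_iff.1 h).lt_or_eq with h | rfl
    · rw [ih h, mul_zero]
    · simp

lemma coeff_jacobiPoly (m j : ℕ) : (jacobiPoly α β m).coeff j = jacobiCoeff α β m j := by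
  rw [jacobiPoly, finsetSum_coeff]
  simp only [coeff_C_mul, coeff_X_pow, mul_ite, mul_one, mul_zero, Finset.sum_ite_eq,
    Finset.mem_range]
  split_ifs with h
  · rfl
  · exact (jacobiCoeff_eq_zero (by omega)).symm

lemma jacobiPoly_degree_lt {m n : ℕ} (h : m < n) : (jacobiPoly α β m).degree < n :=
  (degree_lt_iff_coeff_zero _ _).2 fun i hi => by
    rw [coeff_jacobiPoly, jacobiCoeff_eq_zero (h.trans_le hi)]

lemma jacobiPoly_ne_zero (m : ℕ) : jacobiPoly α β m ≠ 0 := fun h => by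
  have := coeff_jacobiPoly (α := α) (β := β) m 0
  simp [h, jacobiCoeff] at this

lemma jacobiPoly_zero : jacobiPoly α β 0 = 1 := by simp [jacobiPoly, jacobiCoeff]

/-- The hypergeometric differential equation. -/
lemma pearson_derivative_jacobiPoly (hα : 0 < α) (m : ℕ) :
    pearson α β (derivative (jacobiPoly α β m)) =
      -(C (m * (m + α + β + 1) : ℝ) * jacobiPoly α β m) := by
  ext i
  rw [coeff_neg, coeff_C_mul, coeff_jacobiPoly]
  have hrec : ∀ j : ℕ, (j + 1) * (α + 1 + j) * jacobiCoeff α β m (j + 1) =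
      -(((m : ℝ) - j) * (m + α + β + 1 + j)) * jacobiCoeff α β m j := fun j => by
    have : (0 : ℝ) < α + 1 + j := by positivity
    rw [jacobiCoeff]; field_simp
  rcases i with _ | i
  · have h := hrec 0
    simp only [pearson, coeff_add, mul_coeff_zero, coeff_X_zero, coeff_sub, coeff_C_zero,
      coeff_derivative, coeff_jacobiPoly]
    push_cast at h ⊢
    linear_combination h
  · have h := hrec (i + 1)
    rw [coeff_pearson, coeff_derivative, coeff_derivative, coeff_jacobiPoly, coeff_jacobiPoly]
    push_cast at h ⊢
    linear_combination h

lemma derivative_jacobiPoly (hα : 0 < α) (m : ℕ) : derivative (jacobiPoly α β (m + 1)) =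
    C (-((m + 1) * (m + α + β + 2) / (α + 1)) : ℝ) * jacobiPoly (α + 1) (β + 1) m := by
  ext i
  rw [coeff_derivative, coeff_C_mul, coeff_jacobiPoly, coeff_jacobiPoly]
  induction i with
  | zero =>
    simp only [jacobiCoeff]
    push_cast
    field_simp
    ring
  | succ i ih =>
    have h1 : (0 : ℝ) < α + 1 + i := by positivity
    have h2 : (0 : ℝ) < α + 1 + (i + 1) := by positivity
    have h3 : (0 : ℝ) < α + 1 + 1 + i := by positivity
    rw [jacobiCoeff_succ α β (m + 1) (i + 1), jacobiCoeff_succ (α + 1) (β + 1) m i]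
    push_cast at ih ⊢
    have e : (-(((m : ℝ) + 1 - (i + 1)) * (m + 1 + α + β + 1 + (i + 1))) / ((i + 1 + 1) * (α + 1 + (i + 1))) *
        jacobiCoeff α β (m + 1) (i + 1)) * (i + 1 + 1) =
        -(((m : ℝ) - i) * (m + α + β + 3 + i)) / ((i + 1) * (α + 2 + i)) *
        (jacobiCoeff α β (m + 1) (i + 1) * (i + 1)) := by
      have h4 : (0 : ℝ) < α + 2 + i := by positivity
      have : α + 1 + ((i : ℝ) + 1) = α + 2 + i := by ring
      rw [this]
      field_simp
      ring
    rw [e, ih, show α + 2 + (i : ℝ) = α + 1 + 1 + i by ring]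
    field_simp
    ring

/-! ### Orthogonality and norms of the Jacobi polynomials. -/

lemma jacobiL_zero_mul (hα : 0 < α) (hβ : 0 < β) (f : ℝ[X]) :
    jacobiL α β 0 (X * (1 - X) * f) = jacobiL (α + 1) (β + 1) 0 f := by
  refine intervalIntegral.integral_congr fun x hx => ?_
  rw [Set.uIcc_of_le zero_le_one] at hx
  simp only [jacobiWeight, eval_mul, eval_X, eval_sub, eval_one]
  rw [Real.rpow_add_one' hx.1 (by positivity),
    Real.rpow_add_one' (sub_nonneg.2 hx.2) (by positivity)]
  ring

/-- Sturm–Liouville form of the hypergeometric equation; on `(0, 1)` no boundary term occurs. The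
right side is symmetric, so distinct eigenvalues give orthogonality, and equal arguments relate
norms across parameters. -/
lemma eigenvalue_mul_jacobiL (hα : 0 < α) (hβ : 0 < β) (m : ℕ) (q : ℝ[X]) :
    m * (m + α + β + 1) * jacobiL α β 0 (jacobiPoly α β m * q) =
      jacobiL (α + 1) (β + 1) 0 (derivative (jacobiPoly α β m) * derivative q) := by
  have h := jacobiL_pearson hα hβ le_rfl zero_le_one (derivative (jacobiPoly α β m) * q)
  have e : pearson α β (derivative (jacobiPoly α β m) * q) =
      pearson α β (derivative (jacobiPoly α β m)) * q +
        X * (1 - X) * (derivative (jacobiPoly α β m) * derivative q) := by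
    simp only [pearson, derivative_mul]; ring
  rw [e, jacobiL_add hα hβ, jacobiL_zero_mul hα hβ, pearson_derivative_jacobiPoly hα, neg_mul,
    jacobiL_neg, mul_assoc, jacobiL_smul] at h
  simp only [zero_mul, neg_zero] at h
  linarith

lemma jacobiL_jacobiPoly_mul (hα : 0 < α) (hβ : 0 < β) {m k : ℕ} (h : m ≠ k) :
    jacobiL α β 0 (jacobiPoly α β m * jacobiPoly α β k) = 0 := by
  have h1 := eigenvalue_mul_jacobiL hα hβ m (jacobiPoly α β k)
  have h2 := eigenvalue_mul_jacobiL hα hβ k (jacobiPoly α β m)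
  rw [mul_comm (jacobiPoly α β k), mul_comm (derivative (jacobiPoly α β k)), ← h1] at h2
  have hne : ((m : ℝ) - k) * (m + k + α + β + 1) ≠ 0 :=
    mul_ne_zero (sub_ne_zero.2 (by exact_mod_cast h)) (by positivity)
  refine (mul_eq_zero.1 (?_ : ((m : ℝ) - k) * (m + k + α + β + 1) * _ = 0)).resolve_left hne
  linear_combination -h2

/-- The squared norm of the Jacobi polynomial. -/
noncomputable def jacobiNorm (α β : ℝ) (m : ℕ) : ℝ :=
  jacobiL α β 0 (jacobiPoly α β m * jacobiPoly α β m)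

lemma jacobiNorm_pos (hα : 0 < α) (hβ : 0 < β) (m : ℕ) : 0 < jacobiNorm α β m :=
  jacobiL_mul_self_pos hα hβ le_rfl zero_lt_one (jacobiPoly_ne_zero m)

lemma jacobiNorm_succ (hα : 0 < α) (hβ : 0 < β) (m : ℕ) : jacobiNorm α β (m + 1) =
    (m + 1) * (m + α + β + 2) / (α + 1) ^ 2 * jacobiNorm (α + 1) (β + 1) m := by
  have h := eigenvalue_mul_jacobiL hα hβ (m + 1) (jacobiPoly α β (m + 1))
  rw [derivative_jacobiPoly hα, mul_mul_mul_comm, ← C_mul, jacobiL_smul, ← jacobiNorm,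
    ← jacobiNorm] at h
  have hne : ((m + 1 : ℕ) : ℝ) * ((m + 1 : ℕ) + α + β + 1) ≠ 0 := by positivity
  refine mul_left_cancel₀ hne (h.trans ?_)
  push_cast
  field_simp
  ring

lemma jacobiNorm_zero (hα : 0 < α) (hβ : 0 < β) : jacobiNorm α β 0 =
    Real.Gamma (α + 1) * Real.Gamma (β + 1) / Real.Gamma (α + β + 2) := by
  have h := ProbabilityTheory.beta_eq_betaIntegralReal (α + 1) (β + 1) (by positivity)
    (by positivity)
  have hb : ProbabilityTheory.beta (α + 1) (β + 1) =
    Real.Gamma (α + 1) * Real.Gamma (β + 1) / Real.Gamma (α + β + 2) := by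
    rw [ProbabilityTheory.beta]; congr 2; ring
  rw [← hb, h, Complex.betaIntegral, jacobiNorm, jacobiPoly_zero, jacobiL]
  have : ∀ x ∈ Set.uIcc (0 : ℝ) 1, (x : ℂ) ^ (((α + 1 : ℝ) : ℂ) - 1) *
      (1 - (x : ℂ)) ^ (((β + 1 : ℝ) : ℂ) - 1) =
      ((eval x (1 * 1 : ℝ[X]) * jacobiWeight α β x : ℝ) : ℂ) := fun x hx => by
    rw [Set.uIcc_of_le zero_le_one] at hx
    rw [jacobiWeight]
    push_cast
    rw [Complex.ofReal_cpow hx.1, Complex.ofReal_cpow (sub_nonneg.2 hx.2)]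
    simp
  rw [intervalIntegral.integral_congr this, intervalIntegral.integral_ofReal, Complex.ofReal_re]

lemma jacobiNorm_eq (m : ℕ) : ∀ {α β : ℝ}, 0 < α → 0 < β → jacobiNorm α β m =
    Real.Gamma (α + 1) ^ 2 * m.factorial * Real.Gamma (m + β + 1) /
      (Real.Gamma (m + α + 1) * Real.Gamma (m + α + β + 1) * (2 * m + α + β + 1)) := by
  -- The parameters are generalised because lowering the degree raises both `α` and `β` by one.
  induction m with
  | zero =>
    intro α β hα hβ
    have h1 := (Real.Gamma_pos_of_pos (show 0 < α + 1 by positivity)).ne'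
    have h2 := (Real.Gamma_pos_of_pos (show 0 < α + β + 1 by positivity)).ne'
    rw [jacobiNorm_zero hα hβ, show α + β + 2 = (α + β + 1) + 1 by ring,
      Real.Gamma_add_one (s := α + β + 1) (by positivity)]
    simp only [Nat.cast_zero, Nat.factorial_zero, Nat.cast_one, zero_add, mul_zero, mul_one]
    field_simp
  | succ m ih =>
    intro α β hα hβ
    rw [jacobiNorm_succ hα hβ, ih (by positivity) (by positivity),
      show (m : ℝ) + (α + 1) + (β + 1) + 1 = (m + α + β + 2) + 1 by ring,
      Real.Gamma_add_one (s := α + 1) (by positivity),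
      Real.Gamma_add_one (s := m + α + β + 2) (by positivity), Nat.factorial_succ]
    push_cast
    rw [show (m : ℝ) + 1 + α + β + 1 = m + α + β + 2 by ring,
      show (m : ℝ) + 1 + α + 1 = m + (α + 1) + 1 by ring,
      show (m : ℝ) + 1 + β + 1 = m + (β + 1) + 1 by ring,
      show 2 * ((m : ℝ) + 1) + α + β + 1 = 2 * m + (α + 1) + (β + 1) + 1 by ring]
    have h1 := (Real.Gamma_pos_of_pos (show 0 < m + (α + 1) + 1 by positivity)).ne'
    have h2 := (Real.Gamma_pos_of_pos (show 0 < m + α + β + 2 by positivity)).ne'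
    field_simp

/-- The coefficients of the reproducing kernel, i.e. the entries of the inverse Hankel matrix. -/
noncomputable def jacobiKerCoeff (α β : ℝ) (n j l : ℕ) : ℝ :=
  ∑ m ∈ Finset.range n, jacobiCoeff α β m j * jacobiCoeff α β m l / jacobiNorm α β m

lemma jacobiKerCoeff_eq_zero {n j l : ℕ} (h : n ≤ j ∨ n ≤ l) : jacobiKerCoeff α β n j l = 0 := by
  refine Finset.sum_eq_zero fun m hm => ?_
  rw [Finset.mem_range] at hm
  rcases h with h | h
  · rw [jacobiCoeff_eq_zero (hm.trans_le h)]; simp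
  · rw [jacobiCoeff_eq_zero (hm.trans_le h)]; simp

/-- From `P H Pᵀ = D⁻¹` one gets `H⁻¹ = Pᵀ D P`, whose entries are the kernel coefficients;
one-sided inverses of square matrices suffice. -/
lemma jacobiKerCoeff_mul_jacobiHankel (hα : 0 < α) (hβ : 0 < β) (n : ℕ) :
    (Matrix.of fun i j : Fin n => jacobiKerCoeff α β n i j) * jacobiHankel α β 0 n = 1 := by
  set P : Matrix (Fin n) (Fin n) ℝ := Matrix.of fun i j => jacobiCoeff α β i j with hP
  set D : Matrix (Fin n) (Fin n) ℝ := Matrix.diagonal fun i => (jacobiNorm α β i)⁻¹ with hD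
  have hmul : P * jacobiHankel α β 0 n * P.transpose =
      Matrix.diagonal fun i : Fin n => jacobiNorm α β i := by
    ext i j
    have h := jacobiL_mul_eq_sum (t := 0) hα hβ
      (jacobiPoly_degree_lt (α := α) (β := β) i.2) (jacobiPoly_degree_lt (α := α) (β := β) j.2)
    have : (P * jacobiHankel α β 0 n * P.transpose) i j =
        jacobiL α β 0 (jacobiPoly α β i * jacobiPoly α β j) := by
      rw [h, Finset.sum_comm]
      simp [Matrix.mul_apply, hP, Finset.sum_mul, coeff_jacobiPoly]
    rw [this, Matrix.diagonal_apply]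
    split_ifs with hij
    · rw [hij, jacobiNorm]
    · exact jacobiL_jacobiPoly_mul hα hβ fun h => hij (Fin.ext h)
  have h1 : P * (jacobiHankel α β 0 n * (P.transpose * D)) = 1 := by
    rw [← mul_assoc, ← mul_assoc, hmul, hD, Matrix.diagonal_mul_diagonal, ← Matrix.diagonal_one]
    congr 1
    ext i
    exact mul_inv_cancel₀ (jacobiNorm_pos hα hβ i).ne'
  have h2 : jacobiHankel α β 0 n * (P.transpose * D * P) = 1 := by
    rw [← mul_eq_one_comm.1 h1]; simp only [mul_assoc]
  rw [← mul_eq_one_comm.1 h2]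
  congr 1
  ext i j
  rw [Matrix.mul_apply]
  simp only [hP, hD, Matrix.of_apply, Matrix.transpose_apply, Matrix.mul_diagonal, jacobiKerCoeff]
  rw [← Fin.sum_univ_eq_sum_range
    (fun m => jacobiCoeff α β m i * jacobiCoeff α β m j / jacobiNorm α β m)]
  exact Finset.sum_congr rfl fun m _ => by ring

end

/-! ### Asymptotics of the kernel coefficients -/

section

lemma Gamma_mul_prod_range {a : ℝ} (ha : 0 < a) (n : ℕ) :
    Real.Gamma a * ∏ j ∈ Finset.range n, (a + j) = Real.Gamma (n + a) := by
  induction n with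
  | zero => simp
  | succ n ih =>
    rw [Finset.prod_range_succ, ← mul_assoc, ih]
    push_cast
    rw [show (n : ℝ) + 1 + a = n + a + 1 by ring, Real.Gamma_add_one (by positivity)]
    ring

/-- Euler's product limit for `Γ(a)`, rewritten with `Γ(a) ∏_{j ≤ n} (a + j) = Γ(n + a + 1)`. -/
lemma tendsto_Gamma_div_factorial {a : ℝ} (ha : 0 < a) :
    Tendsto (fun n : ℕ => Real.Gamma (n + a + 1) / (n.factorial * (n : ℝ) ^ a)) atTop (𝓝 1) := by
  have hG := (Real.Gamma_pos_of_pos ha).ne'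
  have h := (tendsto_const_nhds (x := Real.Gamma a)).div (Real.GammaSeq_tendsto_Gamma a) hG
  rw [div_self hG] at h
  refine h.congr fun n => ?_
  have h2 := Gamma_mul_prod_range ha (n + 1)
  push_cast at h2
  simp only [Pi.div_apply, Real.GammaSeq]
  rw [show (n : ℝ) + a + 1 = n + 1 + a by ring, ← h2, div_div_eq_mul_div, mul_comm ((n : ℝ) ^ a)]

/-- Stolz–Cesàro: `f` is compared with the increments of `m ^ (p + 1)`, which are positive,
telescope, and behave like `(p + 1) m ^ p`. -/
lemma tendsto_sum_div_rpow {f : ℕ → ℝ} {p L : ℝ} (hp : 0 < p)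
    (hf : Tendsto (fun m : ℕ => f m / (m : ℝ) ^ p) atTop (𝓝 L)) :
    Tendsto (fun n : ℕ => (∑ m ∈ Finset.range n, f m) / (n : ℝ) ^ (p + 1)) atTop
      (𝓝 (L / (p + 1))) := by
  set g : ℕ → ℝ := fun m => ((m + 1 : ℕ) : ℝ) ^ (p + 1) - (m : ℝ) ^ (p + 1) with hg
  have hp1 : 0 < p + 1 := by positivity
  have hgpos : ∀ m, 0 < g m := fun m =>
    sub_pos.2 (Real.rpow_lt_rpow (by positivity) (by push_cast; linarith) hp1)
  have hgsum : ∀ n, ∑ m ∈ Finset.range n, g m = (n : ℝ) ^ (p + 1) := fun n => by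
    rw [hg, Finset.sum_range_sub (fun m : ℕ => (m : ℝ) ^ (p + 1))]
    simp [Real.zero_rpow hp1.ne']
  have hglim : Tendsto (fun m : ℕ => g m / (m : ℝ) ^ p) atTop (𝓝 (p + 1)) := by
    have hd : HasDerivAt (fun x : ℝ => (1 + x) ^ (p + 1)) (p + 1) 0 := by
      refine (((hasDerivAt_id (0 : ℝ)).const_add 1).rpow_const (p := p + 1)
        (Or.inl (by simp))).congr_deriv (by simp)
    have h2 := (hasDerivAt_iff_tendsto_slope_zero.1 hd).comp
      (tendsto_inv_atTop_nhdsGT_zero.mono_right (nhdsGT_le_nhdsNE 0) |>.comp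
        (tendsto_natCast_atTop_atTop (R := ℝ)))
    refine h2.congr' ?_
    filter_upwards [eventually_gt_atTop 0] with m hm
    have hm' : (0 : ℝ) < m := by exact_mod_cast hm
    have e : ((m + 1 : ℕ) : ℝ) = m * (1 + (m : ℝ)⁻¹) := by push_cast; field_simp
    simp only [Function.comp_apply, hg, inv_inv, zero_add, smul_eq_mul, add_zero, Real.one_rpow]
    rw [e, Real.mul_rpow hm'.le (by positivity), Real.rpow_add_one hm'.ne']
    have := (Real.rpow_pos_of_pos hm' p).ne'
    field_simp
  have hratio : Tendsto (fun m : ℕ => f m / g m) atTop (𝓝 (L / (p + 1))) := by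
    refine (hf.div hglim hp1.ne').congr' ?_
    filter_upwards [eventually_gt_atTop 0] with m hm
    have hm' := (Real.rpow_pos_of_pos (show (0 : ℝ) < m by exact_mod_cast hm) p).ne'
    simp only [Pi.div_apply]
    field_simp
  have ho : (fun m => f m - L / (p + 1) * g m) =o[atTop] g := by
    rw [Asymptotics.isLittleO_iff_tendsto fun m h => absurd h (hgpos m).ne']
    have := hratio.sub_const (L / (p + 1))
    rw [sub_self] at this
    refine this.congr fun m => ?_
    have := (hgpos m).ne'
    field_simp
  have hs := ho.sum_range (fun m => (hgpos m).le) (by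
    simp only [hgsum]
    exact (tendsto_rpow_atTop hp1).comp tendsto_natCast_atTop_atTop)
  have hs2 := hs.tendsto_div_nhds_zero
  simp only [Finset.sum_sub_distrib, ← Finset.mul_sum, hgsum] at hs2
  have := hs2.add_const (L / (p + 1))
  rw [zero_add] at this
  refine this.congr' ?_
  filter_upwards [eventually_gt_atTop 0] with m hm
  have hm' := (Real.rpow_pos_of_pos (show (0 : ℝ) < m by exact_mod_cast hm) (p + 1)).ne'
  field_simp
  ring

variable {α β : ℝ}

/-- The Gamma quotients contribute `m ^ α · m ^ (α + β) / m ^ β` and the last factor `2 m`; thus `β`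
cancels from the leading term. -/
lemma tendsto_inv_jacobiNorm (hα : 0 < α) (hβ : 0 < β) :
    Tendsto (fun m : ℕ => (jacobiNorm α β m)⁻¹ / (m : ℝ) ^ (2 * α + 1)) atTop
      (𝓝 (2 / Real.Gamma (α + 1) ^ 2)) := by
  have h1 := (((tendsto_Gamma_div_factorial hα).mul
    (tendsto_Gamma_div_factorial (add_pos hα hβ))).div (tendsto_Gamma_div_factorial hβ)
    one_ne_zero).mul (((tendsto_inv_atTop_zero.comp (tendsto_natCast_atTop_atTop (R := ℝ))).const_mul
      (α + β + 1)).const_add 2 |>.div_const (Real.Gamma (α + 1) ^ 2))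
  simp only [mul_one, div_one, one_mul, mul_zero, add_zero] at h1
  refine h1.congr' ?_
  filter_upwards [eventually_gt_atTop 0] with m hm
  have hm' : (0 : ℝ) < m := by exact_mod_cast hm
  have hf : (m.factorial : ℝ) ≠ 0 := by exact_mod_cast m.factorial_ne_zero
  have g1 := (Real.Gamma_pos_of_pos (show 0 < α + 1 by positivity)).ne'
  have g2 := (Real.Gamma_pos_of_pos (show 0 < (m : ℝ) + β + 1 by positivity)).ne'
  have g3 := (Real.Gamma_pos_of_pos (show 0 < (m : ℝ) + α + 1 by positivity)).ne'
  have g4 := (Real.Gamma_pos_of_pos (show 0 < (m : ℝ) + α + β + 1 by positivity)).ne'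
  have p1 := (Real.rpow_pos_of_pos hm' α).ne'
  have p2 := (Real.rpow_pos_of_pos hm' β).ne'
  rw [jacobiNorm_eq m hα hβ, show 2 * α + 1 = α + α + 1 by ring, Real.rpow_add_one hm'.ne',
    Real.rpow_add hm']
  simp only [Pi.div_apply, Function.comp_apply]
  rw [Real.rpow_add hm', ← add_assoc (m : ℝ) α β]
  field_simp
  ring

lemma tendsto_jacobiCoeff (j : ℕ) : ∃ L, Tendsto (fun m : ℕ => jacobiCoeff α β m j /
    (m : ℝ) ^ (2 * j)) atTop (𝓝 L) := by
  induction j with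
  | zero => exact ⟨1, by simp [jacobiCoeff]⟩
  | succ j ih =>
    obtain ⟨L, hL⟩ := ih
    have hinv := tendsto_inv_atTop_zero.comp (tendsto_natCast_atTop_atTop (R := ℝ))
    have h1 := (((hinv.const_mul (j : ℝ)).const_sub 1).mul
      ((hinv.const_mul (α + β + 1 + j)).const_add 1)).mul_const (-(1 / ((j + 1) * (α + 1 + j))))
    refine ⟨_, (h1.mul hL).congr' ?_⟩
    filter_upwards [eventually_gt_atTop 0] with m hm
    have hm' : (m : ℝ) ≠ 0 := by exact_mod_cast hm.ne'
    rw [jacobiCoeff_succ, show 2 * (j + 1) = 2 * j + 2 by ring, pow_add]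
    simp only [Function.comp_apply]
    -- No sign is assumed for `α` here; if the denominator is zero, division by zero makes the
    -- coefficient zero and the limit is trivial.
    rcases eq_or_ne ((j + 1 : ℝ) * (α + 1 + j)) 0 with h | h
    · simp [h]
    · field_simp
      ring

lemma abs_jacobiCoeff_le (hα : 0 < α) (hβ : 0 < β) {m n : ℕ} (hmn : m < n) (j : ℕ) :
    |jacobiCoeff α β m j| ≤ ((α + β + 3) * (n : ℝ) ^ 2) ^ j / j.factorial := by
  induction j with
  | zero => simp [jacobiCoeff]
  | succ j ih =>
    have hn : (m : ℝ) + 1 ≤ n := by exact_mod_cast hmn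
    have hn1 : (1 : ℝ) ≤ n := le_trans (by linarith [m.cast_nonneg (α := ℝ)]) hn
    rcases le_or_gt j m with hjm | hjm
    · have hjm' : (j : ℝ) ≤ m := by exact_mod_cast hjm
      have hj0 : (0 : ℝ) ≤ j := j.cast_nonneg
      have hm0 : (0 : ℝ) ≤ m := m.cast_nonneg
      rw [jacobiCoeff_succ, abs_mul, abs_div, abs_neg, abs_of_nonneg (mul_nonneg (sub_nonneg.2 hjm')
        (by positivity)), abs_of_pos (by positivity)]
      have h1 : ((m : ℝ) - j) * (m + α + β + 1 + j) / ((j + 1) * (α + 1 + j)) ≤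
          (α + β + 3) * (n : ℝ) ^ 2 / (j + 1) := by
        have hnum : ((m : ℝ) - j) * (m + α + β + 1 + j) ≤ (α + β + 3) * (n : ℝ) ^ 2 := by
          calc ((m : ℝ) - j) * (m + α + β + 1 + j) ≤ n * ((α + β + 3) * n) :=
                mul_le_mul (by linarith) (by nlinarith) (by positivity) (by positivity)
            _ = _ := by ring
        exact div_le_div₀ (by positivity) hnum (by positivity)
          (le_mul_of_one_le_right (by positivity) (by linarith))
      refine (mul_le_mul h1 ih (abs_nonneg _) (by positivity)).trans_eq ?_
      rw [Nat.factorial_succ, pow_succ]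
      push_cast
      field_simp
      ring
    · rw [jacobiCoeff_eq_zero (by omega), abs_zero]
      positivity

/-- The kernel coefficients, scaled to the hard edge. -/
noncomputable def scaledKerCoeff (α β : ℝ) (n j l : ℕ) : ℝ :=
  jacobiKerCoeff α β n j l / ((4 * (n : ℝ) ^ 2) ^ (α + 1) * (4 * (n : ℝ) ^ 2) ^ (j + l))

lemma scaledKerCoeff_eq_zero {n j l : ℕ} (h : n ≤ j ∨ n ≤ l) : scaledKerCoeff α β n j l = 0 := by
  rw [scaledKerCoeff, jacobiKerCoeff_eq_zero h, zero_div]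

/-- The summands grow like `m ^ (2 (j + l) + 2 α + 1)`, so their sum has order `(n²) ^ (α + 1 + j +
l)`, exactly the scaling divided out. -/
lemma tendsto_scaledKerCoeff (hα : 0 < α) (hβ : 0 < β) (j l : ℕ) :
    ∃ e, Tendsto (fun n => scaledKerCoeff α β n j l) atTop (𝓝 e) := by
  obtain ⟨a, ha⟩ := tendsto_jacobiCoeff (α := α) (β := β) j
  obtain ⟨b, hb⟩ := tendsto_jacobiCoeff (α := α) (β := β) l
  have h := (ha.mul hb).mul (tendsto_inv_jacobiNorm hα hβ)
  have h2 := tendsto_sum_div_rpow (p := 2 * (j + l : ℕ) + (2 * α + 1))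
    (f := fun m => jacobiCoeff α β m j * jacobiCoeff α β m l / jacobiNorm α β m) (by positivity)
    (h.congr' ?_)
  · refine ⟨_, (h2.div_const (4 ^ (α + 1) * 4 ^ (j + l))).congr' ?_⟩
    filter_upwards [eventually_gt_atTop 0] with n hn
    have hn' : (0 : ℝ) < n := by exact_mod_cast hn
    rw [scaledKerCoeff, jacobiKerCoeff, div_div]
    congr 1
    rw [Real.mul_rpow (by norm_num) (by positivity), mul_pow, ← Real.rpow_natCast (n : ℝ) 2,
      ← Real.rpow_mul hn'.le, ← Real.rpow_natCast ((n : ℝ) ^ ((2 : ℕ) : ℝ)), ← Real.rpow_mul hn'.le,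
      show 2 * ((j + l : ℕ) : ℝ) + (2 * α + 1) + 1 =
        ((2 : ℕ) : ℝ) * (α + 1) + ((2 : ℕ) : ℝ) * ((j + l : ℕ) : ℝ) by push_cast; ring,
      Real.rpow_add hn']
    ring
  · filter_upwards [eventually_gt_atTop 0] with m hm
    have hm' : (0 : ℝ) < m := by exact_mod_cast hm
    rw [Real.rpow_add hm' (2 * ((j + l : ℕ) : ℝ)) (2 * α + 1), show 2 * ((j + l : ℕ) : ℝ) = ((2 * j + 2 * l : ℕ) : ℝ) by push_cast; ring,
      Real.rpow_natCast, pow_add]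
    have := (Real.rpow_pos_of_pos hm' (2 * α + 1)).ne'
    field_simp

lemma exists_abs_scaledKerCoeff_le (hα : 0 < α) (hβ : 0 < β) : ∃ K, 0 < K ∧ ∀ n j l,
    |scaledKerCoeff α β n j l| ≤
      K * ((α + β + 3) ^ j / j.factorial * ((α + β + 3) ^ l / l.factorial)) := by
  obtain ⟨K, hK⟩ := (tendsto_inv_jacobiNorm hα hβ).bddAbove_range
  -- The asymptotic bound says nothing at `m = 0`, where `m ^ (2 α + 1)` vanishes; hence the maximum
  -- with the inverse norm at `0` and the shift to `m + 1`.
  have hK' : ∀ m : ℕ, (jacobiNorm α β m)⁻¹ ≤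
      max K (jacobiNorm α β 0)⁻¹ * ((m : ℝ) + 1) ^ (2 * α + 1) := by
    intro m
    rcases m.eq_zero_or_pos with rfl | hm
    · simp
    · have hm' : (0 : ℝ) < m := by exact_mod_cast hm
      have h1 := hK ⟨m, rfl⟩
      rw [div_le_iff₀ (by positivity)] at h1
      refine h1.trans ((mul_le_mul_of_nonneg_right (le_max_left K (jacobiNorm α β 0)⁻¹)
        (by positivity)).trans (mul_le_mul_of_nonneg_left
          (Real.rpow_le_rpow hm'.le (by linarith) (by positivity)) ?_))
      exact (inv_pos.2 (jacobiNorm_pos hα hβ 0)).le.trans (le_max_right _ _)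
  set M := max K (jacobiNorm α β 0)⁻¹ with hM
  have hMpos : 0 < M := (inv_pos.2 (jacobiNorm_pos hα hβ 0)).trans_le (le_max_right _ _)
  refine ⟨M, hMpos, fun n j l => ?_⟩
  rcases n.eq_zero_or_pos with rfl | hn
  · rw [scaledKerCoeff_eq_zero (Or.inl (Nat.zero_le j)), abs_zero]; positivity
  have hn' : (0 : ℝ) < n := by exact_mod_cast hn
  have hn1 : (1 : ℝ) ≤ n := by exact_mod_cast hn
  have hker : |jacobiKerCoeff α β n j l| ≤ n * (((α + β + 3) * (n : ℝ) ^ 2) ^ j / j.factorial *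
      (((α + β + 3) * (n : ℝ) ^ 2) ^ l / l.factorial) * (M * (n : ℝ) ^ (2 * α + 1))) := by
    refine (Finset.abs_sum_le_sum_abs _ _).trans ((Finset.sum_le_card_nsmul _ _ _ ?_).trans_eq
      (by rw [Finset.card_range, nsmul_eq_mul]))
    intro m hm
    rw [Finset.mem_range] at hm
    rw [abs_div, abs_mul, abs_of_pos (jacobiNorm_pos hα hβ m), div_eq_mul_inv]
    have hmn : (m : ℝ) + 1 ≤ n := by exact_mod_cast hm
    refine mul_le_mul (mul_le_mul (abs_jacobiCoeff_le hα hβ hm j) (abs_jacobiCoeff_le hα hβ hm l)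
      (abs_nonneg _) (by positivity)) ((hK' m).trans (mul_le_mul_of_nonneg_left
      (Real.rpow_le_rpow (by positivity) hmn (by positivity)) hMpos.le))
      (inv_pos.2 (jacobiNorm_pos hα hβ m)).le (by positivity)
  rw [scaledKerCoeff, abs_div, abs_of_pos (by positivity : 0 < (4 * (n : ℝ) ^ 2) ^ (α + 1) *
    (4 * (n : ℝ) ^ 2) ^ (j + l)), div_le_iff₀ (by positivity)]
  refine hker.trans ?_
  have h4 : (n : ℝ) * (n : ℝ) ^ (2 * α + 1) ≤ (4 * (n : ℝ) ^ 2) ^ (α + 1) := by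
    rw [Real.mul_rpow (by norm_num) (by positivity), ← Real.rpow_natCast (n : ℝ) 2,
      ← Real.rpow_mul hn'.le, mul_comm (n : ℝ), ← Real.rpow_add_one hn'.ne',
      show 2 * α + 1 + 1 = ((2 : ℕ) : ℝ) * (α + 1) by push_cast; ring]
    exact le_mul_of_one_le_left (by positivity) (Real.one_le_rpow (by norm_num) (by positivity))
  have h5 : ((n : ℝ) ^ 2) ^ (j + l) ≤ (4 * (n : ℝ) ^ 2) ^ (j + l) :=
    pow_le_pow_left₀ (by positivity) (by nlinarith [sq_nonneg (n : ℝ)]) _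
  calc _ = M * ((α + β + 3) ^ j / j.factorial * ((α + β + 3) ^ l / l.factorial)) *
        ((n * (n : ℝ) ^ (2 * α + 1)) * ((n : ℝ) ^ 2) ^ (j + l)) := by
          rw [mul_pow, mul_pow, pow_add]; ring
    _ ≤ _ := mul_le_mul_of_nonneg_left (mul_le_mul h4 h5 (by positivity) (by positivity))
        (by positivity)

end

/-! ### Fredholm determinants of infinite matrices -/

section

/-- Expand multilinearly in the rows: outside `S` the rows are those of the identity, so the matrix
is block triangular and its determinant is the minor on `S`. -/
lemma det_one_add_eq_sum_minors {ι : Type*} [Fintype ι] [DecidableEq ι] (M : Matrix ι ι ℂ) :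
    (1 + M).det = ∑ S : Finset ι, (Matrix.of fun i j : S => M i j).det := by
  set I : ι → ι → ℂ := fun i => (1 : Matrix ι ι ℂ) i with hI
  have h : (M + 1).det = ∑ S : Finset ι, Matrix.det (Matrix.of (S.piecewise (fun i => M i) I)) :=
    (Matrix.detRowAlternating (R := ℂ) (n := ι)).toMultilinearMap.map_add_univ (fun i => M i) I
  rw [add_comm, h]
  refine Finset.sum_congr rfl fun S _ => ?_
  have hrow : ∀ i, i ∉ S → ∀ j, Matrix.of (S.piecewise (fun i => M i) I) i j =
      (1 : Matrix ι ι ℂ) i j :=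
    fun i hi j => congrFun (Finset.piecewise_eq_of_notMem _ _ _ hi) j
  have hrow' : ∀ i, i ∈ S → ∀ j, Matrix.of (S.piecewise (fun i => M i) I) i j = M i j :=
    fun i hi j => congrFun (Finset.piecewise_eq_of_mem _ _ _ hi) j
  rw [Matrix.twoBlockTriangular_det _ (fun i => i ∈ S) fun i hi j hj => by
    rw [hrow i hi, Matrix.one_apply_ne]; rintro rfl; exact hi hj]
  have h1 : (Matrix.toSquareBlockProp (Matrix.of (S.piecewise (fun i => M i) I)) fun i => i ∉ S) = 1 := by
    ext i j
    rw [Matrix.toSquareBlockProp_def, Matrix.of_apply, hrow _ i.2, Matrix.one_apply, Matrix.one_apply]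
    simp [Subtype.ext_iff]
  rw [h1, Matrix.det_one, mul_one]
  have h2 : (Matrix.toSquareBlockProp (Matrix.of (S.piecewise (fun i => M i) I)) fun i => i ∈ S) =
      Matrix.of fun i j : S => M i j := by
    ext i j
    rw [Matrix.toSquareBlockProp_def, Matrix.of_apply, hrow' _ i.2, Matrix.of_apply]
  rw [h2]
  congr!

/-- Multiplying out the row sums gives a nonnegative term for every function `ι → ι`; permutations
are among them. -/
lemma norm_det_le_prod_sum {ι : Type*} [Fintype ι] [DecidableEq ι] (M : Matrix ι ι ℂ) :
    ‖M.det‖ ≤ ∏ i, ∑ j, ‖M i j‖ := by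
  rw [← Matrix.det_transpose, Matrix.det_apply, Finset.prod_univ_sum, Fintype.piFinset_univ]
  refine (norm_sum_le _ _).trans ?_
  have : ∀ σ : Equiv.Perm ι, ‖Equiv.Perm.sign σ • ∏ i, M.transpose (σ i) i‖ =
      ∏ i, ‖M i ((σ : ι → ι) i)‖ := fun σ => by
    rw [← norm_prod]
    rcases Int.units_eq_one_or (Equiv.Perm.sign σ) with h | h <;> simp [h]
  simp only [this]
  set F : (ι → ι) → ℝ := fun f => ∏ i, ‖M i (f i)‖ with hF
  have hFn : ∀ f, 0 ≤ F f := fun f => Finset.prod_nonneg fun _ _ => norm_nonneg _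
  have hmap : ∑ σ : Equiv.Perm ι, F σ = ∑ f ∈ Finset.univ.map
      ⟨fun σ : Equiv.Perm ι => (σ : ι → ι), DFunLike.coe_injective⟩, F f :=
    (Finset.sum_map Finset.univ (⟨fun σ : Equiv.Perm ι => (σ : ι → ι), DFunLike.coe_injective⟩ :
      Equiv.Perm ι ↪ (ι → ι)) F).symm
  exact hmap.trans_le (Finset.sum_le_sum_of_subset_of_nonneg (Finset.subset_univ _)
    fun f _ _ => hFn f)

/-- A principal minor of an infinite matrix. -/
noncomputable def minor (A : ℕ → ℕ → ℂ) (S : Finset ℕ) : ℂ :=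
  (Matrix.of fun i j : S => A i j).det

lemma minor_empty (A : ℕ → ℕ → ℂ) : minor A ∅ = 1 := Matrix.det_isEmpty

lemma det_one_add_fin (A : ℕ → ℕ → ℂ) (n : ℕ) :
    (1 + Matrix.of fun i j : Fin n => A i j).det = ∑ S ∈ (Finset.range n).powerset, minor A S := by
  rw [det_one_add_eq_sum_minors]
  refine Finset.sum_bij (fun S _ => S.map Fin.valEmbedding) (fun S _ => ?_) (fun S _ T _ h => ?_)
    (fun T hT => ?_) fun S _ => ?_
  · rw [Finset.mem_powerset]
    intro x hx
    obtain ⟨y, -, rfl⟩ := Finset.mem_map.1 hx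
    exact Finset.mem_range.2 y.2
  · exact Finset.map_injective _ h
  · rw [Finset.mem_powerset] at hT
    refine ⟨Finset.univ.filter fun i : Fin n => (i : ℕ) ∈ T, Finset.mem_univ _, ?_⟩
    ext x
    simp only [Finset.mem_map, Finset.mem_filter, Finset.mem_univ, true_and, Fin.valEmbedding_apply]
    constructor
    · rintro ⟨y, hy, rfl⟩; exact hy
    · intro hx; exact ⟨⟨x, Finset.mem_range.1 (hT hx)⟩, hx, rfl⟩
  · let e : S ≃ S.map Fin.valEmbedding := Equiv.ofBijective
      (fun x => ⟨x, Finset.mem_map.2 ⟨x, x.2, rfl⟩⟩)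
      ⟨fun x y h => Subtype.ext (Fin.ext (congrArg Subtype.val h)), fun y => by
        obtain ⟨x, hx, hxy⟩ := Finset.mem_map.1 y.2
        exact ⟨⟨x, hx⟩, Subtype.ext hxy⟩⟩
    rw [minor, ← Matrix.det_submatrix_equiv_self e]
    rfl

lemma norm_minor_le {A : ℕ → ℕ → ℂ} {r c : ℕ → ℝ} (hr : ∀ j, 0 ≤ r j) (hc : ∀ k, 0 ≤ c k)
    (hcs : Summable c) (h : ∀ j k, ‖A j k‖ ≤ r j * c k) (S : Finset ℕ) :
    ‖minor A S‖ ≤ ∏ j ∈ S, (r j * ∑' k, c k) := by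
  refine (norm_det_le_prod_sum _).trans ?_
  rw [← Finset.prod_coe_sort S (fun j => r j * ∑' k, c k)]
  refine Finset.prod_le_prod (fun i _ => Finset.sum_nonneg fun _ _ => norm_nonneg _) fun i _ => ?_
  refine (Finset.sum_le_sum (g := fun j : S => r i * c j) fun j _ => h i j).trans ?_
  rw [← Finset.mul_sum, Finset.sum_coe_sort S c]
  exact mul_le_mul_of_nonneg_left (hcs.sum_le_tsum _ fun _ _ => hc _) (hr i)

lemma tendsto_minor {ι : Type*} {l : Filter ι} {A : ι → ℕ → ℕ → ℂ} {B : ℕ → ℕ → ℂ}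
    (h : ∀ j k, Tendsto (fun b => A b j k) l (𝓝 (B j k))) (S : Finset ℕ) :
    Tendsto (fun b => minor (A b) S) l (𝓝 (minor B S)) := by
  unfold minor
  simp only [Matrix.det_apply, Matrix.of_apply]
  exact tendsto_finsetSum _ fun σ _ =>
    (tendsto_finsetProd _ fun i _ => h _ _).const_smul (Equiv.Perm.sign σ)

/-- Dominated convergence over the finite sets `S`: each eventually lies in `range (N b)`, and its
minor is at most `∏_{j ∈ S} r j ∑ c`, summable because `r` is. -/
lemma tendsto_det_one_add {ι : Type*} {l : Filter ι} {A : ι → ℕ → ℕ → ℂ}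
    {B : ℕ → ℕ → ℂ} {N : ι → ℕ} (hN : Tendsto N l atTop) {r c : ℕ → ℝ} (hr : ∀ j, 0 ≤ r j)
    (hrs : Summable r) (hc : ∀ k, 0 ≤ c k) (hcs : Summable c)
    (h : ∀ j k, Tendsto (fun b => A b j k) l (𝓝 (B j k)))
    (hb : ∀ᶠ b in l, ∀ j k, ‖A b j k‖ ≤ r j * c k) :
    Tendsto (fun b => (1 + Matrix.of fun i j : Fin (N b) => A b i j).det) l
      (𝓝 (∑' S, minor B S)) := by
  have hC : 0 ≤ ∑' k, c k := tsum_nonneg hc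
  have hsum : Summable fun S : Finset ℕ => ∏ j ∈ S, (r j * ∑' k, c k) :=
    summable_finsetProd_of_summable_nonneg (fun j => mul_nonneg (hr j) hC) (hrs.mul_right _)
  have heq : ∀ b, (1 + Matrix.of fun i j : Fin (N b) => A b i j).det =
      ∑' S, (if S ∈ (Finset.range (N b)).powerset then minor (A b) S else 0) := fun b => by
    rw [det_one_add_fin, tsum_eq_sum (s := (Finset.range (N b)).powerset) fun S hS => if_neg hS]
    exact Finset.sum_congr rfl fun S hS => (if_pos hS).symm
  simp only [heq]
  refine tendsto_tsum_of_dominated_convergence hsum (fun S => ?_) ?_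
  · refine (tendsto_minor h S).congr' ?_
    obtain ⟨n, hn⟩ : ∃ n, S ⊆ Finset.range n := S.exists_nat_subset_range
    filter_upwards [hN.eventually_ge_atTop n] with b hb
    rw [if_pos (Finset.mem_powerset.2 (hn.trans (Finset.range_subset_range.2 hb)))]
  · filter_upwards [hb] with b hb S
    split_ifs
    · exact norm_minor_le hr hc hcs hb S
    · rw [norm_zero]; exact Finset.prod_nonneg fun j _ => mul_nonneg (hr j) hC

/-- The empty minor is `1`; any other carries `u ^ |S| ≤ u`. -/
lemma norm_det_one_add_sub_one_le {A : ℕ → ℕ → ℂ} {r c : ℕ → ℝ} {u : ℝ} (hu : 0 ≤ u) (hu1 : u ≤ 1)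
    (hr : ∀ j, 0 ≤ r j) (hrs : Summable r) (hc : ∀ k, 0 ≤ c k) (hcs : Summable c)
    (h : ∀ j k, ‖A j k‖ ≤ u * r j * c k) (n : ℕ) :
    ‖(1 + Matrix.of fun i j : Fin n => A i j).det - 1‖ ≤
      u * ∑' S : Finset ℕ, ∏ j ∈ S, (r j * ∑' k, c k) := by
  have hC : 0 ≤ ∑' k, c k := tsum_nonneg hc
  have hsum : Summable fun S : Finset ℕ => ∏ j ∈ S, (r j * ∑' k, c k) :=
    summable_finsetProd_of_summable_nonneg (fun j => mul_nonneg (hr j) hC) (hrs.mul_right _)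
  have hnn : ∀ S : Finset ℕ, 0 ≤ ∏ j ∈ S, (r j * ∑' k, c k) := fun S =>
    Finset.prod_nonneg fun j _ => mul_nonneg (hr j) hC
  rw [det_one_add_fin, ← Finset.add_sum_erase _ _ (Finset.empty_mem_powerset _), minor_empty,
    add_sub_cancel_left]
  refine (norm_sum_le _ _).trans ?_
  refine le_trans (Finset.sum_le_sum (g := fun S => u * ∏ j ∈ S, (r j * ∑' k, c k))
    fun S hS => ?_) ?_
  · refine (norm_minor_le (fun j => mul_nonneg hu (hr j)) hc hcs h S).trans ?_
    simp only [mul_assoc u]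
    rw [Finset.prod_mul_distrib, Finset.prod_const]
    refine mul_le_mul_of_nonneg_right (pow_le_of_le_one hu hu1 ?_) (hnn S)
    exact (Finset.card_pos.2 (Finset.nonempty_iff_ne_empty.2 (Finset.ne_of_mem_erase hS))).ne'
  · rw [← Finset.mul_sum]
    exact mul_le_mul_of_nonneg_left (hsum.sum_le_tsum _ fun S _ => hnn S) hu

end

/-! ### Moments over the removed interval -/

section

/-- The moment `∫₀¹ y ^ p y ^ α (1 - ζ y) ^ β dy`, analytic in `ζ`. -/
noncomputable def edgeMoment (α β : ℝ) (p : ℕ) (ζ : ℂ) : ℂ :=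
  ∫ y in (0 : ℝ)..1, ((y ^ p * y ^ α : ℝ) : ℂ) * (1 - ζ * y) ^ (β : ℂ)

variable {α β : ℝ}

/-- Keeps the base of the complex power away from zero and from the branch cut. -/
lemma norm_one_sub_mul_bounds {ζ : ℂ} (hζ : ‖ζ‖ ≤ 1 / 2) {y : ℝ} (h0 : 0 ≤ y) (h1 : y ≤ 1) :
    1 / 2 ≤ (1 - ζ * y).re ∧ ‖1 - ζ * y‖ ≤ 2 := by
  have hy : ‖ζ * y‖ ≤ 1 / 2 := by
    rw [norm_mul, Complex.norm_real, Real.norm_of_nonneg h0]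
    nlinarith [norm_nonneg ζ]
  constructor
  · have := (Complex.re_le_norm (ζ * y)).trans hy
    rw [Complex.sub_re, Complex.one_re]; linarith
  · refine (norm_sub_le _ _).trans ?_
    rw [norm_one]; linarith

lemma norm_cpow_one_sub_mul_le (hβ : 0 < β) {ζ : ℂ} (hζ : ‖ζ‖ ≤ 1 / 2) {y : ℝ} (h0 : 0 ≤ y)
    (h1 : y ≤ 1) : ‖(1 - ζ * y) ^ (β : ℂ)‖ ≤ 2 ^ β := by
  rw [Complex.norm_cpow_real]
  exact Real.rpow_le_rpow (norm_nonneg _) (norm_one_sub_mul_bounds hζ h0 h1).2 hβ.le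

lemma pow_mul_rpow_le_one (hα : 0 < α) (p : ℕ) {y : ℝ} (h0 : 0 ≤ y) (h1 : y ≤ 1) :
    ‖((y ^ p * y ^ α : ℝ) : ℂ)‖ ≤ 1 := by
  rw [Complex.norm_real, Real.norm_of_nonneg (by positivity)]
  exact mul_le_one₀ (pow_le_one₀ h0 h1) (by positivity) (Real.rpow_le_one h0 h1 hα.le)

lemma norm_edgeMoment_le (hα : 0 < α) (hβ : 0 < β) (p : ℕ) {ζ : ℂ} (hζ : ‖ζ‖ ≤ 1 / 2) :
    ‖edgeMoment α β p ζ‖ ≤ 2 ^ β := by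
  have := intervalIntegral.norm_integral_le_of_norm_le_const (a := 0) (b := 1) (C := 2 ^ β)
    (f := fun y : ℝ => ((y ^ p * y ^ α : ℝ) : ℂ) * (1 - ζ * y) ^ (β : ℂ)) fun y hy => by
      rw [Set.uIoc_of_le zero_le_one] at hy
      rw [norm_mul]
      exact (mul_le_mul (pow_mul_rpow_le_one hα p hy.1.le hy.2)
        (norm_cpow_one_sub_mul_le hβ hζ hy.1.le hy.2) (norm_nonneg _) zero_le_one).trans_eq
          (one_mul _)
  simpa [edgeMoment] using this

lemma continuousOn_edgeIntegrand (hα : 0 < α) (p : ℕ) (s : ℂ) {ζ : ℂ} (hζ : ‖ζ‖ ≤ 1 / 2) :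
    ContinuousOn (fun y : ℝ => ((y ^ p * y ^ α : ℝ) : ℂ) * (1 - ζ * y) ^ s) (Set.Icc 0 1) := by
  refine ContinuousOn.mul (Complex.continuous_ofReal.comp ((continuous_pow p).mul
    (continuous_id.rpow_const fun _ => Or.inr hα.le))).continuousOn (ContinuousOn.cpow_const
      (by fun_prop) fun y hy => Or.inl ?_)
  linarith [(norm_one_sub_mul_bounds hζ hy.1 hy.2).1]

lemma differentiableAt_edgeMoment (hα : 0 < α) (hβ : 0 < β) (p : ℕ) {ζ : ℂ} (hζ : ‖ζ‖ < 1 / 2) :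
    DifferentiableAt ℂ (edgeMoment α β p) ζ := by
  have hmem : Metric.ball (0 : ℂ) (1 / 2) ∈ 𝓝 ζ :=
    Metric.isOpen_ball.mem_nhds (by simpa using hζ)
  have hball : ∀ x ∈ Metric.ball (0 : ℂ) (1 / 2), ‖x‖ ≤ 1 / 2 := fun x hx => by
    simpa using (Metric.mem_ball.1 hx).le
  have hmeas : ∀ (s : ℂ) {x : ℂ}, ‖x‖ ≤ 1 / 2 → IntervalIntegrable
      (fun y : ℝ => ((y ^ p * y ^ α : ℝ) : ℂ) * (1 - x * y) ^ s) MeasureTheory.volume 0 1 :=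
    fun s x hx => (by
      have := continuousOn_edgeIntegrand hα p s hx
      rw [← Set.uIcc_of_le zero_le_one] at this
      exact this.intervalIntegrable)
  have hF' : IntervalIntegrable (fun y : ℝ => ((y ^ p * y ^ α : ℝ) : ℂ) *
      ((β : ℂ) * (1 - ζ * y) ^ ((β : ℂ) - 1) * (-y))) MeasureTheory.volume 0 1 := by
    have := ((hmeas ((β : ℂ) - 1) hζ.le).mul_continuousOn (g := fun y : ℝ => (β : ℂ) * (-y))
      (by fun_prop))
    refine this.congr fun y _ => ?_
    ring
  refine (intervalIntegral.hasDerivAt_integral_of_dominated_loc_of_deriv_le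
    (F := fun (x : ℂ) (y : ℝ) => ((y ^ p * y ^ α : ℝ) : ℂ) * (1 - x * y) ^ (β : ℂ))
    (F' := fun (x : ℂ) (y : ℝ) => ((y ^ p * y ^ α : ℝ) : ℂ) *
      ((β : ℂ) * (1 - x * y) ^ ((β : ℂ) - 1) * (-y)))
    (bound := fun _ => β * 2 ^ β * 2) hmem ?_ (hmeas β hζ.le) hF'.def'.aestronglyMeasurable ?_
    intervalIntegrable_const ?_).2.differentiableAt
  · filter_upwards [hmem] with x hx
    exact (hmeas β (hball x hx)).def'.aestronglyMeasurable
  · refine Eventually.of_forall fun y hy x hx => ?_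
    rw [Set.uIoc_of_le zero_le_one] at hy
    obtain ⟨b1, -⟩ := norm_one_sub_mul_bounds (hball x hx) hy.1.le hy.2
    have hne : (1 - x * y) ≠ 0 := fun h => by rw [h, Complex.zero_re] at b1; linarith
    have hn : ‖(1 - x * y)⁻¹‖ ≤ 2 := by
      rw [norm_inv]
      exact inv_le_of_inv_le₀ (by norm_num) (by
        have := b1.trans (Complex.re_le_norm _)
        linarith)
    have hy' : ‖(-(y : ℂ))‖ ≤ 1 := by
      rw [norm_neg, Complex.norm_real, Real.norm_of_nonneg hy.1.le]; exact hy.2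
    have hb : ‖(β : ℂ)‖ = β := by rw [Complex.norm_real, Real.norm_of_nonneg hβ.le]
    rw [Complex.cpow_sub _ _ hne, Complex.cpow_one, div_eq_mul_inv, norm_mul, norm_mul, norm_mul,
      norm_mul, hb]
    have h1 := norm_cpow_one_sub_mul_le hβ (hball x hx) hy.1.le hy.2
    have h2 := pow_mul_rpow_le_one (y := y) hα p hy.1.le hy.2
    calc _ ≤ 1 * (β * (2 ^ β * 2) * 1) := by gcongr
      _ = _ := by ring
  · refine Eventually.of_forall fun y hy x hx => ?_
    rw [Set.uIoc_of_le zero_le_one] at hy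
    refine HasDerivAt.const_mul _ ?_
    refine ((((hasDerivAt_id x).mul_const (y : ℂ)).const_sub 1).cpow_const (c := (β : ℂ))
      (Or.inl ?_)).congr_deriv (by simp)
    have := (norm_one_sub_mul_bounds (hball x hx) hy.1.le hy.2).1
    simp only [id]
    linarith

/-- Substituting `x = t y` extracts all non-analytic dependence on `t` as the factor `t ^ (α + 1)`.
-/
lemma integral_eq_edgeMoment {t : ℝ} (ht : 0 < t) (ht1 : t < 1) (p : ℕ) :
    ((∫ x in (0 : ℝ)..t, x ^ p * jacobiWeight α β x : ℝ) : ℂ) =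
      ((t ^ (α + 1) * t ^ p : ℝ) : ℂ) * edgeMoment α β p t := by
  have h := intervalIntegral.mul_integral_comp_mul_left (a := 0) (b := 1)
    (f := fun x => x ^ p * jacobiWeight α β x) t
  rw [mul_zero, mul_one] at h
  rw [← h, edgeMoment]
  have h2 : ∀ y ∈ Set.uIcc (0 : ℝ) 1, ((y ^ p * y ^ α : ℝ) : ℂ) * (1 - (t : ℂ) * y) ^ (β : ℂ) =
      ((y ^ p * y ^ α * (1 - t * y) ^ β : ℝ) : ℂ) := fun y hy => by
    rw [Set.uIcc_of_le zero_le_one] at hy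
    have : 0 ≤ 1 - t * y := by nlinarith [hy.1, hy.2]
    push_cast
    rw [Complex.ofReal_cpow this]
    push_cast
    rfl
  rw [intervalIntegral.integral_congr h2, intervalIntegral.integral_ofReal, ← Complex.ofReal_mul]
  congr 1
  rw [← intervalIntegral.integral_const_mul, ← intervalIntegral.integral_const_mul]
  refine intervalIntegral.integral_congr fun y hy => ?_
  rw [Set.uIcc_of_le zero_le_one] at hy
  simp only [jacobiWeight]
  rw [Real.mul_rpow ht.le hy.1, Real.rpow_add_one ht.ne', mul_pow]
  ring

end

/-! ### The probability as a holomorphic determinant -/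

section

/-- The matrix, scaled to the hard edge, whose Fredholm determinant is the probability. -/
noncomputable def edgeMatrix (α β : ℝ) (n : ℕ) (z : ℂ) (j k : ℕ) : ℂ :=
  -(z ^ ((α + 1 : ℝ) : ℂ) * (∑ l ∈ Finset.range n, (scaledKerCoeff α β n j l : ℂ) * z ^ (j + l) *
    edgeMoment α β (l + k) (z / (4 * (n : ℂ) ^ 2))) * (2 ^ j * (1 / 2) ^ k))

/-- The analytic continuation of the scaled probability. -/
noncomputable def edgeDet (α β : ℝ) (n : ℕ) (z : ℂ) : ℂ :=
  (1 + Matrix.of fun i j : Fin n => edgeMatrix α β n z i j).det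

variable {α β : ℝ}

/-- Conjugation leaves the determinant unchanged. It is used with `d i = (2 t) ^ i`: the powers of
`t` even out the scaling, and those of `2` create geometric decay along the columns, paid for by a
factor `2 ^ j` that the factorial decay of the rows absorbs. -/
lemma det_one_sub_conj_diagonal {n : ℕ} (M : Matrix (Fin n) (Fin n) ℝ) (d : Fin n → ℝ)
    (hd : ∀ i, d i ≠ 0) :
    (1 + Matrix.of fun i j => -(M i j * (d i / d j))).det = (1 - M).det := by
  have h : (1 + Matrix.of fun i j => -(M i j * (d i / d j))) =
      Matrix.diagonal d * (1 - M) * Matrix.diagonal fun i => (d i)⁻¹ := by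
    ext i j
    rw [Matrix.mul_diagonal, Matrix.diagonal_mul, Matrix.add_apply, Matrix.sub_apply,
      Matrix.of_apply, Matrix.one_apply]
    split_ifs with hij
    · subst hij
      have := hd i
      field_simp
      ring
    · rw [zero_add, zero_sub]; ring
  rw [h, Matrix.det_mul, Matrix.det_mul, Matrix.det_diagonal, Matrix.det_diagonal,
    mul_right_comm, ← Finset.prod_mul_distrib]
  simp [hd]

/-- The ratio of Hankel determinants is `det (H_0⁻¹ H_t) = det (1 - H_0⁻¹ (H_0 - H_t))`, and `H_0 -
H_t` consists of the moments over `(0, t)`. -/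
lemma edgeDet_ofReal (hα : 0 < α) (hβ : 0 < β) {n : ℕ} (hn : 1 ≤ n) {s : ℝ} (hs : 0 < s)
    (hsn : s < 4 * (n : ℝ) ^ 2) :
    edgeDet α β n (s : ℂ) = (jacobiProb (s / (4 * (n : ℝ) ^ 2)) α β n : ℂ) := by
  have hn' : (0 : ℝ) < n := by exact_mod_cast hn
  have hT : 0 < 4 * (n : ℝ) ^ 2 := by positivity
  set T := 4 * (n : ℝ) ^ 2 with hTdef
  set t := s / T with ht
  have hst : s = T * t := by rw [ht]; field_simp
  have ht0 : 0 < t := div_pos hs hT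
  have ht1 : t < 1 := (div_lt_one hT).2 hsn
  have harg : (s : ℂ) / (4 * (n : ℂ) ^ 2) = (t : ℂ) := by rw [ht, hTdef]; push_cast; rfl
  set Cm : Matrix (Fin n) (Fin n) ℝ := Matrix.of fun i j => jacobiKerCoeff α β n i j with hC
  set M : Matrix (Fin n) (Fin n) ℝ := Matrix.of fun i j =>
    ∫ x in (0 : ℝ)..t, x ^ ((i : ℕ) + j) * jacobiWeight α β x with hM
  have hentry : ∀ j k : Fin n, edgeMatrix α β n s j k =
      ((-((Cm * M) j k * ((2 * t) ^ (j : ℕ) / (2 * t) ^ (k : ℕ))) : ℝ) : ℂ) := by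
    intro j k
    rw [edgeMatrix, harg, Complex.ofReal_neg, neg_inj, Matrix.mul_apply, Finset.mul_sum,
      Finset.sum_mul, Finset.sum_mul, Complex.ofReal_sum,
      ← Fin.sum_univ_eq_sum_range (fun l => (s : ℂ) ^ ((α + 1 : ℝ) : ℂ) *
        ((scaledKerCoeff α β n j l : ℂ) * (s : ℂ) ^ ((j : ℕ) + l) * edgeMoment α β (l + k) t) *
        (2 ^ (j : ℕ) * (1 / 2) ^ (k : ℕ)))]
    refine Finset.sum_congr rfl fun l _ => ?_
    simp only [hC, hM, Matrix.of_apply]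
    rw [Complex.ofReal_mul, Complex.ofReal_mul, integral_eq_edgeMoment ht0 ht1,
      ← Complex.ofReal_cpow hs.le]
    have e1 : s ^ (α + 1) * (scaledKerCoeff α β n j l * s ^ ((j : ℕ) + l)) *
        (2 ^ (j : ℕ) * (1 / 2) ^ (k : ℕ)) = jacobiKerCoeff α β n j l * (t ^ (α + 1) *
          t ^ ((l : ℕ) + k)) * ((2 * t) ^ (j : ℕ) / (2 * t) ^ (k : ℕ)) := by
      rw [scaledKerCoeff, ← hTdef, hst, Real.mul_rpow hT.le ht0.le, mul_pow]
      have := (Real.rpow_pos_of_pos hT (α + 1)).ne'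
      rw [pow_add, pow_add t, mul_pow, mul_pow, one_div, inv_pow]
      field_simp
      simp only [mul_pow, pow_add]
      ring
    have e2 := congrArg (fun x : ℝ => (x : ℂ) * edgeMoment α β (l + k) t) e1
    push_cast at e2 ⊢
    linear_combination e2
  have hmom : ∀ i, ∫ x in (0 : ℝ)..t, x ^ i * jacobiWeight α β x =
      jacobiL α β 0 (X ^ i) - jacobiL α β t (X ^ i) := fun i => by
    have hc : Continuous fun x => x ^ i * jacobiWeight α β x :=
      (continuous_pow i).mul (continuous_jacobiWeight hα hβ)
    simp only [jacobiL, eval_pow, eval_X]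
    rw [eq_sub_iff_add_eq]
    exact intervalIntegral.integral_add_adjacent_intervals (hc.intervalIntegrable _ _)
      (hc.intervalIntegrable _ _)
  have hHM : M = jacobiHankel α β 0 n - jacobiHankel α β t n := by
    ext i j
    simp only [hM, Matrix.of_apply, Matrix.sub_apply, jacobiHankel, hmom]
  have hCH := jacobiKerCoeff_mul_jacobiHankel hα hβ n
  rw [← hC] at hCH
  have h1CM : 1 - Cm * M = Cm * jacobiHankel α β t n := by
    rw [hHM, mul_sub, hCH, sub_sub_cancel]
  have hdetC := congrArg Matrix.det hCH
  rw [Matrix.det_mul, Matrix.det_one] at hdetC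
  have hH0 := (det_jacobiHankel_pos hα hβ le_rfl zero_lt_one n).ne'
  have hreal : (1 + Matrix.of fun j k : Fin n =>
      -((Cm * M) j k * ((2 * t) ^ (j : ℕ) / (2 * t) ^ (k : ℕ)))).det = jacobiProb t α β n := by
    rw [det_one_sub_conj_diagonal (Cm * M) (fun i => (2 * t) ^ (i : ℕ))
      fun i => by positivity, h1CM, Matrix.det_mul, jacobiProb_eq hα hβ ht1.le,
      eq_div_iff hH0, mul_right_comm, hdetC, one_mul]
  rw [← hreal, edgeDet]
  refine Eq.trans ?_ (Complex.ofRealHom.map_det _).symm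
  congr 1
  ext i j
  simp only [Matrix.add_apply, Matrix.of_apply, hentry, RingHom.mapMatrix_apply, Matrix.map_apply,
    Complex.ofRealHom_eq_coe, Complex.ofReal_add, Matrix.one_apply]
  split_ifs <;> simp

lemma norm_div_four_sq_le {n : ℕ} {z : ℂ} (hz : ‖z‖ ≤ 2 * (n : ℝ) ^ 2) :
    ‖z / (4 * (n : ℂ) ^ 2)‖ ≤ 1 / 2 := by
  rw [norm_div, norm_mul, norm_pow, Complex.norm_natCast, Complex.norm_ofNat]
  exact div_le_of_le_mul₀ (by positivity) (by norm_num) (by linarith)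

lemma differentiableAt_edgeDet (hα : 0 < α) (hβ : 0 < β) {n : ℕ} {z : ℂ} (hre : 0 < z.re)
    (hz : ‖z‖ < 2 * (n : ℝ) ^ 2) : DifferentiableAt ℂ (edgeDet α β n) z := by
  have hn : 0 < (n : ℝ) ^ 2 := by nlinarith [norm_nonneg z]
  have hz' : ‖z / (4 * (n : ℂ) ^ 2)‖ < 1 / 2 := by
    rw [norm_div, norm_mul, norm_pow, Complex.norm_natCast, Complex.norm_ofNat,
      div_lt_iff₀ (by positivity)]
    linarith
  have hentry : ∀ j k, DifferentiableAt ℂ (fun z => edgeMatrix α β n z j k) z := by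
    intro j k
    unfold edgeMatrix
    refine (((differentiableAt_id.cpow_const (Or.inl hre)).mul
      (DifferentiableAt.fun_sum fun l _ => ?_)).mul_const _).neg
    refine ((differentiableAt_id.pow _).const_mul _).mul ?_
    have hdiv : DifferentiableAt ℂ (fun z : ℂ => z / (4 * (n : ℂ) ^ 2)) z :=
      differentiableAt_id.div_const _
    exact (differentiableAt_edgeMoment hα hβ (l + k) hz').comp z hdiv
  unfold edgeDet
  simp only [Matrix.det_apply, Matrix.add_apply, Matrix.of_apply]
  refine DifferentiableAt.fun_sum fun σ _ => DifferentiableAt.const_smul ?_ _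
  exact DifferentiableAt.fun_finsetProd fun i _ => (differentiableAt_const _).add (hentry _ _)

/-- A bound independent of `n`, factorially small in rows and geometrically in columns. The factor
`‖z‖ ^ (α + 1)` is kept because it governs the behaviour at the origin. -/
lemma exists_norm_edgeMatrix_le (hα : 0 < α) (hβ : 0 < β) {R : ℝ} (hR : 0 ≤ R) :
    ∃ r : ℕ → ℝ, (∀ j, 0 ≤ r j) ∧ Summable r ∧ ∀ (n : ℕ) (z : ℂ), ‖z‖ ≤ R →
      ‖z‖ ≤ 2 * (n : ℝ) ^ 2 → ∀ j k,
        ‖edgeMatrix α β n z j k‖ ≤ ‖z‖ ^ (α + 1) * r j * (1 / 2) ^ k := by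
  obtain ⟨K, hK, hbound⟩ := exists_abs_scaledKerCoeff_le hα hβ
  set a := α + β + 3 with ha
  have ha0 : 0 < a := by positivity
  refine ⟨fun j => (2 * a * R) ^ j / j.factorial * (K * Real.exp (a * R) * 2 ^ β),
    fun j => by positivity, (Real.summable_pow_div_factorial _).mul_right _, ?_⟩
  intro n z hzR hzn j k
  have hterm : ∀ l, ‖(scaledKerCoeff α β n j l : ℂ) * z ^ (j + l) *
      edgeMoment α β (l + k) (z / (4 * (n : ℂ) ^ 2))‖ ≤
      (K * ((a * R) ^ j / j.factorial) * 2 ^ β) * ((a * R) ^ l / l.factorial) := fun l => by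
    rw [norm_mul, norm_mul, norm_pow, Complex.norm_real, Real.norm_eq_abs]
    calc _ ≤ (K * (a ^ j / j.factorial * (a ^ l / l.factorial))) * R ^ (j + l) * 2 ^ β := by
          gcongr
          · exact hbound n j l
          · exact norm_edgeMoment_le hα hβ _ (norm_div_four_sq_le hzn)
      _ = _ := by rw [pow_add, mul_pow, mul_pow]; ring
  have hsum : ‖∑ l ∈ Finset.range n, (scaledKerCoeff α β n j l : ℂ) * z ^ (j + l) *
      edgeMoment α β (l + k) (z / (4 * (n : ℂ) ^ 2))‖ ≤
      (K * ((a * R) ^ j / j.factorial) * 2 ^ β) * Real.exp (a * R) := by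
    refine (norm_sum_le _ _).trans ((Finset.sum_le_sum fun l _ => hterm l).trans ?_)
    rw [← Finset.mul_sum]
    refine mul_le_mul_of_nonneg_left (Real.sum_le_exp_of_nonneg (by positivity) n) (by positivity)
  rw [edgeMatrix, norm_neg, norm_mul, norm_mul, norm_mul, norm_pow, norm_pow,
    Complex.norm_cpow_real, Complex.norm_ofNat, norm_div, norm_one, Complex.norm_ofNat]
  calc _ ≤ ‖z‖ ^ (α + 1) * ((K * ((a * R) ^ j / j.factorial) * 2 ^ β) * Real.exp (a * R)) *
        (2 ^ j * (1 / 2) ^ k) := by gcongr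
    _ = _ := by
      have : (2 * a * R) ^ j = 2 ^ j * (a * R) ^ j := by rw [← mul_pow, mul_assoc]
      simp only [this]
      ring

lemma exists_norm_edgeDet_sub_one_le (hα : 0 < α) (hβ : 0 < β) : ∃ C : ℝ, 0 ≤ C ∧
    ∀ (n : ℕ) (z : ℂ), 1 ≤ n → ‖z‖ ≤ 1 → ‖edgeDet α β n z - 1‖ ≤ ‖z‖ ^ (α + 1) * C := by
  obtain ⟨r, hr, hrs, hb⟩ := exists_norm_edgeMatrix_le hα hβ zero_le_one
  have hc : ∀ k : ℕ, (0 : ℝ) ≤ (1 / 2) ^ k := fun k => by positivity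
  refine ⟨∑' S : Finset ℕ, ∏ j ∈ S, (r j * ∑' k : ℕ, (1 / 2 : ℝ) ^ k), tsum_nonneg (fun S => Finset.prod_nonneg fun j _ => mul_nonneg (hr j)
    (tsum_nonneg hc)), fun n z hn hz => ?_⟩
  refine norm_det_one_add_sub_one_le (by positivity)
    (Real.rpow_le_one (norm_nonneg _) hz (by positivity)) hr hrs hc summable_geometric_two
    (hb n z hz (hz.trans ?_)) n
  have : (1 : ℝ) ≤ n := by exact_mod_cast hn
  nlinarith

lemma tendsto_div_four_sq (z₀ : ℂ) : Tendsto (fun x : ℕ × ℂ => x.2 / (4 * (x.1 : ℂ) ^ 2))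
    (atTop ×ˢ 𝓝 z₀) (𝓝 0) := by
  have h1 : Tendsto (fun n : ℕ => ((n : ℂ))⁻¹) atTop (𝓝 0) := tendsto_inv_atTop_nhds_zero_nat
  have h2 := (((h1.pow 2).div_const 4).comp (tendsto_fst (g := 𝓝 z₀))).mul
    (tendsto_snd (f := (atTop : Filter ℕ)) (g := 𝓝 z₀))
  simp only [ne_eq, OfNat.ofNat_ne_zero, not_false_eq_true, zero_pow, zero_div, zero_mul] at h2
  refine h2.congr fun x => ?_
  simp only [Function.comp_apply]
  rw [inv_pow]
  simp only [div_eq_mul_inv, mul_inv]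
  ring

lemma eventually_norm_le (z₀ : ℂ) : ∀ᶠ x : ℕ × ℂ in atTop ×ˢ 𝓝 z₀,
    ‖x.2‖ ≤ ‖z₀‖ + 1 ∧ ‖x.2‖ ≤ 2 * (x.1 : ℝ) ^ 2 := by
  have h1 : ∀ᶠ z in 𝓝 z₀, ‖z‖ < ‖z₀‖ + 1 :=
    continuous_norm.continuousAt.eventually_lt continuousAt_const (lt_add_one _)
  have h2 : ∀ᶠ n : ℕ in atTop, ‖z₀‖ + 1 ≤ n := tendsto_natCast_atTop_atTop.eventually_ge_atTop _
  filter_upwards [(h2.and (eventually_ge_atTop 1)).prod_mk h1] with x hx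
  have : (1 : ℝ) ≤ x.1 := by exact_mod_cast hx.1.2
  exact ⟨hx.2.le, by nlinarith [hx.1.1, hx.2]⟩

/-- Convergence is taken jointly in `n` and `z`, which encodes local uniformity. The kernel
coefficients vanish for `l ≥ n`, so the sum is a series over a fixed index set and dominated
convergence applies; the moment's argument `z / (4 n²)` tends to `0`. -/
lemma exists_tendsto_edgeMatrix (hα : 0 < α) (hβ : 0 < β) (j k : ℕ) (z₀ : ℂ) (h0 : 0 < z₀.re) :
    ∃ B, Tendsto (fun x : ℕ × ℂ => edgeMatrix α β x.1 x.2 j k) (atTop ×ˢ 𝓝 z₀) (𝓝 B) := by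
  choose e he using tendsto_scaledKerCoeff hα hβ
  obtain ⟨K, hK, hbound⟩ := exists_abs_scaledKerCoeff_le hα hβ
  set a := α + β + 3 with ha
  have ha0 : 0 < a := by positivity
  set R := ‖z₀‖ + 1 with hR
  have hR0 : 0 ≤ R := by positivity
  have hsnd : Tendsto (fun x : ℕ × ℂ => x.2) (atTop ×ˢ 𝓝 z₀) (𝓝 z₀) := tendsto_snd
  have heq : ∀ x : ℕ × ℂ, ∑ l ∈ Finset.range x.1, (scaledKerCoeff α β x.1 j l : ℂ) *
      x.2 ^ (j + l) * edgeMoment α β (l + k) (x.2 / (4 * (x.1 : ℂ) ^ 2)) =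
      ∑' l, (scaledKerCoeff α β x.1 j l : ℂ) *
      x.2 ^ (j + l) * edgeMoment α β (l + k) (x.2 / (4 * (x.1 : ℂ) ^ 2)) := fun x => by
    rw [tsum_eq_sum (s := Finset.range x.1)]
    intro l hl
    rw [Finset.mem_range, not_lt] at hl
    rw [scaledKerCoeff_eq_zero (Or.inr hl)]
    simp
  have hT := tendsto_tsum_of_dominated_convergence (𝓕 := atTop ×ˢ 𝓝 z₀)
    (f := fun (x : ℕ × ℂ) (l : ℕ) => (scaledKerCoeff α β x.1 j l : ℂ) *
      x.2 ^ (j + l) * edgeMoment α β (l + k) (x.2 / (4 * (x.1 : ℂ) ^ 2)))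
    (g := fun l => (e j l : ℂ) * z₀ ^ (j + l) * edgeMoment α β (l + k) 0)
    (bound := fun l => (K * ((a * R) ^ j / j.factorial) * 2 ^ β) * ((a * R) ^ l / l.factorial))
    ((Real.summable_pow_div_factorial _).mul_left _) (fun l => ?_) ?_
  · simp only [edgeMatrix, heq]
    exact ⟨_, (((((continuousAt_cpow_const (Or.inl h0)).tendsto.comp hsnd).mul hT).mul_const
      _).neg)⟩
  · refine ((((Complex.continuous_ofReal.tendsto _).comp (he j l)).comp tendsto_fst).mul
      (hsnd.pow (j + l))).mul ?_
    exact (differentiableAt_edgeMoment hα hβ (l + k) (by simp)).continuousAt.tendsto.comp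
      (tendsto_div_four_sq z₀)
  · filter_upwards [eventually_norm_le z₀] with x hx l
    rw [norm_mul, norm_mul, norm_pow, Complex.norm_real, Real.norm_eq_abs]
    calc _ ≤ (K * (a ^ j / j.factorial * (a ^ l / l.factorial))) * R ^ (j + l) * 2 ^ β := by
          gcongr
          · exact hbound x.1 j l
          · exact hx.1
          · exact norm_edgeMoment_le hα hβ _ (norm_div_four_sq_le hx.2)
      _ = _ := by rw [pow_add, mul_pow, mul_pow]; ring

lemma exists_tendsto_edgeDet (hα : 0 < α) (hβ : 0 < β) (z₀ : ℂ) (h0 : 0 < z₀.re) :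
    ∃ B, Tendsto (fun x : ℕ × ℂ => edgeDet α β x.1 x.2) (atTop ×ˢ 𝓝 z₀) (𝓝 B) := by
  choose B hB using fun j k => exists_tendsto_edgeMatrix hα hβ j k z₀ h0
  obtain ⟨r, hr, hrs, hb⟩ := exists_norm_edgeMatrix_le hα hβ
    (show (0 : ℝ) ≤ ‖z₀‖ + 1 by positivity)
  refine ⟨_, tendsto_det_one_add (N := fun x : ℕ × ℂ => x.1)
    (A := fun x : ℕ × ℂ => edgeMatrix α β x.1 x.2)
    (r := fun j => (‖z₀‖ + 1) ^ (α + 1) * r j) (c := fun k => (1 / 2) ^ k) tendsto_fst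
    (fun j => mul_nonneg (by positivity) (hr j)) (hrs.mul_left _) (fun k => by positivity)
    summable_geometric_two hB ?_⟩
  filter_upwards [eventually_norm_le z₀] with x hx j k
  refine (hb x.1 x.2 hx.1 hx.2 j k).trans ?_
  have := hr j
  gcongr
  exact hx.1

/-- Joint convergence forces the limit to be continuous; near `z` both `f w` and `F n w` are then
close to `f z`, hence to each other. -/
lemma tendstoLocallyUniformlyOn_of_tendsto_prod {F : ℕ → ℂ → ℂ} {f : ℂ → ℂ} {U : Set ℂ}
    (hU : IsOpen U)
    (h : ∀ z ∈ U, Tendsto (fun x : ℕ × ℂ => F x.1 x.2) (atTop ×ˢ 𝓝 z) (𝓝 (f z))) :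
    TendstoLocallyUniformlyOn F f atTop U := by
  rw [hU.tendstoLocallyUniformlyOn_iff_forall_tendsto]
  intro z hz
  have hpt : ∀ w ∈ U, Tendsto (fun n => F n w) atTop (𝓝 (f w)) := fun w hw =>
    (h w hw).comp (tendsto_id.prodMk tendsto_const_nhds)
  have hf : Tendsto f (𝓝 z) (𝓝 (f z)) := by
    rw [Metric.tendsto_nhds]
    intro ε hε
    obtain ⟨P, hP, Q, hQ, hPQ⟩ := eventually_prod_iff.1
      ((Metric.tendsto_nhds.1 (h z hz)) (ε / 2) (half_pos hε))
    filter_upwards [hQ, hU.mem_nhds hz] with w hw hwU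
    have : dist (f w) (f z) ≤ ε / 2 := by
      refine le_of_tendsto ((hpt w hwU).dist tendsto_const_nhds) ?_
      filter_upwards [hP] with n hn using (hPQ hn hw).le
    linarith
  exact ((hf.comp tendsto_snd).prodMk_nhds (h z hz)).mono_right (nhds_le_uniformity (f z))

end

/-! ### Logarithmic derivatives and the finite `n` differential equation -/

section

/-- First logarithmic derivative of `P 0`, where `P k` is the `k`-th derivative of `P 0`. -/
noncomputable def logD0 (P : ℕ → ℝ → ℝ) (u : ℝ) : ℝ := P 1 u / P 0 u

/-- Derivative of `logD0 P`. -/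
noncomputable def logD1 (P : ℕ → ℝ → ℝ) (u : ℝ) : ℝ := P 2 u / P 0 u - logD0 P u ^ 2

/-- Derivative of `logD1 P`. -/
noncomputable def logD2 (P : ℕ → ℝ → ℝ) (u : ℝ) : ℝ :=
  P 3 u / P 0 u - P 2 u * P 1 u / P 0 u ^ 2 - 2 * logD0 P u * logD1 P u

/-- The function `s (1 - ν² s / 4) (log P 0)'`, with `ν = 1 / n`. -/
noncomputable def sig (ν : ℝ) (P : ℕ → ℝ → ℝ) (s : ℝ) : ℝ := (s - ν ^ 2 * s ^ 2 / 4) * logD0 P s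

/-- Derivative of `sig ν P`. -/
noncomputable def sig1 (ν : ℝ) (P : ℕ → ℝ → ℝ) (s : ℝ) : ℝ :=
  (1 - ν ^ 2 * s / 2) * logD0 P s + (s - ν ^ 2 * s ^ 2 / 4) * logD1 P s

/-- Derivative of `sig1 ν P`. -/
noncomputable def sig2 (ν : ℝ) (P : ℕ → ℝ → ℝ) (s : ℝ) : ℝ :=
  -(ν ^ 2 / 2) * logD0 P s + 2 * (1 - ν ^ 2 * s / 2) * logD1 P s +
    (s - ν ^ 2 * s ^ 2 / 4) * logD2 P s

variable {P : ℕ → ℝ → ℝ} {s : ℝ}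

lemma hasDerivAt_logD0 (hP : ∀ k, HasDerivAt (P k) (P (k + 1) s) s) (h0 : P 0 s ≠ 0) :
    HasDerivAt (logD0 P) (logD1 P s) s := by
  refine ((hP 1).div (hP 0) h0).congr_deriv ?_
  simp only [logD1, logD0, zero_add, one_add_one_eq_two]
  field_simp

lemma hasDerivAt_logD1 (hP : ∀ k, HasDerivAt (P k) (P (k + 1) s) s) (h0 : P 0 s ≠ 0) :
    HasDerivAt (logD1 P) (logD2 P s) s := by
  refine (((hP 2).div (hP 0) h0).sub ((hasDerivAt_logD0 hP h0).pow 2)).congr_deriv ?_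
  simp only [logD2, zero_add]
  norm_num
  field_simp

lemma hasDerivAt_sig (ν : ℝ) (hP : ∀ k, HasDerivAt (P k) (P (k + 1) s) s) (h0 : P 0 s ≠ 0) :
    HasDerivAt (sig ν P) (sig1 ν P s) s := by
  have h : HasDerivAt (fun s : ℝ => s - ν ^ 2 * s ^ 2 / 4) (1 - ν ^ 2 * s / 2) s :=
    ((hasDerivAt_id' s).sub ((((hasDerivAt_id' s).pow 2).const_mul (ν ^ 2)).div_const 4)
      ).congr_deriv (by norm_num; ring)
  exact (h.mul (hasDerivAt_logD0 hP h0)).congr_deriv rfl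

lemma hasDerivAt_sig1 (ν : ℝ) (hP : ∀ k, HasDerivAt (P k) (P (k + 1) s) s) (h0 : P 0 s ≠ 0) :
    HasDerivAt (sig1 ν P) (sig2 ν P s) s := by
  have h : HasDerivAt (fun s : ℝ => s - ν ^ 2 * s ^ 2 / 4) (1 - ν ^ 2 * s / 2) s :=
    ((hasDerivAt_id' s).sub ((((hasDerivAt_id' s).pow 2).const_mul (ν ^ 2)).div_const 4)
      ).congr_deriv (by norm_num; ring)
  have h' : HasDerivAt (fun s : ℝ => 1 - ν ^ 2 * s / 2) (-(ν ^ 2 / 2)) s :=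
    ((hasDerivAt_const s (1 : ℝ)).sub (((hasDerivAt_id' s).const_mul (ν ^ 2)).div_const 2)
      ).congr_deriv (by ring)
  refine ((h'.mul (hasDerivAt_logD0 hP h0)).add
    (h.mul (hasDerivAt_logD1 hP h0))).congr_deriv ?_
  simp only [sig2]
  ring

/-- The finite `n` differential equation reads `sigmaDefect α β (1 / n) s S S' S'' = 0`. -/
noncomputable def sigmaDefect (α β ν s S S' S'' : ℝ) : ℝ :=
  (2 + (α + β) * ν) ^ 2 * s ^ 4 * (1 - s * ν ^ 2 / 4) ^ 2 * S'' ^ 2 -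
    (((2 + (α + β) * ν) ^ 2 * s / 4) ^ 2 * S ^ 2 * ν ^ 2 +
      2 * ((2 + (α + β) * ν) ^ 2 * s / 4) * S *
        ((2 + (α + β) * ν) ^ 2 - β * (2 + (α + β) * ν) * ν - 2 * (1 + α * ν) +
          (2 * S - (2 + (α + β) * ν) ^ 2 * s / 4) * ν ^ 2) * (s * S') +
      (s * S') ^ 2 * ((2 + (α + β) * ν) ^ 2 * α ^ 2 +
        2 * ((2 + (α + β) * ν) ^ 2 - β * (2 + (α + β) * ν) * ν - 2 * (1 + α * ν)) *
          (2 * S - (2 + (α + β) * ν) ^ 2 * s / 4) +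
        (2 * S - (2 + (α + β) * ν) ^ 2 * s / 4) ^ 2 * ν ^ 2 -
        4 * (((2 + (α + β) * ν) - (1 + α * ν) + S * ν ^ 2) *
            ((2 + (α + β) * ν) * (1 + α * ν) - (1 + α * ν) + S * ν ^ 2) * s / 4 +
          (S ^ 2 * ν ^ 2 - S * (2 * (1 + α * ν) + β * (2 + (α + β) * ν) * ν)) *
            (1 - s * ν ^ 2 / 4) -
          (1 + α * ν) * ((1 + α * ν) + β * (2 + (α + β) * ν) * ν) * s / 4 +
          (2 + (α + β) * ν) ^ 2 * (1 - s * ν ^ 2 / 4) * (s * S'))))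

/-- Every occurrence of `β` is multiplied by `ν`, so it disappears; the prefactor is nonzero for `s
> 0`. -/
lemma sigmaDefect_zero (α β s S S' S'' : ℝ) : sigmaDefect α β 0 s S S' S'' =
    4 * s ^ 2 * ((s * S'') ^ 2 + S' * (4 * S' + 1) * (s * S' - S) - α ^ 2 * S' ^ 2) := by
  unfold sigmaDefect
  ring

lemma sigmaDefect_inv_eq_zero {α β n t m S S' S'' c c1 c2 r : ℝ} (hn : n ≠ 0) (ht : t ≠ 1)
    (hm : m ≠ 0) (hmn : m = 2 * n + α + β) (hc : c = (S - n * (n + α)) / m)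
    (hc1 : c1 = 4 * n ^ 2 * S' / m) (hc2 : c2 = (4 * n ^ 2) ^ 2 * S'' / m)
    (hr : r = t * (1 - t) * c1)
    (h : ((t * (1 - t)) ^ 2 * c2) ^ 2 =
      (t * (1 - t) * (m * c + n * (n + α)) + (2 * c - β + m * (1 - t)) * r) ^ 2 -
        4 * ((n + c) * (n + α + c) * t + c * (c - β) * (1 - t) + m * r) * r ^ 2) :
    sigmaDefect α β n⁻¹ (4 * n ^ 2 * t) S S' S'' = 0 := by
  -- Eliminating `β` makes `m` an independent variable, so that clearing denominators becomes a
  -- polynomial identity.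
  obtain rfl : β = m - 2 * n - α := by linarith
  have hT : 1 - t ≠ 0 := sub_ne_zero.2 ht.symm
  have key : n ^ 2 * (1 - t) ^ 2 * sigmaDefect α (m - 2 * n - α) n⁻¹ (4 * n ^ 2 * t) S S' S'' =
      m ^ 4 * (((t * (1 - t)) ^ 2 * c2) ^ 2 -
      ((t * (1 - t) * (m * c + n * (n + α)) +
        (2 * c - (m - 2 * n - α) + m * (1 - t)) * r) ^ 2 -
        4 * ((n + c) * (n + α + c) * t + c * (c - (m - 2 * n - α)) * (1 - t) + m * r) *
          r ^ 2)) := by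
    have hμ : 2 + (α + (m - 2 * n - α)) * n⁻¹ = m * n⁻¹ := by field_simp; ring
    rw [hr, hc, hc1, hc2]
    unfold sigmaDefect
    rw [hμ]
    field_simp
    ring
  rw [h, sub_self, mul_zero] at key
  exact (mul_eq_zero.1 key).resolve_left (by positivity)

end

/-! ### The scaled probability and its derivatives -/

section

/-- Real part of the `k`-th derivative of `F` on the real line. -/
noncomputable def reDeriv (F : ℂ → ℂ) (k : ℕ) (u : ℝ) : ℝ := (deriv^[k] F u).re

lemma differentiableOn_iterate_deriv {F : ℂ → ℂ} {U : Set ℂ} (hU : IsOpen U)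
    (hF : DifferentiableOn ℂ F U) (k : ℕ) : DifferentiableOn ℂ (deriv^[k] F) U := by
  induction k with
  | zero => exact hF
  | succ k ih => rw [Function.iterate_succ_apply']; exact ih.deriv hU

lemma hasDerivAt_reDeriv {F : ℂ → ℂ} {U : Set ℂ} (hU : IsOpen U) (hF : DifferentiableOn ℂ F U)
    {s : ℝ} (hs : (s : ℂ) ∈ U) (k : ℕ) : HasDerivAt (reDeriv F k) (reDeriv F (k + 1) s) s := by
  have h := ((differentiableOn_iterate_deriv hU hF k).differentiableAt
    (hU.mem_nhds hs)).hasDerivAt.real_of_complex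
  refine h.congr_deriv ?_
  rw [reDeriv, Function.iterate_succ_apply']

lemma tendstoLocallyUniformlyOn_iterate_deriv {F : ℕ → ℂ → ℂ} {f : ℂ → ℂ} {U : Set ℂ}
    (hU : IsOpen U) (hf : TendstoLocallyUniformlyOn F f atTop U)
    (hF : ∀ᶠ n in atTop, DifferentiableOn ℂ (F n) U) (k : ℕ) :
    TendstoLocallyUniformlyOn (fun n => deriv^[k] (F n)) (deriv^[k] f) atTop U := by
  induction k with
  | zero => exact hf
  | succ k ih =>
    simp only [Function.iterate_succ_apply']
    exact ih.deriv (hF.mono fun n hn => differentiableOn_iterate_deriv hU hn k) hU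

variable {α β : ℝ}

lemma isOpen_half_disc (R : ℝ) : IsOpen {z : ℂ | 0 < z.re ∧ ‖z‖ < R} :=
  (isOpen_lt continuous_const Complex.continuous_re).inter
    (isOpen_lt continuous_norm continuous_const)

lemma mem_half_disc {s R : ℝ} (hs : 0 < s) (hR : s < R) :
    (s : ℂ) ∈ {z : ℂ | 0 < z.re ∧ ‖z‖ < R} :=
  ⟨hs, by rwa [Complex.norm_real, Real.norm_of_nonneg hs.le]⟩

lemma differentiableOn_edgeDet (hα : 0 < α) (hβ : 0 < β) {n : ℕ} {R : ℝ}
    (hR : R ≤ 2 * (n : ℝ) ^ 2) :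
    DifferentiableOn ℂ (edgeDet α β n) {z : ℂ | 0 < z.re ∧ ‖z‖ < R} := fun _ hz =>
  (differentiableAt_edgeDet hα hβ hz.1 (hz.2.trans_le hR)).differentiableWithinAt

lemma eventually_le_two_sq (R : ℝ) : ∀ᶠ n : ℕ in atTop, R ≤ 2 * (n : ℝ) ^ 2 := by
  filter_upwards [tendsto_natCast_atTop_atTop.eventually_ge_atTop R, eventually_ge_atTop 1]
    with n hn h1
  have : (1 : ℝ) ≤ n := by exact_mod_cast h1
  nlinarith

lemma reDeriv_edgeDet_zero (hα : 0 < α) (hβ : 0 < β) {n : ℕ} {s : ℝ} (hn : 1 ≤ n) (hs : 0 < s)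
    (hsn : s < 2 * (n : ℝ) ^ 2) :
    reDeriv (edgeDet α β n) 0 s = jacobiProb (s / (4 * (n : ℝ) ^ 2)) α β n := by
  rw [reDeriv, Function.iterate_zero, id, edgeDet_ofReal hα hβ hn hs (by nlinarith),
    Complex.ofReal_re]

lemma reDeriv_edgeDet_zero_ne (hα : 0 < α) (hβ : 0 < β) {n : ℕ} {s : ℝ} (hn : 1 ≤ n)
    (hs : 0 < s) (hsn : s < 2 * (n : ℝ) ^ 2) : reDeriv (edgeDet α β n) 0 s ≠ 0 := by
  rw [reDeriv_edgeDet_zero hα hβ hn hs hsn]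
  exact ((Real.exp_pos _).trans_le (exp_le_jacobiProb hα hβ hs.le hn hsn.le)).ne'

lemma hasDerivAt_reDeriv_edgeDet (hα : 0 < α) (hβ : 0 < β) {n : ℕ} {s : ℝ} (hs : 0 < s)
    (hsn : s < 2 * (n : ℝ) ^ 2) (k : ℕ) :
    HasDerivAt (reDeriv (edgeDet α β n) k) (reDeriv (edgeDet α β n) (k + 1) s) s :=
  hasDerivAt_reDeriv (isOpen_half_disc _) (differentiableOn_edgeDet hα hβ le_rfl)
    (mem_half_disc hs hsn) k

/-- With `s = 4 n² t`, the operator `s (1 - s / (4 n²)) d/ds` is `t (1 - t) d/dt`. Normalising by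
the constant determinant at `0` does not affect the logarithmic derivative. -/
lemma sig_edgeDet (hα : 0 < α) (hβ : 0 < β) {n : ℕ} {s : ℝ} (hn : 1 ≤ n) (hs : 0 < s)
    (hsn : s < 2 * (n : ℝ) ^ 2) : sig (n : ℝ)⁻¹ (reDeriv (edgeDet α β n)) s =
      n * (n + α) + (2 * n + α + β) * jopSub α β (s / (4 * (n : ℝ) ^ 2)) n := by
  have hn' : (0 : ℝ) < n := by exact_mod_cast hn
  set t := s / (4 * (n : ℝ) ^ 2) with ht
  have hst : s = 4 * (n : ℝ) ^ 2 * t := by rw [ht]; field_simp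
  have ht0 : 0 < t := by positivity
  have ht1 : t < 1 := by rw [ht, div_lt_one (by positivity)]; nlinarith
  have h1 : HasDerivAt (fun u => Real.log (reDeriv (edgeDet α β n) 0 u))
      (logD0 (reDeriv (edgeDet α β n)) s) s :=
    (hasDerivAt_reDeriv_edgeDet hα hβ hs hsn 0).log (reDeriv_edgeDet_zero_ne hα hβ hn hs hsn)
  have hdiv : HasDerivAt (fun u : ℝ => u / (4 * (n : ℝ) ^ 2)) (1 / (4 * (n : ℝ) ^ 2)) s :=
    (hasDerivAt_id' s).div_const _
  have h2 := ((hasDerivAt_log_det_jacobiHankel hα hβ ht0 ht1 n).comp s hdiv).sub_const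
    (Real.log (jacobiHankel α β 0 n).det)
  have h3 := h1.unique (h2.congr_of_eventuallyEq (by
    filter_upwards [Ioo_mem_nhds hs hsn] with u hu
    have hu1 : u / (4 * (n : ℝ) ^ 2) < 1 := by
      rw [div_lt_one (by positivity)]; nlinarith [hu.2]
    have hu0 : 0 < u / (4 * (n : ℝ) ^ 2) := div_pos hu.1 (by positivity)
    rw [reDeriv_edgeDet_zero hα hβ hn hu.1 hu.2, jacobiProb_eq hα hβ hu1.le,
      Real.log_div (det_jacobiHankel_pos hα hβ hu0.le hu1 n).ne'
        (det_jacobiHankel_pos hα hβ le_rfl zero_lt_one n).ne']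
    rfl))
  have ht1' : 1 - t ≠ 0 := (sub_pos.2 ht1).ne'
  rw [sig, h3, hst]
  field_simp

/-- The relation of `sig_edgeDet` holds on an open interval, so uniqueness of derivatives expresses
`c`, `c'`, `c''` through `sig`, `sig1`, `sig2`; the equation for `c` is then rewritten. -/
lemma sigmaDefect_edgeDet (hα : 0 < α) (hβ : 0 < β) {n : ℕ} {s : ℝ} (hn : 1 ≤ n) (hs : 0 < s)
    (hsn : s < 2 * (n : ℝ) ^ 2) :
    sigmaDefect α β (n : ℝ)⁻¹ s (sig (n : ℝ)⁻¹ (reDeriv (edgeDet α β n)) s)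
      (sig1 (n : ℝ)⁻¹ (reDeriv (edgeDet α β n)) s)
      (sig2 (n : ℝ)⁻¹ (reDeriv (edgeDet α β n)) s) = 0 := by
  obtain ⟨k, rfl⟩ : ∃ k, n = k + 1 := ⟨n - 1, by omega⟩
  set P := reDeriv (edgeDet α β (k + 1)) with hPdef
  set x : ℝ := ((k + 1 : ℕ) : ℝ) with hx
  have hxk : x = k + 1 := by rw [hx]; push_cast; rfl
  have hx0 : 0 < x := by rw [hxk]; positivity
  have hm : 0 < 2 * x + α + β := by positivity
  have ht0 : ∀ u ∈ Set.Ioo 0 (2 * x ^ 2), 0 < u / (4 * x ^ 2) := fun u hu =>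
    div_pos hu.1 (by positivity)
  have ht1 : ∀ u ∈ Set.Ioo 0 (2 * x ^ 2), u / (4 * x ^ 2) < 1 := fun u hu => by
    rw [div_lt_one (by positivity)]; nlinarith [hu.2]
  have hdiv : ∀ u : ℝ, HasDerivAt (fun u : ℝ => u / (4 * x ^ 2)) (1 / (4 * x ^ 2)) u := fun u =>
    (hasDerivAt_id' u).div_const _
  have hP : ∀ u ∈ Set.Ioo 0 (2 * x ^ 2), ∀ k, HasDerivAt (P k) (P (k + 1) u) u := fun u hu =>
    hasDerivAt_reDeriv_edgeDet hα hβ hu.1 hu.2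
  have hP0 : ∀ u ∈ Set.Ioo 0 (2 * x ^ 2), P 0 u ≠ 0 := fun u hu =>
    reDeriv_edgeDet_zero_ne hα hβ hn hu.1 hu.2
  have hc : ∀ u ∈ Set.Ioo 0 (2 * x ^ 2), jopSub α β (u / (4 * x ^ 2)) (k + 1) =
      (sig x⁻¹ P u - x * (x + α)) / (2 * x + α + β) := fun u hu => by
    rw [eq_div_iff hm.ne', sig_edgeDet hα hβ hn hu.1 hu.2]
    ring
  have hc1 : ∀ u ∈ Set.Ioo 0 (2 * x ^ 2), jopSubDeriv α β (u / (4 * x ^ 2)) k =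
      4 * x ^ 2 * sig1 x⁻¹ P u / (2 * x + α + β) := fun u hu => by
    have h1 := (hasDerivAt_jopSub hα hβ (ht0 u hu) (ht1 u hu) k).comp u (hdiv u)
    have h2 := ((hasDerivAt_sig x⁻¹ (hP u hu) (hP0 u hu)).sub_const (x * (x + α))).div_const
      (2 * x + α + β)
    have h3 := h1.unique (h2.congr_of_eventuallyEq (by
      filter_upwards [Ioo_mem_nhds hu.1 hu.2] with v hv using hc v hv))
    rw [mul_div_assoc, ← h3, jopSubDeriv]
    field_simp
  have hsI : s ∈ Set.Ioo 0 (2 * x ^ 2) := ⟨hs, hsn⟩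
  obtain ⟨c2, hc2, h⟩ := jopSub_painleve hα hβ (ht0 s hsI) (ht1 s hsI) k
  have hc2' : c2 = (4 * x ^ 2) ^ 2 * sig2 x⁻¹ P s / (2 * x + α + β) := by
    have h1 := hc2.comp s (hdiv s)
    have h2 := ((hasDerivAt_sig1 x⁻¹ (hP s hsI) (hP0 s hsI)).const_mul (4 * x ^ 2)).div_const
      (2 * x + α + β)
    have h3 := h1.unique (h2.congr_of_eventuallyEq (by
      filter_upwards [Ioo_mem_nhds hsI.1 hsI.2] with v hv using hc1 v hv))
    have : c2 = 4 * x ^ 2 * (c2 * (1 / (4 * x ^ 2))) := by field_simp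
    rw [this, h3]
    ring
  have hfin := sigmaDefect_inv_eq_zero hx0.ne' (ht1 s hsI).ne hm.ne' rfl (hc s hsI) (hc1 s hsI)
    hc2' rfl (h x _ _ _ hxk rfl rfl rfl)
  rwa [mul_div_cancel₀ _ (by positivity)] at hfin

end

/-! ### The limiting probability -/

section

variable {α β : ℝ}

/-- Each determinant is known to be holomorphic only in a half disc of radius `2 n²`; any fixed half
disc is eventually covered, and there Weierstrass' theorem gives convergence of all derivatives. -/
lemma exists_edgeDet_limit (hα : 0 < α) (hβ : 0 < β) : ∃ F : ℂ → ℂ,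
    DifferentiableOn ℂ F {z | 0 < z.re} ∧ ∀ (k : ℕ) (z : ℂ), 0 < z.re →
      Tendsto (fun n => deriv^[k] (edgeDet α β n) z) atTop (𝓝 (deriv^[k] F z)) := by
  choose! F hF using exists_tendsto_edgeDet hα hβ
  have hopen : IsOpen {z : ℂ | 0 < z.re} := isOpen_lt continuous_const Complex.continuous_re
  have hloc : TendstoLocallyUniformlyOn (fun n => edgeDet α β n) F atTop {z | 0 < z.re} :=
    tendstoLocallyUniformlyOn_of_tendsto_prod hopen hF
  have hdisc : ∀ R : ℝ, TendstoLocallyUniformlyOn (fun n => edgeDet α β n) F atTop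
      {z | 0 < z.re ∧ ‖z‖ < R} := fun R => hloc.mono fun z hz => hz.1
  have hdiff : ∀ R : ℝ, ∀ᶠ n in atTop,
      DifferentiableOn ℂ (edgeDet α β n) {z | 0 < z.re ∧ ‖z‖ < R} := fun R =>
    (eventually_le_two_sq R).mono fun n hn => differentiableOn_edgeDet hα hβ hn
  refine ⟨F, fun z hz => ?_, fun k z hz => ?_⟩
  · have h := (hdisc (‖z‖ + 1)).differentiableOn (hdiff _) (isOpen_half_disc _)
    exact (h.differentiableAt ((isOpen_half_disc _).mem_nhds
      ⟨hz, lt_add_one _⟩)).differentiableWithinAt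
  · exact (tendstoLocallyUniformlyOn_iterate_deriv (isOpen_half_disc (‖z‖ + 1)) (hdisc _)
      (hdiff _) k).tendsto_at ⟨hz, lt_add_one _⟩

lemma tendsto_jacobiProb (hα : 0 < α) (hβ : 0 < β) {F : ℂ → ℂ}
    (hF : ∀ (k : ℕ) (z : ℂ), 0 < z.re →
      Tendsto (fun n => deriv^[k] (edgeDet α β n) z) atTop (𝓝 (deriv^[k] F z)))
    {s : ℝ} (hs : 0 < s) : Tendsto (fun n : ℕ => jacobiProb (s / (4 * (n : ℝ) ^ 2)) α β n) atTop
      (𝓝 (reDeriv F 0 s)) := by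
  refine ((Complex.continuous_re.tendsto _).comp (hF 0 s hs)).congr' ?_
  filter_upwards [eventually_le_two_sq (s + 1), eventually_ge_atTop 1] with n hn h1
  exact reDeriv_edgeDet_zero hα hβ h1 hs (by linarith)

lemma exp_le_of_tendsto_jacobiProb (hα : 0 < α) (hβ : 0 < β) {s p : ℝ} (hs : 0 ≤ s)
    (h : Tendsto (fun n : ℕ => jacobiProb (s / (4 * (n : ℝ) ^ 2)) α β n) atTop (𝓝 p)) :
    Real.exp (-(s / 2 * (1 + α + β))) ≤ p := by
  refine ge_of_tendsto h ?_
  filter_upwards [eventually_le_two_sq s, eventually_ge_atTop 1] with n hn h1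
  exact exp_le_jacobiProb hα hβ hs h1 hn

lemma jacobiProb_zero (hα : 0 < α) (hβ : 0 < β) (n : ℕ) : jacobiProb 0 α β n = 1 := by
  rw [jacobiProb_eq hα hβ zero_le_one]
  exact div_self (det_jacobiHankel_pos hα hβ le_rfl zero_lt_one n).ne'

lemma continuous_sigmaDefect (α β s : ℝ) : Continuous fun x : ℝ × ℝ × ℝ × ℝ =>
    sigmaDefect α β x.1 s x.2.1 x.2.2.1 x.2.2.2 := by
  unfold sigmaDefect
  fun_prop

/-- The defect is continuous in `ν` and the three derivatives, all of which converge because the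
limiting probability, as a denominator, is nonzero. -/
lemma sigmaDefect_limit (hα : 0 < α) (hβ : 0 < β) {F : ℂ → ℂ}
    (hF : ∀ (k : ℕ) (z : ℂ), 0 < z.re →
      Tendsto (fun n => deriv^[k] (edgeDet α β n) z) atTop (𝓝 (deriv^[k] F z)))
    {s : ℝ} (hs : 0 < s) (h0 : reDeriv F 0 s ≠ 0) :
    sigmaDefect α β 0 s (sig 0 (reDeriv F) s) (sig1 0 (reDeriv F) s)
      (sig2 0 (reDeriv F) s) = 0 := by
  have hν : Tendsto (fun n : ℕ => ((n : ℝ))⁻¹) atTop (𝓝 0) := tendsto_inv_atTop_nhds_zero_nat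
  have hP : ∀ k, Tendsto (fun n => reDeriv (edgeDet α β n) k s) atTop (𝓝 (reDeriv F k s)) :=
    fun k => (Complex.continuous_re.tendsto _).comp (hF k s hs)
  have hL0 : Tendsto (fun n => logD0 (reDeriv (edgeDet α β n)) s) atTop
      (𝓝 (logD0 (reDeriv F) s)) := (hP 1).div (hP 0) h0
  have hL1 : Tendsto (fun n => logD1 (reDeriv (edgeDet α β n)) s) atTop
      (𝓝 (logD1 (reDeriv F) s)) := ((hP 2).div (hP 0) h0).sub (hL0.pow 2)
  have hL2 : Tendsto (fun n => logD2 (reDeriv (edgeDet α β n)) s) atTop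
      (𝓝 (logD2 (reDeriv F) s)) :=
    (((hP 3).div (hP 0) h0).sub (((hP 2).mul (hP 1)).div ((hP 0).pow 2) (pow_ne_zero 2 h0))).sub
      ((hL0.const_mul 2).mul hL1)
  have ha : Tendsto (fun n : ℕ => s - ((n : ℝ)⁻¹) ^ 2 * s ^ 2 / 4) atTop
      (𝓝 (s - 0 ^ 2 * s ^ 2 / 4)) :=
    (((hν.pow 2).mul_const (s ^ 2)).div_const 4).const_sub s
  have hb : Tendsto (fun n : ℕ => 1 - ((n : ℝ)⁻¹) ^ 2 * s / 2) atTop (𝓝 (1 - 0 ^ 2 * s / 2)) :=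
    (((hν.pow 2).mul_const s).div_const 2).const_sub 1
  have hS0 : Tendsto (fun n : ℕ => sig (n : ℝ)⁻¹ (reDeriv (edgeDet α β n)) s) atTop
      (𝓝 (sig 0 (reDeriv F) s)) := ha.mul hL0
  have hS1 : Tendsto (fun n : ℕ => sig1 (n : ℝ)⁻¹ (reDeriv (edgeDet α β n)) s) atTop
      (𝓝 (sig1 0 (reDeriv F) s)) := (hb.mul hL0).add (ha.mul hL1)
  have hS2 : Tendsto (fun n : ℕ => sig2 (n : ℝ)⁻¹ (reDeriv (edgeDet α β n)) s) atTop
      (𝓝 (sig2 0 (reDeriv F) s)) :=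
    ((((hν.pow 2).div_const 2).neg.mul hL0).add ((hb.const_mul 2).mul hL1)).add (ha.mul hL2)
  have hlim := ((continuous_sigmaDefect α β s).tendsto
    (0, sig 0 (reDeriv F) s, sig1 0 (reDeriv F) s, sig2 0 (reDeriv F) s)).comp
    (hν.prodMk_nhds (hS0.prodMk_nhds (hS1.prodMk_nhds hS2)))
  refine tendsto_nhds_unique hlim (tendsto_const_nhds.congr' ?_)
  filter_upwards [eventually_le_two_sq (s + 1), eventually_ge_atTop 1] with n hn h1
  exact (sigmaDefect_edgeDet hα hβ h1 hs (by linarith)).symm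

/-! ### Behaviour of the limit at the origin. -/

lemma norm_limit_sub_one_le (hα : 0 < α) (hβ : 0 < β) {F : ℂ → ℂ}
    (hF : ∀ (k : ℕ) (z : ℂ), 0 < z.re →
      Tendsto (fun n => deriv^[k] (edgeDet α β n) z) atTop (𝓝 (deriv^[k] F z))) :
    ∃ C : ℝ, 0 ≤ C ∧ ∀ z : ℂ, 0 < z.re → ‖z‖ ≤ 1 → ‖F z - 1‖ ≤ ‖z‖ ^ (α + 1) * C := by
  obtain ⟨C, hC, h⟩ := exists_norm_edgeDet_sub_one_le hα hβ
  refine ⟨C, hC, fun z hz hz1 => le_of_tendsto (((hF 0 z hz).sub_const 1).norm) ?_⟩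
  filter_upwards [eventually_ge_atTop 1] with n hn using h n z hn hz1

/-- Cauchy estimates at the origin of a half plane. -/
lemma tendsto_reDeriv_zero_right {F : ℂ → ℂ} (hd : DifferentiableOn ℂ F {z | 0 < z.re})
    (hα : 0 < α) {C : ℝ} (hC : 0 ≤ C)
    (h : ∀ z : ℂ, 0 < z.re → ‖z‖ ≤ 1 → ‖F z - 1‖ ≤ ‖z‖ ^ (α + 1) * C) (k : ℕ) :
    Tendsto (fun s : ℝ => s ^ k * reDeriv F (k + 1) s) (𝓝[>] 0) (𝓝 0) := by
  have hbound : ∀ s : ℝ, 0 < s → s ≤ 1 / 2 → ‖s ^ k * reDeriv F (k + 1) s‖ ≤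
      (3 / 2 * s) ^ α * ((k + 1).factorial * C * (3 / 2) * 2 ^ (k + 1)) := by
    intro s hs hs1
    -- The disc of radius `s / 2` about `s` stays in the half plane and in `‖z‖ ≤ 1`. Cauchy's
    -- estimate costs `s ^ (-(k + 1))` against `s ^ (α + 1)`, so after multiplication by `s ^ k` a
    -- factor `s ^ α` is left, tending to `0`.
    have hsub : ∀ z ∈ Metric.closedBall (s : ℂ) (s / 2), 0 < z.re ∧ ‖z‖ ≤ 3 / 2 * s := by
      intro z hz
      rw [mem_closedBall_iff_norm] at hz
      constructor
      · have := (Complex.abs_re_le_norm (z - s)).trans hz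
        rw [Complex.sub_re, Complex.ofReal_re] at this
        linarith [(abs_le.1 this).1]
      · have := norm_add_le (z - s) (s : ℂ)
        rw [sub_add_cancel, Complex.norm_real, Real.norm_of_nonneg hs.le] at this
        linarith
    have hdc : DiffContOnCl ℂ (fun z => F z - 1) (Metric.ball (s : ℂ) (s / 2)) := by
      refine DifferentiableOn.diffContOnCl_ball (U := {z | 0 < z.re}) (hd.sub_const 1) ?_
      exact fun z hz => (hsub z hz).1
    have hest := Complex.norm_iteratedDeriv_le_of_forall_mem_sphere_norm_le
      (C := (3 / 2 * s) ^ (α + 1) * C) (k + 1) (half_pos hs) hdc (fun z hz => by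
        obtain ⟨h1, h2⟩ := hsub z (Metric.sphere_subset_closedBall hz)
        refine (h z h1 (h2.trans (by linarith))).trans ?_
        gcongr)
    have hder : iteratedDeriv (k + 1) (fun z => F z - 1) = deriv^[k + 1] F := by
      rw [iteratedDeriv_eq_iterate, Function.iterate_succ_apply, Function.iterate_succ_apply]
      congr 1
      funext z
      exact deriv_sub_const 1
    rw [hder] at hest
    rw [norm_mul, norm_pow, Real.norm_of_nonneg hs.le]
    refine (mul_le_mul_of_nonneg_left ((Complex.abs_re_le_norm _).trans hest)
      (by positivity)).trans (le_of_eq ?_)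
    rw [Real.rpow_add_one (by positivity), div_pow]
    field_simp
    ring
  have hlim : Tendsto (fun s : ℝ => (3 / 2 * s) ^ α *
      ((k + 1).factorial * C * (3 / 2) * 2 ^ (k + 1))) (𝓝[>] 0) (𝓝 0) := by
    have hc : Continuous fun s : ℝ => (3 / 2 * s) ^ α *
        ((k + 1).factorial * C * (3 / 2) * 2 ^ (k + 1)) :=
      (Continuous.rpow_const (by fun_prop) fun _ => Or.inr hα.le).mul_const _
    have := (hc.tendsto 0).mono_left (nhdsWithin_le_nhds (s := Set.Ioi 0))
    simpa [Real.zero_rpow hα.ne'] using this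
  refine squeeze_zero_norm' ?_ hlim
  filter_upwards [Ioc_mem_nhdsGT (show (0 : ℝ) < 1 / 2 by norm_num)] with s hs
  exact hbound s hs.1 hs.2

lemma tendsto_reDeriv_zero_one {F : ℂ → ℂ} (hα : 0 < α) {C : ℝ}
    (h : ∀ z : ℂ, 0 < z.re → ‖z‖ ≤ 1 → ‖F z - 1‖ ≤ ‖z‖ ^ (α + 1) * C) :
    Tendsto (reDeriv F 0) (𝓝[>] 0) (𝓝 1) := by
  rw [tendsto_iff_norm_sub_tendsto_zero]
  have hc : Continuous fun s : ℝ => s ^ (α + 1) * C :=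
    (Continuous.rpow_const continuous_id fun _ => Or.inr (by positivity)).mul_const _
  have hlim := (hc.tendsto 0).mono_left (nhdsWithin_le_nhds (s := Set.Ioi 0))
  rw [Real.zero_rpow (by positivity), zero_mul] at hlim
  refine squeeze_zero' (Eventually.of_forall fun _ => norm_nonneg _) ?_ hlim
  filter_upwards [Ioc_mem_nhdsGT zero_lt_one] with s hs
  have hn : ‖(s : ℂ)‖ = s := by rw [Complex.norm_real, Real.norm_of_nonneg hs.1.le]
  have := h s hs.1 (hn.trans_le hs.2)
  rw [hn] at this
  refine le_trans ?_ this
  have := Complex.abs_re_le_norm (F s - 1)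
  rwa [Complex.sub_re, Complex.one_re] at this

end

/-! ### Conclusion. -/

theorem mainTheorem7 (α β : ℝ) (hα : 0 < α) (hβ : 0 < β) :
    -- the limit defining the scaled probability exists and is positive
    (∀ s : ℝ, 0 ≤ s →
      Tendsto (fun n : ℕ => jacobiProb (s / (4 * (n : ℝ) ^ 2)) α β n) atTop
        (𝓝 (scaledProb s α β)) ∧ 0 < scaledProb s α β) ∧
    -- all derivatives involved exist, and the differential equation holds
    (∀ s : ℝ, 0 < s →
      DifferentiableAt ℝ (fun u : ℝ => Real.log (scaledProb u α β)) s ∧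
      DifferentiableAt ℝ (sigmaFn α β) s ∧
      DifferentiableAt ℝ (deriv (sigmaFn α β)) s ∧
      (s * deriv (deriv (sigmaFn α β)) s) ^ 2
        + deriv (sigmaFn α β) s * (4 * deriv (sigmaFn α β) s + 1)
          * (s * deriv (sigmaFn α β) s - sigmaFn α β s)
        - α ^ 2 * (deriv (sigmaFn α β) s) ^ 2 = 0) ∧
    -- the initial conditions, as values and as limits at `0` from the right
    sigmaFn α β 0 = 0 ∧
    Tendsto (sigmaFn α β) (𝓝[>] 0) (𝓝 0) ∧
    HasDerivWithinAt (sigmaFn α β) 0 (Set.Ici 0) 0 ∧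
    Tendsto (deriv (sigmaFn α β)) (𝓝[>] 0) (𝓝 0) := by
  obtain ⟨F, hd, hF⟩ := exists_edgeDet_limit hα hβ
  obtain ⟨C, hC, hFC⟩ := norm_limit_sub_one_le hα hβ hF
  have hopen : IsOpen {z : ℂ | 0 < z.re} := isOpen_lt continuous_const Complex.continuous_re
  set P := reDeriv F with hPdef
  have hlim : ∀ s : ℝ, 0 < s → Tendsto (fun n : ℕ => jacobiProb (s / (4 * (n : ℝ) ^ 2)) α β n)
      atTop (𝓝 (P 0 s)) := fun s hs => tendsto_jacobiProb hα hβ hF hs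
  have hpos : ∀ s : ℝ, 0 < s → 0 < P 0 s := fun s hs =>
    (Real.exp_pos _).trans_le (exp_le_of_tendsto_jacobiProb hα hβ hs.le (hlim s hs))
  have hscaled : ∀ s : ℝ, 0 < s → scaledProb s α β = P 0 s := fun s hs => (hlim s hs).limUnder_eq
  have hP : ∀ s : ℝ, 0 < s → ∀ k, HasDerivAt (P k) (P (k + 1) s) s := fun s hs =>
    hasDerivAt_reDeriv hopen hd hs
  have hlog : ∀ s : ℝ, 0 < s →
      HasDerivAt (fun u : ℝ => Real.log (scaledProb u α β)) (logD0 P s) s := fun s hs =>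
    ((hP s hs 0).log (hpos s hs).ne').congr_of_eventuallyEq (by
      filter_upwards [lt_mem_nhds hs] with u hu
      rw [hscaled u hu])
  have hsig : ∀ s : ℝ, 0 < s → sigmaFn α β s = sig 0 P s := fun s hs => by
    rw [sigmaFn, (hlog s hs).deriv, sig]
    ring
  have hsig1 : ∀ s : ℝ, 0 < s → HasDerivAt (sigmaFn α β) (sig1 0 P s) s := fun s hs =>
    (hasDerivAt_sig 0 (hP s hs) (hpos s hs).ne').congr_of_eventuallyEq (by
      filter_upwards [lt_mem_nhds hs] with u hu using hsig u hu)
  have hsig2 : ∀ s : ℝ, 0 < s → HasDerivAt (deriv (sigmaFn α β)) (sig2 0 P s) s := fun s hs =>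
    (hasDerivAt_sig1 0 (hP s hs) (hpos s hs).ne').congr_of_eventuallyEq (by
      filter_upwards [lt_mem_nhds hs] with u hu using (hsig1 u hu).deriv)
  have hsigma0 : sigmaFn α β 0 = 0 := zero_mul _
  have hid : Tendsto (fun s : ℝ => s) (𝓝[>] 0) (𝓝 0) := nhdsWithin_le_nhds
  have hP0 : Tendsto (P 0) (𝓝[>] 0) (𝓝 1) := tendsto_reDeriv_zero_one hα hFC
  have hP1 : Tendsto (P 1) (𝓝[>] 0) (𝓝 0) := by
    simpa using tendsto_reDeriv_zero_right hd hα hC hFC 0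
  have hP2 : Tendsto (fun s => s * P 2 s) (𝓝[>] 0) (𝓝 0) := by
    simpa using tendsto_reDeriv_zero_right hd hα hC hFC 1
  have hL0 : Tendsto (logD0 P) (𝓝[>] 0) (𝓝 0) := by
    have h := hP1.div hP0 one_ne_zero
    rw [zero_div] at h
    exact h
  -- This is `s (log P)''`. Only the product with `s` is controlled, since the second derivative
  -- itself need not stay bounded; it is what `σ' = (log P)' + s (log P)''` requires.
  have hL1 : Tendsto (fun s => s * P 2 s / P 0 s - s * logD0 P s ^ 2) (𝓝[>] 0) (𝓝 0) := by
    simpa using (hP2.div hP0 one_ne_zero).sub (hid.mul (hL0.pow 2))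
  refine ⟨fun s hs => ?_, fun s hs => ⟨(hlog s hs).differentiableAt,
    (hsig1 s hs).differentiableAt, (hsig2 s hs).differentiableAt, ?_⟩, hsigma0, ?_, ?_, ?_⟩
  -- The holomorphic limit lives on the open half plane, so `s = 0` is separate: there every finite
  -- probability equals `1`.
  · obtain rfl | hs := hs.eq_or_lt
    · have h1 : Tendsto (fun n : ℕ => jacobiProb (0 / (4 * (n : ℝ) ^ 2)) α β n) atTop (𝓝 1) := by
        simp only [zero_div, jacobiProb_zero hα hβ]
        exact tendsto_const_nhds
      rw [scaledProb, h1.limUnder_eq]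
      exact ⟨h1, zero_lt_one⟩
    · rw [hscaled s hs]
      exact ⟨hlim s hs, hpos s hs⟩
  · have h := sigmaDefect_limit hα hβ hF hs (hpos s hs).ne'
    rw [sigmaDefect_zero] at h
    rw [(hsig2 s hs).deriv, (hsig1 s hs).deriv, hsig s hs]
    exact (mul_eq_zero.1 h).resolve_left (by positivity)
  · have h := hid.mul hL0
    rw [zero_mul] at h
    refine h.congr' ?_
    filter_upwards [self_mem_nhdsWithin] with s hs
    rw [hsig s hs, sig]
    ring
  -- The difference quotient `σ(s) / s` at `0` is the logarithmic derivative itself.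
  · rw [hasDerivWithinAt_iff_tendsto_slope, Set.Ici_sdiff_left]
    refine hL0.congr' ?_
    filter_upwards [self_mem_nhdsWithin] with s hs
    have hs' : s ≠ 0 := (Set.mem_Ioi.1 hs).ne'
    rw [slope_def_field, hsigma0, hsig s hs, sig]
    field_simp
    ring
  · have h := hL0.add hL1
    rw [add_zero] at h
    refine h.congr' ?_
    filter_upwards [self_mem_nhdsWithin] with s hs
    rw [(hsig1 s hs).deriv, sig1, logD1]
    ring
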